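/- Let $F$ be a closed (compact, without boundary) smooth manifold, let $Q\subset\mathbb{R}^n$ be open, and let $(g_q)_{q\in Q}$ be a family of Riemannian metrics on $F$ that is smooth jointly in $(x,q)\in F\times Q$; let $\Delta=\Delta_{g_q}$ be the Laplace–Beltrami operator of $g_q$. Let $I\subseteq\mathbb{R}$ be an interval, $T>0$, $D=F\times I\times Q$ and $\tilde D=F\times Q$, and let $f\in C^\infty(D)$ and $u_0\in C^\infty(\tilde D)$ be real-valued functions with $u_0(x,q)\in I$ for all $x\in F$, $q\in Q$. Consider the Cauchy problem $$\partial_t u=\Delta u+f(x,u,q),\qquad u(x,0,q)=u_0(x,q).$$ Here, for fixed $q\in Q$, a solution on $F\times[0,T]$ is a continuous function with values in $I$ that is $C^2$ in $x$ for every $t\in[0,T]$, is differentiable in $t$ on $[0,T]$ (one-sidedly at the end points), and satisfies the equation on $F\times[0,T]$ and the initial condition. Suppose that all partial derivatives (of order at least one, in the charts of $F$) of $f$ with respect to $x,u,q$ are bounded on $D$, and all those of $u_0$ with respect to $x,q$ are bounded on $\tilde D$. Suppose that $u:F\times[0,T]\times Q\to\mathbb{R}$ is such that for every $q\in Q$ the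 function $u(\cdot,\cdot,q)$ is the unique solution of the Cauchy problem, that $u(\cdot,t,q)\in C^\infty(F)$ for all $t\in[0,T]$ and $q\in Q$, and that all partial derivatives of $u$ with respect to $x$ (of order at least one) are bounded on $F\times[0,T]\times Q$. (Bounded in the charts of $F$ means: for every chart with domain $U$, every compact $K\subset U$ and every order, the derivatives of that order in the coordinates of the chart are bounded for $x\in K$, uniformly in the other variables.) Then $u(\cdot,t,\cdot)\in C^\infty(F\times Q)$ for every $t\in[0,T]$. -/

import Mathlib

open Set Bundle Manifold
open scoped ContDiff

noncomputable section

namespace ParamHeat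

/-- The coordinate vector field `∂/∂yⁱ` of the chart around `x₀`, at the point whose coordinates
are `y`. -/
def coordVec {p : ℕ} {F : Type*} [TopologicalSpace F]
    [ChartedSpace (EuclideanSpace ℝ (Fin p)) F]
    (x₀ : F) (i : Fin p) (y : EuclideanSpace ℝ (Fin p)) :
    TangentSpace (𝓡 p) ((extChartAt (𝓡 p) x₀).symm y) :=
  mfderiv (𝓡 p) (𝓡 p) (extChartAt (𝓡 p) x₀).symm y (EuclideanSpace.single i (1 : ℝ))

/-- The matrix `(g_ij)` of a Riemannian metric in the chart around `x₀`, as a function of the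
coordinates `y`. -/
def gramMatrix {p : ℕ} {F : Type*} [TopologicalSpace F]
    [ChartedSpace (EuclideanSpace ℝ (Fin p)) F] [IsManifold (𝓡 p) ∞ F]
    (g : ContMDiffRiemannianMetric (𝓡 p) ∞ (EuclideanSpace ℝ (Fin p))
      (fun x : F => TangentSpace (𝓡 p) x))
    (x₀ : F) (y : EuclideanSpace ℝ (Fin p)) : Matrix (Fin p) (Fin p) ℝ :=
  Matrix.of fun i j =>
    g.inner ((extChartAt (𝓡 p) x₀).symm y) (coordVec x₀ i y) (coordVec x₀ j y)

/-- The partial derivative `∂h/∂yⁱ` on `ℝᵖ`. -/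
def partialDeriv {p : ℕ} (i : Fin p) (h : EuclideanSpace ℝ (Fin p) → ℝ)
    (y : EuclideanSpace ℝ (Fin p)) : ℝ :=
  fderiv ℝ h y (EuclideanSpace.single i (1 : ℝ))

/-- The Laplace-Beltrami operator `Δ_g w = div grad w`, computed at `x` in the chart around `x` by
`Δ_g w = (det g)^(-1/2) ∑ i, ∂_i ((det g)^(1/2) ∑ j, g^ij ∂_j w)`. -/
def laplacian {p : ℕ} {F : Type*} [TopologicalSpace F]
    [ChartedSpace (EuclideanSpace ℝ (Fin p)) F] [IsManifold (𝓡 p) ∞ F]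
    (g : ContMDiffRiemannianMetric (𝓡 p) ∞ (EuclideanSpace ℝ (Fin p))
      (fun x : F => TangentSpace (𝓡 p) x))
    (w : F → ℝ) (x : F) : ℝ :=
  (Real.sqrt (gramMatrix g x (extChartAt (𝓡 p) x x)).det)⁻¹ *
    ∑ i, partialDeriv i
      (fun y => Real.sqrt (gramMatrix g x y).det *
        ∑ j, (gramMatrix g x y)⁻¹ i j *
          partialDeriv j (fun y' => w ((extChartAt (𝓡 p) x).symm y')) y)
      (extChartAt (𝓡 p) x x)

/-- `v : F × [0,T] → J` is a (classical) solution of the Cauchy problem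
`∂_t v = Δ_g v + f(x, v)`, `v(x, 0) = v₀(x)`. The time derivative is one-sided at the end
points of `[0,T]`. -/
structure IsSolution {p : ℕ} {F : Type*} [TopologicalSpace F]
    [ChartedSpace (EuclideanSpace ℝ (Fin p)) F] [IsManifold (𝓡 p) ∞ F]
    (g : ContMDiffRiemannianMetric (𝓡 p) ∞ (EuclideanSpace ℝ (Fin p))
      (fun x : F => TangentSpace (𝓡 p) x))
    (J : Set ℝ) (T : ℝ) (f : F → ℝ → ℝ) (v₀ : F → ℝ) (v : F → ℝ → ℝ) : Prop where
  mem : ∀ x, ∀ t ∈ Icc 0 T, v x t ∈ J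
  continuousOn : ContinuousOn (fun z : F × ℝ => v z.1 z.2) (univ ×ˢ Icc 0 T)
  contMDiff : ∀ t ∈ Icc 0 T, ContMDiff (𝓡 p) 𝓘(ℝ, ℝ) 2 (fun x => v x t)
  equation : ∀ x, ∀ t ∈ Icc 0 T,
    HasDerivWithinAt (fun s => v x s) (laplacian g (fun x' => v x' t) x + f x (v x t))
      (Icc 0 T) t
  initial : ∀ x, v x 0 = v₀ x

/-- All partial derivatives (of order at least one) of `h(x, a)` in the local coordinates of `x`
and in the parameter `a` are bounded on `F × S`: in every chart, those of each order are bounded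
on `K × S` for every compact part `K` of the chart domain. On a compact manifold this amounts to
boundedness in the charts of a finite cover by such sets `K`. -/
def BoundedDerivs {p : ℕ} {F : Type*} [TopologicalSpace F]
    [ChartedSpace (EuclideanSpace ℝ (Fin p)) F]
    {V : Type*} [NormedAddCommGroup V] [NormedSpace ℝ V]
    (S : Set V) (h : F → V → ℝ) : Prop :=
  ∀ k : ℕ, 1 ≤ k → ∀ x₀ : F, ∀ K : Set F, IsCompact K → K ⊆ (extChartAt (𝓡 p) x₀).source →
    ∃ C : ℝ, ∀ x ∈ K, ∀ a ∈ S,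
      ‖iteratedFDerivWithin ℝ k
        (fun z : EuclideanSpace ℝ (Fin p) × V => h ((extChartAt (𝓡 p) x₀).symm z.1) z.2)
        ((extChartAt (𝓡 p) x₀).target ×ˢ S) (extChartAt (𝓡 p) x₀ x, a)‖ ≤ C

/-- All partial derivatives (of order at least one) in the local coordinates of `x` alone of a
family `w a`, `a ∈ S`, of functions on `F` are bounded on `F × S`. -/
def BoundedSpaceDerivs {p : ℕ} {F : Type*} [TopologicalSpace F]
    [ChartedSpace (EuclideanSpace ℝ (Fin p)) F]
    {A : Type*} (S : Set A) (w : A → F → ℝ) : Prop :=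
  ∀ k : ℕ, 1 ≤ k → ∀ x₀ : F, ∀ K : Set F, IsCompact K → K ⊆ (extChartAt (𝓡 p) x₀).source →
    ∃ C : ℝ, ∀ x ∈ K, ∀ a ∈ S,
      ‖iteratedFDeriv ℝ k (fun y => w a ((extChartAt (𝓡 p) x₀).symm y))
        (extChartAt (𝓡 p) x₀ x)‖ ≤ C

end ParamHeat

end

set_option linter.unusedSectionVars false

noncomputable section

namespace ParamHeat

open Filter Topology

/-! ### Interpolation between derivatives of orders j and j + 2 -/

section Interpolation

variable {E G : Type*} [NormedAddCommGroup E] [NormedSpace ℝ E]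
  [NormedAddCommGroup G] [NormedSpace ℝ G]

/-! No existence theory or Schauder estimate for parabolic equations is used. The proof rests on two
tools: the maximum principle, which controls sup norms, and interpolation, which uses the assumed
bounds on all spatial derivatives to carry sup-norm estimates over to every derivative.

Maximum principle (`le_of_parabolic_inequality`, `EllipticFamily.supBd`): if z solves an equation
with principal part L_q and right-hand side at most K|z| + β in absolute value, and |z| ≤ β
initially, then |z| ≤ exp((K+1)T) β. Interpolation (`jetBd_of_supBd`): a family that is O(ρ^θ) in
sup norm, with all derivatives O(ρ^(-c)), has all its derivatives O(ρ^e) for every e < θ. The loss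
is arbitrarily small, and for this reason every remainder estimate below (`RemBd`) asks for an
exponent e + θ with an unspecified θ > 0. The class `CkH` of k times differentiable families, with
remainders of this kind, is then stable under the whole argument.

Differentiability in q. The difference v_q' - v_q solves a parabolic equation with small right-hand
side, since the increment of the operator falls on v_q', whose spatial derivatives are bounded;
hence v is Hölder continuous in q in all derivatives (`Sol.holder`). Consecutive dyadic difference
quotients in a coordinate direction solve the same linearized equation up to errors of size 2^(-mθ),
so their difference is geometrically small in sup norm. Their derivatives grow at most like 2^m, and
interpolation makes the quotients geometrically Cauchy in every seminorm (`dyadicQuot_cauchy`). The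
limits w_i solve the linearized equation, and the same two tools applied to v_q' - v_q - ∑ (q'_i -
q_i) w_i show that they are the partial derivatives (`Sol.exists_deriv`).

Higher order. Each w_i solves a linear equation of the same type whose data involve v itself and
derivatives of f, g and u₀, so induction on k applies, first for linear equations
(`Sol.ckH_of_linear`) and then for the semilinear one (`Sol.ckH_of_semilinear`). Since all spatial
derivatives are differentiated along with v, joint smoothness follows (`contMDiffOn_of_ckH`).

The geometric input (`SmoothMetrics.exists_ellipticFamily`) is that the Laplacian can be computed in
any chart, by the Piola identity. It thus becomes a finite sum of coefficients smooth in q times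
fixed differential operators of orders one and two, and it is nonpositive at a spatial maximum. -/

lemma differentiableAt_iteratedFDeriv_of_contDiffOn {f : E → G} {U : Set E} (hU : IsOpen U)
    (hf : ContDiffOn ℝ ∞ f U) (j : ℕ) {y : E} (hy : y ∈ U) :
    DifferentiableAt ℝ (iteratedFDeriv ℝ j f) y := by
  have h : ContDiffAt ℝ ∞ f y := hf.contDiffAt (hU.mem_nhds hy)
  have h1 : ContDiffAt ℝ 1 (iteratedFDeriv ℝ j f) y :=
    h.iteratedFDeriv_right (m := 1) (i := j) (by exact_mod_cast le_top)
  exact h1.differentiableAt (by norm_num)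

set_option synthInstance.maxHeartbeats 200000 in
-- A Landau–Kolmogorov inequality. For a unit vector v the increment of the j-th derivative over the
-- step s v differs from s times its derivative at y by at most B s², because on the ball that
-- derivative oscillates by at most B s. The increment itself is at most 2A.
lemma norm_iteratedFDeriv_interpolation {f : E → G} {U : Set E} (hU : IsOpen U)
    (hf : ContDiffOn ℝ ∞ f U) (j : ℕ) {y : E} {s A B : ℝ} (hs : 0 < s)
    (hyU : Metric.closedBall y s ⊆ U)
    (hA : ∀ z ∈ Metric.closedBall y s, ‖iteratedFDeriv ℝ j f z‖ ≤ A)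
    (hB : ∀ z ∈ Metric.closedBall y s, ‖iteratedFDeriv ℝ (j + 2) f z‖ ≤ B) :
    ‖iteratedFDeriv ℝ (j + 1) f y‖ ≤ 2 * A / s + B * s := by
  have hyy : y ∈ Metric.closedBall y s := Metric.mem_closedBall_self hs.le
  have hA0 : 0 ≤ A := (norm_nonneg _).trans (hA y hyy)
  have hB0 : 0 ≤ B := (norm_nonneg _).trans (hB y hyy)
  have hconv : Convex ℝ (Metric.closedBall y s) := convex_closedBall y s
  have hlip : ∀ z ∈ Metric.closedBall y s,
      ‖fderiv ℝ (iteratedFDeriv ℝ j f) z - fderiv ℝ (iteratedFDeriv ℝ j f) y‖ ≤ B * s := by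
    intro z hz
    have h1 : ‖iteratedFDeriv ℝ (j + 1) f z - iteratedFDeriv ℝ (j + 1) f y‖ ≤ B * ‖z - y‖ := by
      refine hconv.norm_image_sub_le_of_norm_fderiv_le (𝕜 := ℝ) ?_ ?_ hyy hz
      · intro w hw
        exact differentiableAt_iteratedFDeriv_of_contDiffOn hU hf _ (hyU hw)
      · intro w hw
        rw [norm_fderiv_iteratedFDeriv]
        exact hB w hw
    have h2 : fderiv ℝ (iteratedFDeriv ℝ j f) z - fderiv ℝ (iteratedFDeriv ℝ j f) y =
        continuousMultilinearCurryLeftEquiv ℝ (fun _ : Fin (j + 1) => E) G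
          (iteratedFDeriv ℝ (j + 1) f z - iteratedFDeriv ℝ (j + 1) f y) := by
      rw [fderiv_iteratedFDeriv]
      simp only [Function.comp_apply]
      rfl
    rw [h2, LinearIsometryEquiv.norm_map]
    refine h1.trans (mul_le_mul_of_nonneg_left ?_ hB0)
    rw [← dist_eq_norm]; exact hz
  rw [← norm_fderiv_iteratedFDeriv]
  refine ContinuousLinearMap.opNorm_le_of_unit_norm (𝕜 := ℝ) (by positivity) ?_
  intro v hv
  have hz : y + s • v ∈ Metric.closedBall y s := by
    simp [norm_smul, hv, abs_of_pos hs]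
  have h3 := hconv.norm_image_sub_le_of_norm_hasFDerivWithin_le'
    (f := iteratedFDeriv ℝ j f) (φ := fderiv ℝ (iteratedFDeriv ℝ j f) y)
    (fun w hw => (differentiableAt_iteratedFDeriv_of_contDiffOn hU hf j
      (hyU hw)).hasFDerivAt.hasFDerivWithinAt) hlip hyy hz
  rw [add_sub_cancel_left, norm_smul, hv, mul_one, Real.norm_of_nonneg hs.le, map_smul] at h3
  have h4 : ‖s • (fderiv ℝ (iteratedFDeriv ℝ j f) y) v‖ ≤ B * s * s + 2 * A := by
    have h5 : s • (fderiv ℝ (iteratedFDeriv ℝ j f) y) v =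
      (iteratedFDeriv ℝ j f (y + s • v) - iteratedFDeriv ℝ j f y) -
      (iteratedFDeriv ℝ j f (y + s • v) - iteratedFDeriv ℝ j f y -
        s • (fderiv ℝ (iteratedFDeriv ℝ j f) y) v) := by abel
    rw [h5]
    refine (norm_sub_le _ _).trans ?_
    have := norm_sub_le (iteratedFDeriv ℝ j f (y + s • v)) (iteratedFDeriv ℝ j f y)
    have := hA _ hz
    have := hA _ hyy
    linarith
  rw [norm_smul, Real.norm_of_nonneg hs.le] at h4
  have h6 : 2 * A / s + B * s = (B * s * s + 2 * A) / s := by field_simp; ring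
  rw [h6, le_div_iff₀ hs]
  linarith

end Interpolation

/-! ### A concavity lemma for sequences of exponents -/

section Sequences

/-- If the sequence drops by d > 0 once, the minimum must afterwards be the midpoint, so every later
drop is at least d and the sequence falls below any bound. It is applied to the optimal decay
exponents of the j-th derivatives of a family. -/
lemma monotone_of_min_midpoint_le {e : ℕ → ℝ} {c : ℝ} (hc : ∀ j, c ≤ e j)
    (h : ∀ j, min (e j) ((e j + e (j + 2)) / 2) ≤ e (j + 1)) : Monotone e := by
  refine monotone_nat_of_le_succ fun j => ?_
  by_contra hlt
  push Not at hlt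
  set d := e j - e (j + 1) with hd
  have hd0 : 0 < d := by linarith
  have key : ∀ k : ℕ, d ≤ e (j + k) - e (j + k + 1) := by
    intro k
    induction k with
    | zero => simp [hd]
    | succ k ih =>
      have h1 := h (j + k)
      have h2 : e (j + k + 1) < e (j + k) := by linarith
      rcases min_le_iff.1 h1 with h3 | h3
      · linarith
      · have : e (j + (k + 1) + 1) = e (j + k + 2) := by ring_nf
        rw [this, ← add_assoc]
        linarith
  have key2 : ∀ k : ℕ, e (j + k) ≤ e j - k * d := by
    intro k
    induction k with
    | zero => simp
    | succ k ih =>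
      have := key k
      push_cast
      rw [← add_assoc]
      linarith
  obtain ⟨k, hk⟩ := exists_nat_gt ((e j - c) / d)
  rw [div_lt_iff₀ hd0] at hk
  have := key2 k
  have := hc (j + k)
  linarith

end Sequences

/-! ### Seminorms of smooth functions in charts, and interpolation for families -/

section Jets

variable {p n : ℕ} {F : Type*} [TopologicalSpace F] [ChartedSpace (EuclideanSpace ℝ (Fin p)) F]

variable (p) in
/-- The expression of a function in the chart around `x₀`. -/
def rep (x₀ : F) (φ : F → ℝ) (y : EuclideanSpace ℝ (Fin p)) : ℝ :=
  φ ((extChartAt (𝓡 p) x₀).symm y)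

variable (p) in
/-- The `j`-th derivative at `x` of `φ` in the chart around `x₀`. -/
def jet (j : ℕ) (x₀ : F) (φ : F → ℝ) (x : F) :
    ContinuousMultilinearMap ℝ (fun _ : Fin j => EuclideanSpace ℝ (Fin p)) ℝ :=
  iteratedFDeriv ℝ j (rep p x₀ φ) (extChartAt (𝓡 p) x₀ x)

variable (p F) in
/-- A compact part of a chart domain. -/
structure ChartCompact where
  center : F
  carrier : Set F
  isCompact : IsCompact carrier
  subset : carrier ⊆ (extChartAt (𝓡 p) center).source

variable (p) in
/-- Smoothness in `x` for all times in `[0, T]`. -/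
def SpaceSmooth (T : ℝ) (v : F → ℝ → ℝ) : Prop :=
  ∀ t ∈ Icc 0 T, ContMDiff (𝓡 p) 𝓘(ℝ, ℝ) ∞ (fun x => v x t)

/-- `|v| ≤ C` on `F × [0, T]`. -/
def SupBd (T : ℝ) (_ : Unit) (v : F → ℝ → ℝ) (C : ℝ) : Prop :=
  ∀ t ∈ Icc 0 T, ∀ x, |v x t| ≤ C

variable (p) in
/-- The function is smooth in `x`, and `C` bounds one of the seminorms of `C^∞(F)`,
uniformly in `t ∈ [0, T]`: the supremum norm for the index `none`, or the derivatives of order `j`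
on the part `κ` of a chart for the index `some (κ, j)`. -/
def JetBd (T : ℝ) : Option (ChartCompact p F × ℕ) → (F → ℝ → ℝ) → ℝ → Prop
  | none, v, C => SpaceSmooth p T v ∧ SupBd T () v C
  | some (κ, j), v, C => SpaceSmooth p T v ∧
      ∀ t ∈ Icc 0 T, ∀ x ∈ κ.carrier, ‖jet p j κ.center (fun x => v x t) x‖ ≤ C

lemma JetBd.smooth {T : ℝ} {s : Option (ChartCompact p F × ℕ)} {v : F → ℝ → ℝ} {C : ℝ}
    (h : JetBd p T s v C) : SpaceSmooth p T v := by
  cases s <;> exact h.1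

lemma contDiffOn_rep [IsManifold (𝓡 p) ∞ F] {φ : F → ℝ} (hφ : ContMDiff (𝓡 p) 𝓘(ℝ, ℝ) ∞ φ)
    (x₀ : F) : ContDiffOn ℝ ∞ (rep p x₀ φ) (extChartAt (𝓡 p) x₀).target := by
  rw [← contMDiffOn_iff_contDiffOn]
  exact hφ.comp_contMDiffOn (contMDiffOn_extChartAt_symm x₀)

lemma jet_zero_norm (x₀ : F) (φ : F → ℝ) {x : F} (hx : x ∈ (extChartAt (𝓡 p) x₀).source) :
    ‖jet p 0 x₀ φ x‖ = |φ x| := by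
  rw [jet, norm_iteratedFDeriv_zero, rep, (extChartAt (𝓡 p) x₀).left_inv hx, Real.norm_eq_abs]

lemma JetBd.some_zero {T : ℝ} {κ : ChartCompact p F} {v : F → ℝ → ℝ} {C : ℝ}
    (h : JetBd p T none v C) : JetBd p T (some (κ, 0)) v C :=
  ⟨h.1, fun t ht x hx => by rw [jet_zero_norm _ _ (κ.subset hx)]; exact h.2 t ht x⟩

lemma jet_add [IsManifold (𝓡 p) ∞ F] {φ ψ : F → ℝ} (hφ : ContMDiff (𝓡 p) 𝓘(ℝ, ℝ) ∞ φ)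
    (hψ : ContMDiff (𝓡 p) 𝓘(ℝ, ℝ) ∞ ψ) (j : ℕ) (x₀ : F) {x : F}
    (hx : x ∈ (extChartAt (𝓡 p) x₀).source) :
    jet p j x₀ (fun x => φ x + ψ x) x = jet p j x₀ φ x + jet p j x₀ ψ x := by
  have hy := (extChartAt (𝓡 p) x₀).map_source hx
  have ho := isOpen_extChartAt_target (I := 𝓡 p) x₀
  have h1 := ((contDiffOn_rep hφ x₀).contDiffAt (ho.mem_nhds hy)).of_le
    (show (j : WithTop ℕ∞) ≤ ∞ by exact_mod_cast le_top)
  have h2 := ((contDiffOn_rep hψ x₀).contDiffAt (ho.mem_nhds hy)).of_le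
    (show (j : WithTop ℕ∞) ≤ ∞ by exact_mod_cast le_top)
  exact iteratedFDeriv_add_apply h1 h2

lemma jet_const_mul [IsManifold (𝓡 p) ∞ F] {φ : F → ℝ} (hφ : ContMDiff (𝓡 p) 𝓘(ℝ, ℝ) ∞ φ)
    (c : ℝ) (j : ℕ) (x₀ : F) {x : F} (hx : x ∈ (extChartAt (𝓡 p) x₀).source) :
    jet p j x₀ (fun x => c * φ x) x = c • jet p j x₀ φ x := by
  have hy := (extChartAt (𝓡 p) x₀).map_source hx
  have ho := isOpen_extChartAt_target (I := 𝓡 p) x₀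
  have h1 := ((contDiffOn_rep hφ x₀).contDiffAt (ho.mem_nhds hy)).of_le
    (show (j : WithTop ℕ∞) ≤ ∞ by exact_mod_cast le_top)
  exact iteratedFDeriv_const_smul_apply (a := c) h1

/-- The inequality at a point of `κ` needs bounds on a ball around it. These are taken on a compact
thickening of `κ` in the same chart; since the hypotheses hold for all compact parts, shrinking the
domain costs nothing. -/
lemma jetBd_interpolation [IsManifold (𝓡 p) ∞ F] {Λ : Type*} {l : Filter Λ} {T : ℝ}
    {φ : Λ → F → ℝ → ℝ}
    {γ₁ γ₂ s : Λ → ℝ} {j : ℕ} (hs : ∀ᶠ i in l, 0 < s i ∧ s i ≤ 1)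
    (hγ₁ : ∀ᶠ i in l, 0 ≤ γ₁ i) (hγ₂ : ∀ᶠ i in l, 0 ≤ γ₂ i)
    (h1 : ∀ κ : ChartCompact p F, ∃ C, ∀ᶠ i in l, JetBd p T (some (κ, j)) (φ i) (C * γ₁ i))
    (h2 : ∀ κ : ChartCompact p F, ∃ C, ∀ᶠ i in l, JetBd p T (some (κ, j + 2)) (φ i) (C * γ₂ i))
    (κ : ChartCompact p F) :
    ∃ C, ∀ᶠ i in l, JetBd p T (some (κ, j + 1)) (φ i) (C * (γ₁ i / s i + γ₂ i * s i)) := by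
  set e := extChartAt (𝓡 p) κ.center with he
  have ho : IsOpen e.target := isOpen_extChartAt_target κ.center
  have hcomp : IsCompact (e '' κ.carrier) :=
    κ.isCompact.image_of_continuousOn ((continuousOn_extChartAt κ.center).mono κ.subset)
  have hsub : e '' κ.carrier ⊆ e.target := by
    rintro _ ⟨x, hx, rfl⟩; exact e.map_source (κ.subset hx)
  obtain ⟨δ, hδ, hδt⟩ := hcomp.exists_cthickening_subset_open ho hsub
  let κ' : ChartCompact p F :=
    { center := κ.center
      carrier := e.symm '' (Metric.cthickening δ (e '' κ.carrier))
      isCompact := hcomp.cthickening.image_of_continuousOn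
        ((continuousOn_extChartAt_symm κ.center).mono hδt)
      subset := by
        rintro _ ⟨y, hy, rfl⟩
        exact e.map_target (hδt hy) }
  obtain ⟨C₁, hC₁⟩ := h1 κ'
  obtain ⟨C₂, hC₂⟩ := h2 κ'
  set r := min δ 1
  have hr : 0 < r := lt_min hδ one_pos
  refine ⟨2 * |C₁| / r + |C₂| * r, ?_⟩
  filter_upwards [hs, hγ₁, hγ₂, hC₁, hC₂] with i ⟨hs0, hs1⟩ hg1 hg2 hb1 hb2
  refine ⟨hb1.1, fun t ht x hx => ?_⟩
  have hball : Metric.closedBall (e x) (r * s i) ⊆ Metric.cthickening δ (e '' κ.carrier) := by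
    refine (Metric.closedBall_subset_closedBall ?_).trans
      (Metric.closedBall_subset_cthickening (mem_image_of_mem _ hx) δ)
    calc r * s i ≤ δ * 1 := mul_le_mul (min_le_left _ _) hs1 hs0.le hδ.le
      _ = δ := mul_one _
  have key : ∀ k C γ, JetBd p T (some (κ', k)) (φ i) (C * γ) → 0 ≤ γ →
      ∀ z ∈ Metric.closedBall (e x) (r * s i),
      ‖iteratedFDeriv ℝ k (rep p κ.center fun x => φ i x t) z‖ ≤ |C| * γ := by
    intro k C γ hb hγ z hz
    have h := hb.2 t ht (e.symm z) (mem_image_of_mem _ (hball hz))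
    rw [jet, show extChartAt (𝓡 p) κ'.center (e.symm z) = z from e.right_inv (hδt (hball hz))] at h
    exact h.trans (mul_le_mul_of_nonneg_right (le_abs_self _) hγ)
  have h3 := norm_iteratedFDeriv_interpolation ho (contDiffOn_rep (hb1.1 t ht) κ.center) j
    (mul_pos hr hs0) (hball.trans hδt) (key _ _ _ hb1 hg1) (key _ _ _ hb2 hg2)
  refine h3.trans ?_
  have e1 : 2 * (|C₁| * γ₁ i) / (r * s i) = (2 * |C₁| / r) * (γ₁ i / s i) := by field_simp
  have e2 : |C₂| * γ₂ i * (r * s i) = (|C₂| * r) * (γ₂ i * s i) := by ring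
  rw [e1, e2, mul_add, add_mul, add_mul]
  have p1 : 0 ≤ |C₂| * r * (γ₁ i / s i) := by positivity
  have p2 : 0 ≤ 2 * |C₁| / r * (γ₂ i * s i) := by positivity
  linarith

lemma JetBd.mono {T : ℝ} {s : Option (ChartCompact p F × ℕ)} {v : F → ℝ → ℝ} {C C' : ℝ}
    (h : JetBd p T s v C) (hC : C ≤ C') : JetBd p T s v C' := by
  rcases s with _ | ⟨κ, j⟩
  · exact ⟨h.1, fun t ht x => (h.2 t ht x).trans hC⟩
  · exact ⟨h.1, fun t ht x hx => (h.2 t ht x hx).trans hC⟩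

/-- A family of functions whose supremum norm is `O(ρ^θ)` and whose derivatives are all
`O(ρ^(-c))` has derivatives of order `O(ρ^e)`, for every `e < θ`. -/
theorem jetBd_of_supBd [IsManifold (𝓡 p) ∞ F] {Λ : Type*} {l : Filter Λ} {T : ℝ}
    {φ : Λ → F → ℝ → ℝ} {ρ : Λ → ℝ} (hρ : ∀ᶠ i in l, 0 < ρ i ∧ ρ i ≤ 1) {θ c : ℝ}
    (hsup : ∃ C, ∀ᶠ i in l, JetBd p T none (φ i) (C * ρ i ^ θ))
    (hjet : ∀ (κ : ChartCompact p F) j, 1 ≤ j →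
      ∃ C, ∀ᶠ i in l, JetBd p T (some (κ, j)) (φ i) (C * ρ i ^ (-c)))
    {e : ℝ} (he : e < θ) (s : Option (ChartCompact p F × ℕ)) :
    ∃ C, ∀ᶠ i in l, JetBd p T s (φ i) (C * ρ i ^ e) := by
  have hle : ∀ a b : ℝ, a ≤ b → ∀ s : Option (ChartCompact p F × ℕ),
      (∃ C, ∀ᶠ i in l, JetBd p T s (φ i) (C * ρ i ^ b)) →
      ∃ C, ∀ᶠ i in l, JetBd p T s (φ i) (C * ρ i ^ a) := by
    rintro a b hab s ⟨C, hC⟩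
    refine ⟨|C|, ?_⟩
    filter_upwards [hC, hρ] with i hi hr
    refine hi.mono ?_
    refine mul_le_mul (le_abs_self _) (Real.rpow_le_rpow_of_exponent_ge hr.1 hr.2 hab)
      (Real.rpow_nonneg hr.1.le _) (abs_nonneg _)
  -- The admissible decay exponents of the derivatives of order j, capped at θ so that suprema
  -- exist. Interpolation makes the suprema satisfy the midpoint condition, so none of them is below
  -- the one for j = 0, which is θ.
  let S : ℕ → Set ℝ := fun j => {a | a ≤ θ ∧ ∀ κ : ChartCompact p F,
    ∃ C, ∀ᶠ i in l, JetBd p T (some (κ, j)) (φ i) (C * ρ i ^ a)}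
  have hS0 : θ ∈ S 0 := by
    refine ⟨le_rfl, fun κ => ?_⟩
    obtain ⟨C, hC⟩ := hsup
    exact ⟨C, hC.mono fun i hi => hi.some_zero⟩
  set b := min (-c) θ
  have hSb : ∀ j, b ∈ S j := by
    intro j
    refine ⟨min_le_right _ _, fun κ => ?_⟩
    rcases Nat.eq_zero_or_pos j with rfl | hj
    · exact hle _ _ (min_le_right _ _) _ (hS0.2 κ)
    · exact hle _ _ (min_le_left _ _) _ (hjet κ j hj)
  have hbdd : ∀ j, BddAbove (S j) := fun j => ⟨θ, fun a ha => ha.1⟩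
  have hdown : ∀ j a, a < sSup (S j) → a ∈ S j := by
    intro j a ha
    obtain ⟨a', ha', haa'⟩ := exists_lt_of_lt_csSup ⟨b, hSb j⟩ ha
    exact ⟨haa'.le.trans ha'.1, fun κ => hle _ _ haa'.le _ (ha'.2 κ)⟩
  have hmono : Monotone fun j => sSup (S j) := by
    refine monotone_of_min_midpoint_le (c := b) (fun j => le_csSup (hbdd j) (hSb j)) fun j => ?_
    refine le_of_forall_lt fun m hm => ?_
    rw [lt_min_iff] at hm
    obtain ⟨a, ham, haS⟩ := exists_between
      (max_lt hm.1 (show 2 * m - sSup (S (j + 2)) < sSup (S j) by linarith [hm.2]))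
    rw [max_lt_iff] at ham
    have hd : 2 * m - a < sSup (S (j + 2)) := by linarith
    obtain ⟨b', hb'm, hb'S⟩ := exists_between hd
    have hmem := hdown j a haS
    -- The interpolation radius must be at most 1, which requires the exponent of order j + 2 not to
    -- exceed that of order j.
    set b'' := min b' a
    have hmem2 : b'' ∈ S (j + 2) := hdown _ _ (lt_of_le_of_lt (min_le_left _ _) hb'S)
    have hb'' : b'' ≤ a := min_le_right _ _
    have hlow : m < (a + b'') / 2 := by
      rcases min_choice b' a with h | h <;> simp only [b'', h] <;> linarith
    refine lt_of_lt_of_le hlow (le_csSup (hbdd _) ⟨by linarith [hmem.1, hmem2.1], fun κ => ?_⟩)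
    -- The radius ρ^((a - b'')/2) balances the two terms of the inequality: both become ρ^((a +
    -- b'')/2).
    have := jetBd_interpolation (l := l) (T := T) (φ := φ) (γ₁ := fun i => ρ i ^ a)
      (γ₂ := fun i => ρ i ^ b'') (s := fun i => ρ i ^ ((a - b'') / 2)) (j := j)
      (by
        filter_upwards [hρ] with i hi
        exact ⟨Real.rpow_pos_of_pos hi.1 _, Real.rpow_le_one hi.1.le hi.2 (by linarith)⟩)
      (by filter_upwards [hρ] with i hi using Real.rpow_nonneg hi.1.le _)
      (by filter_upwards [hρ] with i hi using Real.rpow_nonneg hi.1.le _)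
      hmem.2 hmem2.2 κ
    obtain ⟨C, hC⟩ := this
    refine ⟨2 * C, ?_⟩
    filter_upwards [hC, hρ] with i hi hr
    convert hi using 1
    rw [← Real.rpow_sub hr.1, ← Real.rpow_add hr.1,
      show a - (a - b'') / 2 = (a + b'') / 2 by ring,
      show b'' + (a - b'') / 2 = (a + b'') / 2 by ring]
    ring
  rcases s with _ | ⟨κ, j⟩
  · exact hle _ _ he.le _ hsup
  · refine (hdown j e (he.trans_le ?_)).2 κ
    exact (le_csSup (hbdd 0) hS0).trans (hmono (Nat.zero_le j))

end Jets

/-! ### Differential calculus for families, with Hölder remainders -/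

section Calculus

variable {n : ℕ} {V S : Type*}

/-- Local boundedness of a family of vectors. -/
def LocBd (Bd : S → V → ℝ → Prop) (Q : Set (EuclideanSpace ℝ (Fin n)))
    (r : EuclideanSpace ℝ (Fin n) → V) : Prop :=
  ∀ s, ∀ q₀ ∈ Q, ∃ C, ∀ᶠ q in 𝓝 q₀, Bd s (r q) C

/-- Local boundedness, near the diagonal, of a family of vectors with two parameters. -/
def LocBd₂ (Bd : S → V → ℝ → Prop) (Q : Set (EuclideanSpace ℝ (Fin n)))
    (r : EuclideanSpace ℝ (Fin n) → EuclideanSpace ℝ (Fin n) → V) : Prop :=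
  ∀ s, ∀ q₀ ∈ Q, ∃ C, ∀ᶠ z in 𝓝 (q₀, q₀), Bd s (r z.1 z.2) C

variable {Bd : S → V → ℝ → Prop} {Q : Set (EuclideanSpace ℝ (Fin n))}

lemma eventually_norm_sub_le_one (q₀ : EuclideanSpace ℝ (Fin n)) :
    ∀ᶠ z : EuclideanSpace ℝ (Fin n) × EuclideanSpace ℝ (Fin n) in 𝓝 (q₀, q₀),
      ‖z.2 - z.1‖ ≤ 1 := by
  have : Tendsto (fun z : EuclideanSpace ℝ (Fin n) × EuclideanSpace ℝ (Fin n) => ‖z.2 - z.1‖)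
      (𝓝 (q₀, q₀)) (𝓝 ‖q₀ - q₀‖) := by
    apply Continuous.tendsto (by fun_prop) (q₀, q₀)
  rw [sub_self, norm_zero] at this
  exact this.eventually_le_const one_pos

lemma eventually_fst_diag {q₀ : EuclideanSpace ℝ (Fin n)} {P : EuclideanSpace ℝ (Fin n) → Prop}
    (h : ∀ᶠ q in 𝓝 q₀, P q) :
    ∀ᶠ z : EuclideanSpace ℝ (Fin n) × EuclideanSpace ℝ (Fin n) in 𝓝 (q₀, q₀), P z.1 :=
  (continuous_fst.tendsto (q₀, q₀)).eventually h

lemma eventually_snd_diag {q₀ : EuclideanSpace ℝ (Fin n)} {P : EuclideanSpace ℝ (Fin n) → Prop}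
    (h : ∀ᶠ q in 𝓝 q₀, P q) :
    ∀ᶠ z : EuclideanSpace ℝ (Fin n) × EuclideanSpace ℝ (Fin n) in 𝓝 (q₀, q₀), P z.2 :=
  (continuous_snd.tendsto (q₀, q₀)).eventually h

lemma LocBd.fst {r : EuclideanSpace ℝ (Fin n) → V} (h : LocBd Bd Q r) :
    LocBd₂ Bd Q (fun q _ => r q) := fun s q₀ hq => by
  obtain ⟨C, hC⟩ := h s q₀ hq
  exact ⟨C, eventually_fst_diag hC⟩

lemma LocBd.snd {r : EuclideanSpace ℝ (Fin n) → V} (h : LocBd Bd Q r) :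
    LocBd₂ Bd Q (fun _ q => r q) := fun s q₀ hq => by
  obtain ⟨C, hC⟩ := h s q₀ hq
  exact ⟨C, eventually_snd_diag hC⟩

variable [AddCommGroup V] [Module ℝ V]

/-- A family of relations `‖v‖ₛ ≤ C` given by (extended) seminorms. -/
structure IsBound (Bd : S → V → ℝ → Prop) : Prop where
  mono : ∀ {s v C C'}, Bd s v C → C ≤ C' → Bd s v C'
  add : ∀ {s v w C C'}, Bd s v C → Bd s w C' → Bd s (v + w) (C + C')
  smul : ∀ {s v C} (a : ℝ), Bd s v C → Bd s (a • v) (|a| * C)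
  zero : ∀ {s}, Bd s 0 0

/-- `ρ(q, q') = O(|q' - q|^(e + θ))` near the diagonal, for some `θ > 0` that may depend on the
point and on the seminorm. -/
def RemBd (Bd : S → V → ℝ → Prop) (Q : Set (EuclideanSpace ℝ (Fin n))) (e : ℝ)
    (ρ : EuclideanSpace ℝ (Fin n) → EuclideanSpace ℝ (Fin n) → V) : Prop :=
  ∀ s, ∀ q₀ ∈ Q, ∃ C θ : ℝ, 0 < θ ∧
    ∀ᶠ z in 𝓝 (q₀, q₀), Bd s (ρ z.1 z.2) (C * ‖z.2 - z.1‖ ^ (e + θ))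

/-- Families of vectors that are `k` times differentiable with locally Hölder continuous
derivatives. -/
def CkH (Bd : S → V → ℝ → Prop) (Q : Set (EuclideanSpace ℝ (Fin n))) :
    ℕ → (EuclideanSpace ℝ (Fin n) → V) → Prop
  | 0, r => LocBd Bd Q r ∧ RemBd Bd Q 0 (fun q q' => r q' - r q)
  | k + 1, r => LocBd Bd Q r ∧ ∃ r' : Fin n → EuclideanSpace ℝ (Fin n) → V,
      (∀ i, CkH Bd Q k (r' i)) ∧
        RemBd Bd Q 1 (fun q q' => r q' - r q - ∑ i, (q' i - q i) • r' i q)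

lemma mul_rpow_le_mul_rpow {C d a b : ℝ} (hd : 0 ≤ d) (hd1 : d ≤ 1) (ha : 0 ≤ a) (hab : a ≤ b) :
    C * d ^ b ≤ |C| * d ^ a :=
  mul_le_mul (le_abs_self _) (Real.rpow_le_rpow_of_exponent_ge' hd hd1 ha hab)
    (Real.rpow_nonneg hd _) (abs_nonneg _)

lemma LocBd.add (hB : IsBound Bd) {r r' : EuclideanSpace ℝ (Fin n) → V} (h : LocBd Bd Q r)
    (h' : LocBd Bd Q r') : LocBd Bd Q (fun q => r q + r' q) := fun s q₀ hq => by
  obtain ⟨C, hC⟩ := h s q₀ hq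
  obtain ⟨C', hC'⟩ := h' s q₀ hq
  exact ⟨C + C', by filter_upwards [hC, hC'] with z h1 h2 using hB.add h1 h2⟩

lemma RemBd.add (hB : IsBound Bd) {e : ℝ} (he : 0 ≤ e)
    {ρ ρ' : EuclideanSpace ℝ (Fin n) → EuclideanSpace ℝ (Fin n) → V}
    (h : RemBd Bd Q e ρ) (h' : RemBd Bd Q e ρ') :
    RemBd Bd Q e (fun q q' => ρ q q' + ρ' q q') := fun s q₀ hq => by
  obtain ⟨C, θ, hθ, hC⟩ := h s q₀ hq
  obtain ⟨C', θ', hθ', hC'⟩ := h' s q₀ hq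
  refine ⟨|C| + |C'|, min θ θ', lt_min hθ hθ', ?_⟩
  filter_upwards [hC, hC', eventually_norm_sub_le_one q₀] with z h1 h2 h3
  refine hB.mono (hB.add h1 h2) ?_
  rw [add_mul]
  have hm : 0 ≤ min θ θ' := (lt_min hθ hθ').le
  exact add_le_add
    (mul_rpow_le_mul_rpow (norm_nonneg _) h3 (by linarith) (by linarith [min_le_left θ θ']))
    (mul_rpow_le_mul_rpow (norm_nonneg _) h3 (by linarith) (by linarith [min_le_right θ θ']))

lemma RemBd.mono (hB : IsBound Bd) {e e' : ℝ} (he : 0 ≤ e) (hee' : e ≤ e')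
    {ρ : EuclideanSpace ℝ (Fin n) → EuclideanSpace ℝ (Fin n) → V}
    (h : RemBd Bd Q e' ρ) : RemBd Bd Q e ρ := fun s q₀ hq => by
  obtain ⟨C, θ, hθ, hC⟩ := h s q₀ hq
  refine ⟨|C|, θ, hθ, ?_⟩
  filter_upwards [hC, eventually_norm_sub_le_one q₀] with z h1 h3
  exact hB.mono h1 (mul_rpow_le_mul_rpow (norm_nonneg _) h3 (by linarith) (by linarith))

lemma RemBd.zero (hB : IsBound Bd) (e : ℝ) :
    RemBd Bd Q e (fun _ _ => (0 : V)) := fun _ _ _ =>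
  ⟨0, 1, one_pos, Eventually.of_forall fun _ => by rw [zero_mul]; exact hB.zero⟩

lemma RemBd.sum (hB : IsBound Bd) {e : ℝ} (he : 0 ≤ e) {ι : Type*} (I : Finset ι)
    {ρ : ι → EuclideanSpace ℝ (Fin n) → EuclideanSpace ℝ (Fin n) → V}
    (h : ∀ i ∈ I, RemBd Bd Q e (ρ i)) : RemBd Bd Q e (fun q q' => ∑ i ∈ I, ρ i q q') := by
  classical
  induction I using Finset.induction_on with
  | empty => simpa using RemBd.zero hB e
  | insert i I hi ih =>
    simp only [Finset.sum_insert hi]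
    exact (h i (Finset.mem_insert_self _ _)).add hB he
      (ih fun j hj => h j (Finset.mem_insert_of_mem hj))

lemma LocBd.zero (hB : IsBound Bd) : LocBd Bd Q (fun _ => (0 : V)) :=
  fun _ _ _ => ⟨0, Eventually.of_forall fun _ => hB.zero⟩

lemma abs_sub_apply_le (q q' : EuclideanSpace ℝ (Fin n)) (i : Fin n) :
    |q' i - q i| ≤ ‖q' - q‖ := by
  simpa using PiLp.norm_apply_le (q' - q) i

lemma RemBd.smul_disp (hB : IsBound Bd) {e : ℝ} (he : 0 ≤ e) (i : Fin n)
    {ρ : EuclideanSpace ℝ (Fin n) → EuclideanSpace ℝ (Fin n) → V} (h : RemBd Bd Q e ρ) :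
    RemBd Bd Q (1 + e) (fun q q' => (q' i - q i) • ρ q q') := fun s q₀ hq => by
  obtain ⟨C, θ, hθ, hC⟩ := h s q₀ hq
  refine ⟨|C|, θ, hθ, ?_⟩
  filter_upwards [hC] with z h1
  refine hB.mono (hB.smul _ h1) ?_
  rw [show 1 + e + θ = 1 + (e + θ) by ring,
    Real.rpow_add_of_nonneg (norm_nonneg _) zero_le_one (by linarith), Real.rpow_one]
  calc |z.2 i - z.1 i| * (C * ‖z.2 - z.1‖ ^ (e + θ))
      ≤ ‖z.2 - z.1‖ * (|C| * ‖z.2 - z.1‖ ^ (e + θ)) := by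
        refine (mul_le_mul_of_nonneg_left (mul_le_mul_of_nonneg_right (le_abs_self C)
          (by positivity)) (abs_nonneg _)).trans ?_
        exact mul_le_mul_of_nonneg_right (abs_sub_apply_le _ _ _) (by positivity)
    _ = _ := by ring

lemma LocBd₂.smul_disp (hB : IsBound Bd) {e : ℝ} (he : e < 1) (i : Fin n)
    {ρ : EuclideanSpace ℝ (Fin n) → EuclideanSpace ℝ (Fin n) → V} (h : LocBd₂ Bd Q ρ) :
    RemBd Bd Q e (fun q q' => (q' i - q i) • ρ q q') := fun s q₀ hq => by
  obtain ⟨C, hC⟩ := h s q₀ hq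
  refine ⟨|C|, 1 - e, by linarith, ?_⟩
  filter_upwards [hC] with z h1
  refine hB.mono (hB.smul _ h1) ?_
  rw [add_sub_cancel, Real.rpow_one, mul_comm |C|]
  calc |z.2 i - z.1 i| * C ≤ |z.2 i - z.1 i| * |C| :=
        mul_le_mul_of_nonneg_left (le_abs_self _) (abs_nonneg _)
    _ ≤ _ := mul_le_mul_of_nonneg_right (abs_sub_apply_le _ _ _) (abs_nonneg _)

lemma CkH.locBd {k : ℕ} {r : EuclideanSpace ℝ (Fin n) → V} (h : CkH Bd Q k r) :
    LocBd Bd Q r := by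
  cases k <;> exact h.1

lemma remBd_sub_of_remBd_one (hB : IsBound Bd) {e : ℝ} (he : 0 ≤ e) (he1 : e < 1)
    {r : EuclideanSpace ℝ (Fin n) → V}
    {r' : Fin n → EuclideanSpace ℝ (Fin n) → V} (hr' : ∀ i, LocBd Bd Q (r' i))
    (h : RemBd Bd Q 1 (fun q q' => r q' - r q - ∑ i, (q' i - q i) • r' i q)) :
    RemBd Bd Q e (fun q q' => r q' - r q) := by
  have h1 := (h.mono hB he he1.le).add hB he
    (RemBd.sum hB he Finset.univ fun i _ => ((hr' i).fst).smul_disp hB he1 i)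
  simpa using h1

lemma CkH.holder (hB : IsBound Bd) {k : ℕ} {r : EuclideanSpace ℝ (Fin n) → V}
    (h : CkH Bd Q k r) : RemBd Bd Q 0 (fun q q' => r q' - r q) := by
  cases k with
  | zero => exact h.2
  | succ k =>
    obtain ⟨_, r', hr', hrem⟩ := h
    exact remBd_sub_of_remBd_one hB le_rfl zero_lt_one (fun i => (hr' i).locBd) hrem

lemma CkH.holder_of_lt_one (hB : IsBound Bd) {k : ℕ} {r : EuclideanSpace ℝ (Fin n) → V}
    (h : CkH Bd Q (k + 1) r) {e : ℝ} (he : 0 ≤ e) (he1 : e < 1) :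
    RemBd Bd Q e (fun q q' => r q' - r q) := by
  obtain ⟨_, r', hr', hrem⟩ := h
  exact remBd_sub_of_remBd_one hB he he1 (fun i => (hr' i).locBd) hrem

lemma CkH.of_succ (hB : IsBound Bd) {k : ℕ} {r : EuclideanSpace ℝ (Fin n) → V}
    (h : CkH Bd Q (k + 1) r) : CkH Bd Q k r := by
  induction k generalizing r with
  | zero => exact ⟨h.1, h.holder hB⟩
  | succ k ih =>
    obtain ⟨h1, r', hr', hrem⟩ := h
    exact ⟨h1, r', fun i => ih (hr' i), hrem⟩

lemma CkH.add (hB : IsBound Bd) {k : ℕ} {r s : EuclideanSpace ℝ (Fin n) → V}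
    (hr : CkH Bd Q k r) (hs : CkH Bd Q k s) : CkH Bd Q k (fun q => r q + s q) := by
  induction k generalizing r s with
  | zero =>
    refine ⟨hr.1.add hB hs.1, ?_⟩
    convert hr.2.add hB le_rfl hs.2 using 3
    exact add_sub_add_comm _ _ _ _
  | succ k ih =>
    obtain ⟨h1, r', hr', hrem⟩ := hr
    obtain ⟨h2, s', hs', hsrem⟩ := hs
    refine ⟨h1.add hB h2, fun i q => r' i q + s' i q, fun i => ih (hr' i) (hs' i), ?_⟩
    convert hrem.add hB zero_le_one hsrem using 3
    simp only [smul_add, Finset.sum_add_distrib]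
    abel

lemma CkH.zero (hB : IsBound Bd) (k : ℕ) : CkH Bd Q k (fun _ => (0 : V)) := by
  induction k with
  | zero => exact ⟨LocBd.zero hB, by simpa using RemBd.zero hB 0⟩
  | succ k ih =>
    exact ⟨LocBd.zero hB, fun _ _ => 0, fun _ => ih, by simpa using RemBd.zero hB 1⟩

lemma CkH.sum (hB : IsBound Bd) {k : ℕ} {ι : Type*} (I : Finset ι)
    {r : ι → EuclideanSpace ℝ (Fin n) → V}
    (h : ∀ i ∈ I, CkH Bd Q k (r i)) : CkH Bd Q k (fun q => ∑ i ∈ I, r i q) := by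
  classical
  induction I using Finset.induction_on with
  | empty => simpa using CkH.zero hB k
  | insert i I hi ih =>
    simp only [Finset.sum_insert hi]
    exact (h i (Finset.mem_insert_self _ _)).add hB
      (ih fun j hj => h j (Finset.mem_insert_of_mem hj))

end Calculus

/-! ### Products of families in the sup norm -/

section Sup

variable {n : ℕ} {F : Type*} {T : ℝ} {Q : Set (EuclideanSpace ℝ (Fin n))}

lemma isBound_supBd : IsBound (SupBd (F := F) T) where
  mono h hC t ht x := (h t ht x).trans hC
  add h h' t ht x := (abs_add_le _ _).trans (add_le_add (h t ht x) (h' t ht x))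
  smul a h t ht x := by
    simp only [Pi.smul_apply, smul_eq_mul, abs_mul]
    exact mul_le_mul_of_nonneg_left (h t ht x) (abs_nonneg _)
  zero t _ x := by simp

lemma SupBd.mul {v w : F → ℝ → ℝ} {C D : ℝ} (h : SupBd T () v C) (h' : SupBd T () w D) :
    SupBd T () (v * w) (|C| * D) := fun t ht x => by
  have h1 := h t ht x
  have h2 := h' t ht x
  simp only [Pi.mul_apply, abs_mul]
  exact mul_le_mul (h1.trans (le_abs_self _)) h2 (abs_nonneg _) (abs_nonneg _)

lemma LocBd.mul {r s : EuclideanSpace ℝ (Fin n) → F → ℝ → ℝ} (h : LocBd (SupBd T) Q r)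
    (h' : LocBd (SupBd T) Q s) : LocBd (SupBd T) Q (fun q => r q * s q) := fun _ q₀ hq => by
  obtain ⟨C, hC⟩ := h () q₀ hq
  obtain ⟨C', hC'⟩ := h' () q₀ hq
  exact ⟨|C| * C', by filter_upwards [hC, hC'] with z h1 h2 using h1.mul h2⟩

lemma RemBd.locBd_mul {e : ℝ}
    {β ρ : EuclideanSpace ℝ (Fin n) → EuclideanSpace ℝ (Fin n) → F → ℝ → ℝ}
    (hβ : LocBd₂ (SupBd T) Q β) (h : RemBd (SupBd T) Q e ρ) :
    RemBd (SupBd T) Q e (fun q q' => β q q' * ρ q q') := fun _ q₀ hq => by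
  obtain ⟨C, hC⟩ := hβ () q₀ hq
  obtain ⟨C', θ, hθ, hC'⟩ := h () q₀ hq
  refine ⟨|C| * C', θ, hθ, ?_⟩
  filter_upwards [hC, hC'] with z h1 h2
  rw [mul_assoc]
  exact h1.mul h2

lemma CkH.mul {k : ℕ} {r s : EuclideanSpace ℝ (Fin n) → F → ℝ → ℝ}
    (hr : CkH (SupBd T) Q k r) (hs : CkH (SupBd T) Q k s) :
    CkH (SupBd T) Q k (fun q => r q * s q) := by
  have hB := isBound_supBd (F := F) (T := T)
  induction k generalizing r s with
  | zero =>
    refine ⟨hr.1.mul hs.1, ?_⟩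
    convert (RemBd.locBd_mul hs.1.snd hr.2).add hB le_rfl (RemBd.locBd_mul hr.1.fst hs.2) using 3
    ring
  | succ k ih =>
    have hr0 := hr.of_succ hB
    have hs0 := hs.of_succ hB
    obtain ⟨h1, r', hr', hrem⟩ := hr
    obtain ⟨h2, s', hs', hsrem⟩ := hs
    refine ⟨h1.mul h2, fun i q => r' i q * s q + r q * s' i q,
      fun i => (ih (hr' i) hs0).add hB (ih hr0 (hs' i)), ?_⟩
    -- The Leibniz remainder contains the cross terms (q'_i - q_i) r'_i (s_q' - s_q). Hölder
    -- continuity of s makes them of order above one.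
    have hcross := RemBd.sum hB zero_le_one Finset.univ fun i _ =>
      ((RemBd.locBd_mul ((hr' i).locBd.fst) (hs0.holder hB)).smul_disp hB le_rfl i).mono hB
        zero_le_one (by norm_num : (1 : ℝ) ≤ 1 + 0)
    convert ((RemBd.locBd_mul h2.snd hrem).add hB zero_le_one
      (RemBd.locBd_mul h1.fst hsrem)).add hB zero_le_one hcross using 3
    simp only [smul_add, Finset.sum_add_distrib, mul_sub, smul_sub, Finset.sum_sub_distrib,
      Finset.mul_sum, mul_smul_comm]
    have e1 : ∀ q q' : EuclideanSpace ℝ (Fin n),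
      ∑ i, (q' i - q i) • (s q' * r' i q) = ∑ i, (q' i - q i) • (r' i q * s q') := fun q q' =>
        Finset.sum_congr rfl fun i _ => by rw [mul_comm]
    rw [e1]
    ring

end Sup

/-! ### The parabolic maximum principle -/

section MaximumPrinciple

/-- At a maximum (x₁, t₁) of w = z exp(-(A+1)t) with w > β one has z ≥ w > β and t₁ > 0. There the
time derivative of w is nonnegative, whereas Lz ≤ 0 gives Lz + r - (A+1)z ≤ β - z < 0. The rate A +
1 in place of A is what leaves the term -z. -/
theorem le_of_parabolic_inequality {F : Type*} [TopologicalSpace F] [CompactSpace F] {T : ℝ}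
    {z Lz r : F → ℝ → ℝ}
    (hc : ContinuousOn (fun y : F × ℝ => z y.1 y.2) (univ ×ˢ Icc 0 T))
    (heq : ∀ x, ∀ t ∈ Icc 0 T, HasDerivWithinAt (z x) (Lz x t + r x t) (Icc 0 T) t)
    (hL : ∀ t ∈ Icc 0 T, ∀ x, (∀ y, z y t ≤ z x t) → Lz x t ≤ 0) {A β : ℝ} (hA : 0 ≤ A)
    (hβ : 0 ≤ β) (hr : ∀ t ∈ Icc 0 T, ∀ x, r x t ≤ A * |z x t| + β) (h0 : ∀ x, z x 0 ≤ β)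
    {t : ℝ} (ht : t ∈ Icc 0 T) (x : F) : z x t ≤ Real.exp ((A + 1) * T) * β := by
  have hT : 0 ≤ T := ht.1.trans ht.2
  set w : F → ℝ → ℝ := fun x t => z x t * Real.exp (-((A + 1) * t)) with hw
  have hwc : ContinuousOn (fun y : F × ℝ => w y.1 y.2) (univ ×ˢ Icc 0 T) :=
    hc.mul (Continuous.continuousOn (by fun_prop))
  have hcomp : IsCompact ((univ : Set F) ×ˢ Icc 0 T) := isCompact_univ.prod isCompact_Icc
  obtain ⟨⟨x₁, t₁⟩, ⟨-, ht₁⟩, hmax⟩ := hcomp.exists_isMaxOn ⟨(x, t), mem_univ _, ht⟩ hwc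
  have hmax' : ∀ y, ∀ s ∈ Icc 0 T, w y s ≤ w x₁ t₁ := fun y s hs =>
    hmax (mk_mem_prod (mem_univ y) hs)
  simp only at ht₁
  have hwz : ∀ y s, z y s = w y s * Real.exp ((A + 1) * s) := fun y s => by
    simp only [hw, mul_assoc, ← Real.exp_add]; simp
  suffices hsuff : w x₁ t₁ ≤ β by
    rw [hwz, mul_comm]
    refine (mul_le_mul_of_nonneg_left ((hmax' x t ht).trans hsuff) (Real.exp_pos _).le).trans ?_
    exact mul_le_mul_of_nonneg_right
      (Real.exp_le_exp.2 (mul_le_mul_of_nonneg_left ht.2 (by linarith))) hβ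
  by_contra hlt
  push Not at hlt
  have hzw : w x₁ t₁ ≤ z x₁ t₁ := by
    rw [hwz x₁ t₁]
    refine le_mul_of_one_le_right (hβ.trans hlt.le) (Real.one_le_exp ?_)
    exact mul_nonneg (by linarith) ht₁.1
  have hz0 : 0 < z x₁ t₁ := by linarith
  have ht₁0 : 0 < t₁ := by
    rcases ht₁.1.eq_or_lt with h | h
    · exfalso
      have := h0 x₁
      rw [← h] at hlt
      simp [hw] at hlt
      linarith
    · exact h
  have hmaxz : ∀ y, z y t₁ ≤ z x₁ t₁ := fun y =>
    le_of_mul_le_mul_right (hmax' y t₁ ht₁) (Real.exp_pos _)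
  have hd : HasDerivWithinAt (w x₁) ((Lz x₁ t₁ + r x₁ t₁ - (A + 1) * z x₁ t₁) *
      Real.exp (-((A + 1) * t₁))) (Icc 0 T) t₁ := by
    have h1 : HasDerivAt (fun s => Real.exp (-((A + 1) * s)))
        (Real.exp (-((A + 1) * t₁)) * (-((A + 1) * 1))) t₁ :=
      (((hasDerivAt_id t₁).const_mul (A + 1)).neg).exp
    refine ((heq x₁ t₁ ht₁).mul h1.hasDerivWithinAt).congr_deriv ?_
    ring
  -- The maximum may lie at t₁ = T, where only backward steps are available. The direction -t₁ is
  -- admissible in all cases and gives the sign of the derivative.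
  have hmem : (0 - t₁) ∈ posTangentConeAt (Icc 0 T) t₁ := by
    refine mem_posTangentConeAt_of_segment_subset ?_
    rw [add_sub_cancel]
    exact (convex_Icc 0 T).segment_subset ht₁ ⟨le_rfl, hT⟩
  have hloc : IsLocalMaxOn (w x₁) (Icc 0 T) t₁ :=
    IsMaxOn.localize fun s hs => hmax' x₁ s hs
  have h2 := hloc.hasFDerivWithinAt_nonpos hd.hasFDerivWithinAt hmem
  simp only [ContinuousLinearMap.toSpanSingleton_apply, smul_eq_mul] at h2
  have h3 : 0 ≤ (Lz x₁ t₁ + r x₁ t₁ - (A + 1) * z x₁ t₁) * Real.exp (-((A + 1) * t₁)) := by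
    nlinarith
  have h4 := nonneg_of_mul_nonneg_left h3 (Real.exp_pos _)
  have h5 := hL t₁ ht₁ x₁ hmaxz
  have h6 := hr t₁ ht₁ x₁
  rw [abs_of_pos hz0] at h6
  nlinarith

end MaximumPrinciple

/-! ### Differentiating limits of sequences -/

section Limits

/-- Termwise differentiation within a convex set, so that the end points of the time interval are
included. The mean value inequality bounds the increments of φ_l - φ_M by c/4 |t' - t| uniformly in
l; letting l tend to infinity leaves one fixed function φ_M to be expanded. -/
theorem hasDerivWithinAt_of_tendstoUniformlyOn {φ ψ : ℕ → ℝ → ℝ} {φ' ψ' : ℝ → ℝ} {s : Set ℝ}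
    (hs : Convex ℝ s) (h : ∀ᶠ m in atTop, ∀ t ∈ s, HasDerivWithinAt (φ m) (ψ m t) s t)
    (hψ : TendstoUniformlyOn ψ ψ' atTop s)
    (hφ : ∀ t ∈ s, Tendsto (fun m => φ m t) atTop (𝓝 (φ' t))) {t : ℝ} (ht : t ∈ s) :
    HasDerivWithinAt φ' (ψ' t) s t := by
  rw [hasDerivWithinAt_iff_isLittleO, Asymptotics.isLittleO_iff]
  intro c hc
  have hU := Metric.tendstoUniformlyOn_iff.1 hψ (c / 8) (by positivity)
  obtain ⟨M, hM⟩ := eventually_atTop.1 (hU.and h)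
  have hdM := (hM M le_rfl).2 t ht
  rw [hasDerivWithinAt_iff_isLittleO, Asymptotics.isLittleO_iff] at hdM
  filter_upwards [hdM (show 0 < c / 2 by positivity), self_mem_nhdsWithin] with t' h1 ht'
  have h2 : ∀ l ≥ M, ‖(φ l t' - φ M t') - (φ l t - φ M t)‖ ≤ c / 4 * ‖t' - t‖ := by
    intro l hl
    refine hs.norm_image_sub_le_of_norm_hasDerivWithin_le (f := fun t => φ l t - φ M t)
      (f' := fun t => ψ l t - ψ M t)
      (fun x hx => ((hM l hl).2 x hx).sub ((hM M le_rfl).2 x hx)) (fun x hx => ?_) ht ht'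
    have a1 := (hM l hl).1 x hx
    have a2 := (hM M le_rfl).1 x hx
    rw [dist_eq_norm] at a1 a2
    calc ‖ψ l x - ψ M x‖ = ‖(ψ' x - ψ M x) - (ψ' x - ψ l x)‖ := by congr 1; ring
      _ ≤ _ := (norm_sub_le _ _).trans (by linarith)
  have h3 : ‖(φ' t' - φ M t') - (φ' t - φ M t)‖ ≤ c / 4 * ‖t' - t‖ := by
    refine le_of_tendsto (((hφ t' ht').sub_const _).sub ((hφ t ht).sub_const _)).norm ?_
    filter_upwards [eventually_ge_atTop M] with l hl using h2 l hl
  have h4 : ‖(t' - t) • (ψ M t - ψ' t)‖ ≤ c / 4 * ‖t' - t‖ := by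
    have a2 := (hM M le_rfl).1 t ht
    rw [dist_comm, dist_eq_norm] at a2
    rw [norm_smul, mul_comm]
    exact mul_le_mul_of_nonneg_right (by linarith) (norm_nonneg _)
  calc ‖φ' t' - φ' t - (t' - t) • ψ' t‖
      = ‖((φ' t' - φ M t') - (φ' t - φ M t)) + (φ M t' - φ M t - (t' - t) • ψ M t) +
        (t' - t) • (ψ M t - ψ' t)‖ := by congr 1; simp only [smul_eq_mul]; ring
    _ ≤ c / 4 * ‖t' - t‖ + c / 2 * ‖t' - t‖ + c / 4 * ‖t' - t‖ :=
        norm_add₃_le.trans (by gcongr)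
    _ = c * ‖t' - t‖ := by ring

variable {E G : Type*} [NormedAddCommGroup E] [NormedSpace ℝ E]
  [NormedAddCommGroup G] [NormedSpace ℝ G]

/-- Locally uniform convergence of the derivatives of order j + 1 makes the limit of order j + 1 the
derivative of the limit of order j. -/
theorem hasFTaylorSeriesUpToOn_of_tendsto {U : Set E} (hU : IsOpen U) {f : ℕ → E → G} {g : E → G}
    {D : E → FormalMultilinearSeries ℝ E G}
    (hf : ∀ᶠ m in atTop, ContDiffOn ℝ ∞ (f m) U)
    (hg : ∀ y ∈ U, Tendsto (fun m => f m y) atTop (𝓝 (g y)))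
    (hD : ∀ j, TendstoLocallyUniformlyOn (fun m => iteratedFDeriv ℝ j (f m)) (fun y => D y j)
      atTop U) :
    HasFTaylorSeriesUpToOn ∞ g D U := by
  have key : ∀ j, ∀ y ∈ U, HasFDerivAt (fun y => D y j) (D y (j + 1)).curryLeft y := by
    intro j y hy
    have hcurry : TendstoLocallyUniformlyOn
        (fun m y => (iteratedFDeriv ℝ (j + 1) (f m) y).curryLeft)
        (fun y => (D y (j + 1)).curryLeft) atTop U :=
      ((continuousMultilinearCurryLeftEquiv ℝ (fun _ : Fin (j + 1) => E) G
        ).isometry.uniformContinuous).comp_tendstoLocallyUniformlyOn (hD (j + 1))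
    refine hasFDerivAt_of_tendstoUniformlyOnFilter (l := atTop)
      (f := fun m => iteratedFDeriv ℝ j (f m))
      (f' := fun m y => (iteratedFDeriv ℝ (j + 1) (f m) y).curryLeft)
      (g' := fun y => (D y (j + 1)).curryLeft) ?_ ?_ ?_
    · simpa [hU.nhdsWithin_eq hy] using tendstoLocallyUniformlyOn_iff_filter.mp hcurry y hy
    · filter_upwards [prod_mem_prod hf (hU.mem_nhds hy)] with ⟨m, x⟩ ⟨hm, hx⟩
      have := (differentiableAt_iteratedFDeriv_of_contDiffOn hU hm j hx).hasFDerivAt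
      rw [fderiv_iteratedFDeriv] at this
      exact this
    · filter_upwards [hU.mem_nhds hy] with x hx using (hD j).tendsto_at hx
  refine ⟨fun y hy => ?_, fun j _ y hy => (key j y hy).hasFDerivWithinAt, fun j _ y hy =>
    (key j y hy).continuousAt.continuousWithinAt⟩
  have h1 := (hD 0).tendsto_at hy
  have h2 : Tendsto (fun m => (iteratedFDeriv ℝ 0 (f m) y).curry0) atTop
      (𝓝 (D y 0).curry0) :=
    ((continuousMultilinearCurryFin0 ℝ E G).continuous.tendsto _).comp h1
  exact tendsto_nhds_unique h2 (by simpa using hg y hy)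

end Limits

/-! ### Convergence in all seminorms, and completeness -/

section JetLimits

variable {p : ℕ} {F : Type*} [TopologicalSpace F] [ChartedSpace (EuclideanSpace ℝ (Fin p)) F]
  [IsManifold (𝓡 p) ∞ F] {T : ℝ}

lemma contMDiff_of_rep {φ : F → ℝ}
    (h : ∀ x₀, ContDiffOn ℝ ∞ (rep p x₀ φ) (extChartAt (𝓡 p) x₀).target) :
    ContMDiff (𝓡 p) 𝓘(ℝ, ℝ) ∞ φ := by
  intro x
  have h1 := (contMDiffOn_iff_contDiffOn.2 (h x)).comp (contMDiffOn_extChartAt (x := x))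
    (fun y hy => (extChartAt (𝓡 p) x).map_source (by simpa using hy))
  have h2 : (chartAt (EuclideanSpace ℝ (Fin p)) x).source ∈ 𝓝 x := chart_source_mem_nhds _ x
  refine (h1.contMDiffAt h2).congr_of_eventuallyEq ?_
  filter_upwards [h2] with y hy
  simp only [Function.comp, rep]
  rw [(extChartAt (𝓡 p) x).left_inv (by simpa using hy)]

lemma SpaceSmooth.add {v w : F → ℝ → ℝ} (hv : SpaceSmooth p T v) (hw : SpaceSmooth p T w) :
    SpaceSmooth p T (v + w) := fun t ht => (hv t ht).add (hw t ht)

lemma SpaceSmooth.smul (a : ℝ) {v : F → ℝ → ℝ} (hv : SpaceSmooth p T v) :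
    SpaceSmooth p T (a • v) := fun t ht =>
  (contDiff_const_smul a).contMDiff.comp (hv t ht)

lemma SpaceSmooth.sub {v w : F → ℝ → ℝ} (hv : SpaceSmooth p T v) (hw : SpaceSmooth p T w) :
    SpaceSmooth p T (v - w) := fun t ht => (hv t ht).sub (hw t ht)

lemma SpaceSmooth.zero : SpaceSmooth p T (0 : F → ℝ → ℝ) := fun _ _ => contMDiff_const

lemma SpaceSmooth.sum {ι : Type*} (I : Finset ι) {v : ι → F → ℝ → ℝ}
    (hv : ∀ i ∈ I, SpaceSmooth p T (v i)) : SpaceSmooth p T (∑ i ∈ I, v i) := by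
  classical
  induction I using Finset.induction_on with
  | empty => simpa using SpaceSmooth.zero
  | insert i I hi ih =>
    rw [Finset.sum_insert hi]
    exact (hv i (Finset.mem_insert_self _ _)).add
      (ih fun j hj => hv j (Finset.mem_insert_of_mem hj))

lemma isBound_jetBd : IsBound (JetBd (F := F) p T) where
  mono h hC := h.mono hC
  add {s v w C C'} h h' := by
    rcases s with _ | ⟨κ, j⟩
    · exact ⟨h.1.add h'.1, isBound_supBd.add h.2 h'.2⟩
    · refine ⟨h.1.add h'.1, fun t ht x hx => ?_⟩
      have := jet_add (h.1 t ht) (h'.1 t ht) j κ.center (κ.subset hx)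
      simp only [Pi.add_apply, this]
      exact (norm_add_le _ _).trans (add_le_add (h.2 t ht x hx) (h'.2 t ht x hx))
  smul {s v C} a h := by
    rcases s with _ | ⟨κ, j⟩
    · exact ⟨h.1.smul a, isBound_supBd.smul a h.2⟩
    · refine ⟨h.1.smul a, fun t ht x hx => ?_⟩
      have := jet_const_mul (h.1 t ht) a j κ.center (κ.subset hx)
      simp only [Pi.smul_apply, smul_eq_mul, this, norm_smul, Real.norm_eq_abs]
      exact mul_le_mul_of_nonneg_left (h.2 t ht x hx) (abs_nonneg _)
  zero {s} := by
    rcases s with _ | ⟨κ, j⟩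
    · exact ⟨SpaceSmooth.zero, isBound_supBd.zero⟩
    · refine ⟨SpaceSmooth.zero, fun t _ x _ => ?_⟩
      have : rep p κ.center (fun _ : F => (0 : ℝ)) = fun _ => 0 := rfl
      simp only [Pi.zero_apply, jet, this]
      simp

lemma jet_sub {φ ψ : F → ℝ} (hφ : ContMDiff (𝓡 p) 𝓘(ℝ, ℝ) ∞ φ)
    (hψ : ContMDiff (𝓡 p) 𝓘(ℝ, ℝ) ∞ ψ) (j : ℕ) (x₀ : F) {x : F}
    (hx : x ∈ (extChartAt (𝓡 p) x₀).source) :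
    jet p j x₀ (fun x => φ x - ψ x) x = jet p j x₀ φ x - jet p j x₀ ψ x := by
  have hs : ContMDiff (𝓡 p) 𝓘(ℝ, ℝ) ∞ (fun x => φ x - ψ x) := hφ.sub hψ
  have := jet_add hs hψ j x₀ hx
  rw [eq_sub_iff_add_eq, ← this]
  simp

variable (p) in
/-- Pointwise convergence of all derivatives in all charts. -/
def JetTendsto (T : ℝ) (φ : ℕ → F → ℝ → ℝ) (ψ : F → ℝ → ℝ) : Prop :=
  ∀ t ∈ Icc 0 T, ∀ x₀ : F, ∀ x ∈ (extChartAt (𝓡 p) x₀).source, ∀ j,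
    Tendsto (fun m => jet p j x₀ (fun x => φ m x t) x) atTop
      (𝓝 (jet p j x₀ (fun x => ψ x t) x))

lemma tendsto_of_geometric {X : Type*} [NormedAddCommGroup X] {f : ℕ → X} {a : X} {C r : ℝ}
    {M : ℕ} (hr : r < 1) (h : ∀ m ≥ M, ‖f (m + 1) - f m‖ ≤ C * r ^ m)
    (ha : Tendsto f atTop (𝓝 a)) {m : ℕ} (hm : M ≤ m) : ‖a - f m‖ ≤ C * r ^ m / (1 - r) := by
  have h1 := dist_le_of_le_geometric_of_tendsto r (C * r ^ m) hr (f := fun k => f (m + k))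
    (a := a) (fun k => by
      rw [dist_comm, dist_eq_norm, mul_assoc, ← pow_add]
      exact h (m + k) (by omega)) (by
      simpa [add_comm] using (tendsto_add_atTop_iff_nat m).2 ha) 0
  rw [dist_comm, dist_eq_norm] at h1
  simpa using h1

lemma JetTendsto.pointwise {φ : ℕ → F → ℝ → ℝ} {ψ : F → ℝ → ℝ} (h : JetTendsto p T φ ψ)
    {t : ℝ} (ht : t ∈ Icc 0 T) (x : F) : Tendsto (fun m => φ m x t) atTop (𝓝 (ψ x t)) := by
  have h1 := h t ht x x (mem_extChartAt_source x) 0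
  have h2 := ((continuousMultilinearCurryFin0 ℝ (EuclideanSpace ℝ (Fin p)) ℝ
    ).continuous.tendsto _).comp h1
  have e : ∀ χ : F → ℝ, continuousMultilinearCurryFin0 ℝ (EuclideanSpace ℝ (Fin p)) ℝ
      (jet p 0 x χ x) = χ x := by
    intro χ
    simp only [continuousMultilinearCurryFin0_apply, jet, iteratedFDeriv_zero_apply, rep]
    rw [(extChartAt (𝓡 p) x).left_inv (mem_extChartAt_source x)]
  simpa only [Function.comp_def, e] using h2

lemma JetTendsto.jetBd {φ : ℕ → F → ℝ → ℝ} {ψ : F → ℝ → ℝ} (h : JetTendsto p T φ ψ)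
    (hψ : SpaceSmooth p T ψ) {M : ℕ} (hφ : ∀ m ≥ M, SpaceSmooth p T (φ m))
    {s : Option (ChartCompact p F × ℕ)} {C r : ℝ} (hr : r < 1)
    (hb : ∀ m ≥ M, JetBd p T s (φ (m + 1) - φ m) (C * r ^ m)) {m : ℕ} (hm : M ≤ m) :
    JetBd p T s (ψ - φ m) (C * r ^ m / (1 - r)) := by
  rcases s with _ | ⟨κ, j⟩
  · refine ⟨hψ.sub (hφ m hm), fun t ht x => ?_⟩
    exact tendsto_of_geometric (f := fun m => φ m x t) hr
      (fun k hk => (hb k hk).2 t ht x) (h.pointwise ht x) hm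
  · refine ⟨hψ.sub (hφ m hm), fun t ht x hx => ?_⟩
    simp only [Pi.sub_apply]
    rw [jet_sub (hψ t ht) (hφ m hm t ht) _ _ (κ.subset hx)]
    refine tendsto_of_geometric (f := fun m => jet p j κ.center (fun x => φ m x t) x) hr
      (fun k hk => ?_) (h t ht κ.center x (κ.subset hx) j) hm
    rw [← jet_sub (hφ (k + 1) (by omega) t ht) (hφ k hk t ht) _ _ (κ.subset hx)]
    exact (hb k hk).2 t ht x hx

/-- Completeness of the space of smooth functions, for sequences whose steps are geometrically small
in each seminorm, with a ratio that may depend on the seminorm. -/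
theorem exists_jetTendsto {φ : ℕ → F → ℝ → ℝ} (hφ : ∀ᶠ m in atTop, SpaceSmooth p T (φ m))
    (h : ∀ s : Option (ChartCompact p F × ℕ), ∃ C r : ℝ, 0 ≤ r ∧ r < 1 ∧
      ∀ᶠ m in atTop, JetBd p T s (φ (m + 1) - φ m) (C * r ^ m)) :
    ∃ ψ : F → ℝ → ℝ, SpaceSmooth p T ψ ∧ JetTendsto p T φ ψ := by
  have hcauchy : ∀ t ∈ Icc 0 T, ∀ (x₀ : F) (j : ℕ) (K : Set (EuclideanSpace ℝ (Fin p))),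
      IsCompact K → K ⊆ (extChartAt (𝓡 p) x₀).target → ∃ (C r : ℝ) (M : ℕ), 0 ≤ r ∧ r < 1 ∧
      ∀ m ≥ M, ∀ y ∈ K, ‖iteratedFDeriv ℝ j (rep p x₀ fun x => φ (m + 1) x t) y -
        iteratedFDeriv ℝ j (rep p x₀ fun x => φ m x t) y‖ ≤ C * r ^ m := by
    intro t ht x₀ j K hK hKt
    let κ : ChartCompact p F :=
      { center := x₀
        carrier := (extChartAt (𝓡 p) x₀).symm '' K
        isCompact := hK.image_of_continuousOn ((continuousOn_extChartAt_symm x₀).mono hKt)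
        subset := by
          rintro _ ⟨y, hy, rfl⟩
          exact (extChartAt (𝓡 p) x₀).map_target (hKt hy) }
    obtain ⟨C, r, hr0, hr1, hb⟩ := h (some (κ, j))
    obtain ⟨M, hM⟩ := eventually_atTop.1 (hb.and hφ)
    refine ⟨C, r, M, hr0, hr1, fun m hm y hy => ?_⟩
    have hsrc : (extChartAt (𝓡 p) x₀).symm y ∈ (extChartAt (𝓡 p) x₀).source :=
      (extChartAt (𝓡 p) x₀).map_target (hKt hy)
    have h1 := (hM m hm).1.2 t ht _ (mem_image_of_mem _ hy)
    simp only [Pi.sub_apply] at h1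
    rw [jet_sub ((hM (m + 1) (by omega)).2 t ht) ((hM m hm).2 t ht) _ _ hsrc] at h1
    simpa only [jet, κ, (extChartAt (𝓡 p) x₀).right_inv (hKt hy)] using h1
  have hex : ∀ (t : ℝ) (x₀ : F) (y : EuclideanSpace ℝ (Fin p)) (j : ℕ),
      ∃ a : ContinuousMultilinearMap ℝ (fun _ : Fin j => EuclideanSpace ℝ (Fin p)) ℝ,
      t ∈ Icc 0 T → y ∈ (extChartAt (𝓡 p) x₀).target →
      Tendsto (fun m => iteratedFDeriv ℝ j (rep p x₀ fun x => φ m x t) y) atTop (𝓝 a) := by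
    intro t x₀ y j
    by_cases hty : t ∈ Icc 0 T ∧ y ∈ (extChartAt (𝓡 p) x₀).target
    · obtain ⟨C, r, M, -, hr1, hb⟩ := hcauchy t hty.1 x₀ j {y} isCompact_singleton
        (singleton_subset_iff.2 hty.2)
      have hc : CauchySeq (fun m => iteratedFDeriv ℝ j (rep p x₀ fun x => φ (m + M) x t) y) := by
        refine cauchySeq_of_le_geometric r (C * r ^ M) hr1 fun k => ?_
        rw [dist_comm, dist_eq_norm, mul_assoc, ← pow_add, add_comm M k,
          show k + 1 + M = k + M + 1 by ring]
        exact hb (k + M) (by omega) y rfl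
      obtain ⟨a, ha⟩ := cauchySeq_tendsto_of_complete hc
      exact ⟨a, fun _ _ => (tendsto_add_atTop_iff_nat M).1 ha⟩
    -- A default value outside the chart or the time interval, so that a limit can be chosen for all
    -- arguments at once.
    · exact ⟨0, fun h1 h2 => absurd ⟨h1, h2⟩ hty⟩
  choose D hD using hex
  have hex' : ∀ (x : F) (t : ℝ), ∃ a, t ∈ Icc 0 T →
      Tendsto (fun m => φ m x t) atTop (𝓝 a) := by
    intro x t
    refine ⟨(D t x (extChartAt (𝓡 p) x x) 0).curry0, fun ht => ?_⟩
    have h1 := ((continuousMultilinearCurryFin0 ℝ (EuclideanSpace ℝ (Fin p)) ℝ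
      ).continuous.tendsto _).comp (hD t x (extChartAt (𝓡 p) x x) 0 ht (mem_extChartAt_target x))
    refine h1.congr fun m => ?_
    simp only [Function.comp_apply, continuousMultilinearCurryFin0_apply,
      iteratedFDeriv_zero_apply, rep]
    rw [(extChartAt (𝓡 p) x).left_inv (mem_extChartAt_source x)]
  choose ψ hψ using hex'
  have hT : ∀ t ∈ Icc 0 T, ∀ x₀ : F, HasFTaylorSeriesUpToOn ∞ (rep p x₀ fun x => ψ x t)
      (fun y j => D t x₀ y j) (extChartAt (𝓡 p) x₀).target := by
    intro t ht x₀
    have ho : IsOpen (extChartAt (𝓡 p) x₀).target := isOpen_extChartAt_target x₀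
    refine hasFTaylorSeriesUpToOn_of_tendsto ho (f := fun m => rep p x₀ fun x => φ m x t) ?_
      (fun y _ => hψ _ t ht) fun j => ?_
    · filter_upwards [hφ] with m hm using contDiffOn_rep (hm t ht) x₀
    · rw [tendstoLocallyUniformlyOn_iff_forall_isCompact ho]
      intro K hKt hK
      obtain ⟨C, r, M, hr0, hr1, hb⟩ := hcauchy t ht x₀ j K hK hKt
      rw [Metric.tendstoUniformlyOn_iff]
      intro ε hε
      have hlim : Tendsto (fun m : ℕ => C * r ^ m / (1 - r)) atTop (𝓝 (C * 0 / (1 - r))) :=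
        ((tendsto_pow_atTop_nhds_zero_of_lt_one hr0 hr1).const_mul C).div_const _
      rw [mul_zero, zero_div] at hlim
      filter_upwards [hlim.eventually_lt_const hε, eventually_ge_atTop M] with m h1 h2 y hy
      rw [dist_eq_norm]
      exact (tendsto_of_geometric hr1 (fun k hk => hb k hk y hy)
        (hD t x₀ y j ht (hKt hy)) h2).trans_lt h1
  refine ⟨ψ, fun t ht => contMDiff_of_rep fun x₀ => (hT t ht x₀).contDiffOn,
    fun t ht x₀ x hx j => ?_⟩
  have ho : IsOpen (extChartAt (𝓡 p) x₀).target := isOpen_extChartAt_target x₀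
  have hy := (extChartAt (𝓡 p) x₀).map_source hx
  have h1 := hD t x₀ (extChartAt (𝓡 p) x₀ x) j ht hy
  have h2 := (hT t ht x₀).eq_iteratedFDerivWithin_of_uniqueDiffOn (m := j)
    (by exact_mod_cast le_top) ho.uniqueDiffOn hy
  rw [iteratedFDerivWithin_of_isOpen j ho hy] at h2
  rwa [h2] at h1

end JetLimits

/-! ### Elliptic families of operators and families of solutions -/

section Elliptic

variable {p n : ℕ} {F : Type*} [TopologicalSpace F] [ChartedSpace (EuclideanSpace ℝ (Fin p)) F]

/-- The action of an operator on functions that also depend on time. -/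
def liftOp (D : (F → ℝ) → F → ℝ) (v : F → ℝ → ℝ) : F → ℝ → ℝ :=
  fun x t => D (fun x => v x t) x

variable (p) in
/-- Linearity on smooth functions. -/
structure IsLinearOp (D : (F → ℝ) → F → ℝ) : Prop where
  add : ∀ {φ ψ : F → ℝ}, ContMDiff (𝓡 p) 𝓘(ℝ, ℝ) ∞ φ → ContMDiff (𝓡 p) 𝓘(ℝ, ℝ) ∞ ψ →
    ∀ x, D (fun x => φ x + ψ x) x = D φ x + D ψ x
  smul : ∀ (c : ℝ) {φ : F → ℝ}, ContMDiff (𝓡 p) 𝓘(ℝ, ℝ) ∞ φ →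
    ∀ x, D (fun x => c * φ x) x = c * D φ x

variable (p) in
/-- Linear operators controlled by finitely many derivatives, of orders at least one. -/
structure IsBoundedOp (D : (F → ℝ) → F → ℝ) : Prop extends IsLinearOp p D where
  bound : ∃ I : Finset (ChartCompact p F × ℕ), (∀ s ∈ I, 1 ≤ s.2) ∧
    ∀ (T : ℝ) (v : F → ℝ → ℝ) (C : ℝ), SpaceSmooth p T v →
      (∀ s ∈ I, JetBd p T (some s) v C) → SupBd T () (liftOp D v) C

variable (p) in
/-- A family of operators `L q = ∑ m, A m q • D m` with smooth dependence on the parameter,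
which satisfy the maximum principle. -/
structure EllipticFamily {ι : Type*} [Fintype ι] (Q : Set (EuclideanSpace ℝ (Fin n)))
    (L : EuclideanSpace ℝ (Fin n) → (F → ℝ) → F → ℝ)
    (A : ι → EuclideanSpace ℝ (Fin n) → F → ℝ → ℝ) (D : ι → (F → ℝ) → F → ℝ) : Prop where
  op : ∀ m, IsBoundedOp p (D m)
  rep : ∀ q ∈ Q, ∀ φ : F → ℝ, ContMDiff (𝓡 p) 𝓘(ℝ, ℝ) ∞ φ → ∀ x t,
    L q φ x = ∑ m, A m q x t * D m φ x
  coeff : ∀ T k m, CkH (SupBd T) Q k (A m)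
  nonpos_of_max : ∀ q ∈ Q, ∀ φ : F → ℝ, ContMDiff (𝓡 p) 𝓘(ℝ, ℝ) ∞ φ → ∀ x,
    (∀ y, φ y ≤ φ x) → L q φ x ≤ 0

variable {T : ℝ} [IsManifold (𝓡 p) ∞ F]

lemma IsLinearOp.lift_add {D : (F → ℝ) → F → ℝ} (h : IsLinearOp p D) {v w : F → ℝ → ℝ}
    (hv : SpaceSmooth p T v) (hw : SpaceSmooth p T w) {t : ℝ} (ht : t ∈ Icc 0 T) (x : F) :
    liftOp D (v + w) x t = liftOp D v x t + liftOp D w x t :=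
  h.add (hv t ht) (hw t ht) x

lemma IsLinearOp.lift_smul {D : (F → ℝ) → F → ℝ} (h : IsLinearOp p D) (c : ℝ) {v : F → ℝ → ℝ}
    (hv : SpaceSmooth p T v) {t : ℝ} (ht : t ∈ Icc 0 T) (x : F) :
    liftOp D (c • v) x t = c * liftOp D v x t :=
  h.smul c (hv t ht) x

lemma IsLinearOp.lift_sub {D : (F → ℝ) → F → ℝ} (h : IsLinearOp p D) {v w : F → ℝ → ℝ}
    (hv : SpaceSmooth p T v) (hw : SpaceSmooth p T w) {t : ℝ} (ht : t ∈ Icc 0 T) (x : F) :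
    liftOp D (v - w) x t = liftOp D v x t - liftOp D w x t := by
  have h1 : v - w = v + (-1 : ℝ) • w := by rw [neg_one_smul, sub_eq_add_neg]
  rw [h1, h.lift_add hv (hw.smul _) ht, h.lift_smul _ hw ht]
  ring

lemma IsLinearOp.lift_sum {D : (F → ℝ) → F → ℝ} (h : IsLinearOp p D) {ι : Type*} (I : Finset ι)
    (c : ι → ℝ) {v : ι → F → ℝ → ℝ}
    (hv : ∀ i, SpaceSmooth p T (v i)) {t : ℝ} (ht : t ∈ Icc 0 T) (x : F) :
    liftOp D (∑ i ∈ I, c i • v i) x t = ∑ i ∈ I, c i * liftOp D (v i) x t := by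
  classical
  induction I using Finset.induction_on with
  | empty =>
    have := h.lift_smul 0 (SpaceSmooth.zero (p := p) (F := F) (T := T)) ht x
    simpa using this
  | insert i I hi ih =>
    rw [Finset.sum_insert hi, Finset.sum_insert hi, h.lift_add ((hv i).smul _)
      (SpaceSmooth.sum _ fun j _ => (hv j).smul _) ht, ih, h.lift_smul _ (hv i) ht]

section Family

variable {ι : Type*} [Fintype ι] {Q : Set (EuclideanSpace ℝ (Fin n))}
  {L : EuclideanSpace ℝ (Fin n) → (F → ℝ) → F → ℝ}
  {A : ι → EuclideanSpace ℝ (Fin n) → F → ℝ → ℝ} {D : ι → (F → ℝ) → F → ℝ}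

lemma EllipticFamily.isLinearOp (hE : EllipticFamily p Q L A D) {q : EuclideanSpace ℝ (Fin n)}
    (hq : q ∈ Q) : IsLinearOp p (L q) where
  add {φ ψ} hφ hψ x := by
    have h1 : ContMDiff (𝓡 p) 𝓘(ℝ, ℝ) ∞ (fun x => φ x + ψ x) := hφ.add hψ
    rw [hE.rep q hq _ h1 x 0, hE.rep q hq _ hφ x 0, hE.rep q hq _ hψ x 0,
      ← Finset.sum_add_distrib]
    exact Finset.sum_congr rfl fun m _ => by rw [(hE.op m).add hφ hψ]; ring
  smul c {φ} hφ x := by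
    have h1 : ContMDiff (𝓡 p) 𝓘(ℝ, ℝ) ∞ (fun x => c * φ x) := contMDiff_const.mul hφ
    rw [hE.rep q hq _ h1 x 0, hE.rep q hq _ hφ x 0, Finset.mul_sum]
    exact Finset.sum_congr rfl fun m _ => by rw [(hE.op m).smul c hφ]; ring

/-- The one-sided estimate is applied to z and, by linearity of L_q, to -z. -/
theorem EllipticFamily.supBd [CompactSpace F] (hE : EllipticFamily p Q L A D)
    {q : EuclideanSpace ℝ (Fin n)} (hq : q ∈ Q) {z r : F → ℝ → ℝ}
    (hc : ContinuousOn (fun y : F × ℝ => z y.1 y.2) (univ ×ˢ Icc 0 T))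
    (hz : SpaceSmooth p T z)
    (heq : ∀ x, ∀ t ∈ Icc 0 T, HasDerivWithinAt (z x) (liftOp (L q) z x t + r x t) (Icc 0 T) t)
    {K β : ℝ} (hK : 0 ≤ K) (hβ : 0 ≤ β) (hr : ∀ t ∈ Icc 0 T, ∀ x, |r x t| ≤ K * |z x t| + β)
    (h0 : ∀ x, |z x 0| ≤ β) : SupBd T () z (Real.exp ((K + 1) * T) * β) := by
  intro t ht x
  rw [abs_le']
  have hlin := hE.isLinearOp hq
  constructor
  · refine le_of_parabolic_inequality hc heq (fun s hs y hy => ?_) hK hβ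
      (fun s hs y => (le_abs_self _).trans (hr s hs y)) (fun y => (le_abs_self _).trans (h0 y)) ht x
    exact hE.nonpos_of_max q hq _ (hz s hs) y hy
  · refine le_of_parabolic_inequality (z := fun x t => - z x t)
      (Lz := fun x t => - liftOp (L q) z x t) (r := fun x t => - r x t) hc.neg
      (fun y s hs => ?_) (fun s hs y hy => ?_) hK hβ
      (fun s hs y => (neg_le_abs _).trans (by simpa using hr s hs y))
      (fun y => (neg_le_abs _).trans (h0 y)) ht x
    · exact ((heq y s hs).neg).congr_deriv (by ring)
    · have h1 := hlin.smul (-1) (hz s hs) y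
      have h2 := hE.nonpos_of_max q hq (fun x => -1 * z x s) (contMDiff_const.mul (hz s hs)) y
        (fun y' => by have := hy y'; linarith)
      rw [h1] at h2
      simp only [liftOp]
      linarith

lemma exists_uniform_bound {V S X : Type*} [AddCommGroup V] [Module ℝ V] {Bd : S → V → ℝ → Prop}
    (hB : IsBound Bd) {l : Filter X} {r : X → V} (I : Finset S)
    (h : ∀ s ∈ I, ∃ C, ∀ᶠ q in l, Bd s (r q) C) : ∃ C, ∀ᶠ q in l, ∀ s ∈ I, Bd s (r q) C := by
  classical
  induction I using Finset.induction_on with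
  | empty => exact ⟨0, by simp⟩
  | insert i I hi ih =>
    obtain ⟨C, hC⟩ := h i (Finset.mem_insert_self _ _)
    obtain ⟨C', hC'⟩ := ih fun s hs => h s (Finset.mem_insert_of_mem hs)
    refine ⟨max C C', ?_⟩
    filter_upwards [hC, hC'] with q h1 h2 s hs
    rcases Finset.mem_insert.1 hs with rfl | hs
    · exact hB.mono h1 (le_max_left _ _)
    · exact hB.mono (h2 s hs) (le_max_right _ _)

lemma RemBd.uniform {V S : Type*} [AddCommGroup V] [Module ℝ V] {Bd : S → V → ℝ → Prop}
    (hB : IsBound Bd) {e : ℝ} (he : 0 ≤ e)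
    {ρ : EuclideanSpace ℝ (Fin n) → EuclideanSpace ℝ (Fin n) → V} (h : RemBd Bd Q e ρ)
    (I : Finset S) {q₀ : EuclideanSpace ℝ (Fin n)} (hq : q₀ ∈ Q) :
    ∃ C θ : ℝ, 0 < θ ∧ ∀ᶠ z in 𝓝 (q₀, q₀), ∀ s ∈ I,
      Bd s (ρ z.1 z.2) (C * ‖z.2 - z.1‖ ^ (e + θ)) := by
  classical
  induction I using Finset.induction_on with
  | empty => exact ⟨0, 1, one_pos, by simp⟩
  | insert i I hi ih =>
    obtain ⟨C, θ, hθ, hC⟩ := h i q₀ hq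
    obtain ⟨C', θ', hθ', hC'⟩ := ih
    refine ⟨max |C| |C'|, min θ θ', lt_min hθ hθ', ?_⟩
    have hm : 0 < min θ θ' := lt_min hθ hθ'
    filter_upwards [hC, hC', eventually_norm_sub_le_one q₀] with z h1 h2 h3 s hs
    rcases Finset.mem_insert.1 hs with rfl | hs
    · refine hB.mono h1 ((mul_rpow_le_mul_rpow (norm_nonneg _) h3 (by linarith)
        (by linarith [min_le_left θ θ'] : e + min θ θ' ≤ _)).trans ?_)
      exact mul_le_mul_of_nonneg_right (le_max_left _ _) (by positivity)
    · refine hB.mono (h2 s hs) ((mul_rpow_le_mul_rpow (norm_nonneg _) h3 (by linarith)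
        (by linarith [min_le_right θ θ'] : e + min θ θ' ≤ _)).trans ?_)
      exact mul_le_mul_of_nonneg_right (le_max_right _ _) (by positivity)

lemma RemBd.lift {E : (F → ℝ) → F → ℝ} (hE : IsBoundedOp p E) {e : ℝ} (he : 0 ≤ e)
    {ρ : EuclideanSpace ℝ (Fin n) → EuclideanSpace ℝ (Fin n) → F → ℝ → ℝ}
    (h : RemBd (JetBd p T) Q e ρ) : RemBd (SupBd T) Q e (fun q q' => liftOp E (ρ q q')) := by
  classical
  intro _ q₀ hq
  obtain ⟨I, -, hI⟩ := hE.bound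
  obtain ⟨C, θ, hθ, hC⟩ := h.uniform isBound_jetBd he (insert none (I.image some)) hq
  refine ⟨C, θ, hθ, ?_⟩
  filter_upwards [hC] with z hz
  exact hI T _ _ (hz none (Finset.mem_insert_self _ _)).smooth fun s hs =>
    hz (some s) (Finset.mem_insert_of_mem (Finset.mem_image_of_mem _ hs))

/-- The operators see only derivatives of order at least one, so v itself need not be bounded. This
matters in `Sol.holder`, which precedes local boundedness of the solutions. -/
lemma locBd_lift (hQ : IsOpen Q) {E : (F → ℝ) → F → ℝ} (hE : IsBoundedOp p E)
    {v : EuclideanSpace ℝ (Fin n) → F → ℝ → ℝ} (hv : ∀ q ∈ Q, SpaceSmooth p T (v q))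
    (hb : ∀ κ j, 1 ≤ j → ∀ q₀ ∈ Q, ∃ C, ∀ᶠ q in 𝓝 q₀, JetBd p T (some (κ, j)) (v q) C) :
    LocBd (SupBd T) Q (fun q => liftOp E (v q)) := by
  intro _ q₀ hq
  obtain ⟨I, hI1, hI⟩ := hE.bound
  obtain ⟨C, hC⟩ := exists_uniform_bound (isBound_jetBd (p := p) (F := F) (T := T))
    (l := 𝓝 q₀) (r := v) (I.map Function.Embedding.some)
    (by
      intro s hs
      obtain ⟨s', hs', rfl⟩ := Finset.mem_map.1 hs
      exact hb s'.1 s'.2 (hI1 s' hs') q₀ hq)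
  refine ⟨C, ?_⟩
  filter_upwards [hC, hQ.mem_nhds hq] with q h1 h2
  exact hI T _ _ (hv q h2) fun s hs => h1 _ (Finset.mem_map_of_mem _ hs)

lemma RemBd.congr_of_eqOn (hQ : IsOpen Q) {e : ℝ}
    {ρ ρ' : EuclideanSpace ℝ (Fin n) → EuclideanSpace ℝ (Fin n) → F → ℝ → ℝ}
    (h : RemBd (SupBd T) Q e ρ)
    (h' : ∀ q ∈ Q, ∀ q' ∈ Q, ∀ t ∈ Icc 0 T, ∀ x, ρ q q' x t = ρ' q q' x t) :
    RemBd (SupBd T) Q e ρ' := by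
  intro s q₀ hq
  obtain ⟨C, θ, hθ, hC⟩ := h s q₀ hq
  refine ⟨C, θ, hθ, ?_⟩
  filter_upwards [hC, eventually_fst_diag (hQ.mem_nhds hq), eventually_snd_diag (hQ.mem_nhds hq)]
    with z h1 h2 h3 t ht x
  rw [← h' _ h2 _ h3 t ht x]
  exact h1 t ht x

lemma CkH.lift (hQ : IsOpen Q) {E : (F → ℝ) → F → ℝ} (hE : IsBoundedOp p E) {k : ℕ}
    {v : EuclideanSpace ℝ (Fin n) → F → ℝ → ℝ} (h : CkH (JetBd p T) Q k v) :
    CkH (SupBd T) Q k (fun q => liftOp E (v q)) := by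
  have hsm : ∀ {k} {v : EuclideanSpace ℝ (Fin n) → F → ℝ → ℝ}, CkH (JetBd p T) Q k v →
      ∀ q ∈ Q, SpaceSmooth p T (v q) := fun h q hq => by
    obtain ⟨C, hC⟩ := h.locBd none q hq
    exact hC.self_of_nhds.smooth
  have hloc : ∀ {k} {v : EuclideanSpace ℝ (Fin n) → F → ℝ → ℝ}, CkH (JetBd p T) Q k v →
      LocBd (SupBd T) Q (fun q => liftOp E (v q)) := fun h =>
    locBd_lift hQ hE (hsm h) fun κ j _ => h.locBd (some (κ, j))
  induction k generalizing v with
  | zero =>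
    refine ⟨hloc h, ((h.2).lift hE le_rfl).congr_of_eqOn hQ fun q hq q' hq' t ht x => ?_⟩
    exact hE.lift_sub (hsm h q' hq') (hsm h q hq) ht x
  | succ k ih =>
    have h' := h
    obtain ⟨h1, r', hr', hrem⟩ := h
    refine ⟨hloc h', fun i q => liftOp E (r' i q), fun i => ih (hr' i),
      (hrem.lift hE zero_le_one).congr_of_eqOn hQ fun q hq q' hq' t ht x => ?_⟩
    have hs : ∀ i, SpaceSmooth p T (r' i q) := fun i => hsm (hr' i) q hq
    rw [hE.lift_sub ((hsm h' q' hq').sub (hsm h' q hq))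
      (SpaceSmooth.sum _ fun i _ => (hs i).smul _) ht,
      hE.lift_sub (hsm h' q' hq') (hsm h' q hq) ht, hE.lift_sum _ _ hs ht]
    simp

/-- Interpolation with ρ = |q' - q| and c = 0. The exponent drops from e + θ to e + θ/2, which is
still above e. -/
lemma remBd_jetBd_of_supBd {e : ℝ} (he : 0 ≤ e)
    {ρ : EuclideanSpace ℝ (Fin n) → EuclideanSpace ℝ (Fin n) → F → ℝ → ℝ}
    (hρ : ∀ q, ρ q q = 0)
    (hsup : ∀ q₀ ∈ Q, ∃ C θ : ℝ, 0 < θ ∧ ∀ᶠ z in 𝓝 (q₀, q₀),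
      JetBd p T none (ρ z.1 z.2) (C * ‖z.2 - z.1‖ ^ (e + θ)))
    (hjet : ∀ κ j, 1 ≤ j → ∀ q₀ ∈ Q, ∃ C, ∀ᶠ z in 𝓝 (q₀, q₀),
      JetBd p T (some (κ, j)) (ρ z.1 z.2) C) : RemBd (JetBd p T) Q e ρ := by
  intro s q₀ hq
  obtain ⟨C, θ, hθ, hC⟩ := hsup q₀ hq
  -- The powers of ρ require ρ > 0, so the diagonal is removed; there the family vanishes and the
  -- bound is trivial.
  set l : Filter (EuclideanSpace ℝ (Fin n) × EuclideanSpace ℝ (Fin n)) :=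
    𝓝 (q₀, q₀) ⊓ 𝓟 {z | z.2 ≠ z.1} with hl
  have hll : ∀ {P : EuclideanSpace ℝ (Fin n) × EuclideanSpace ℝ (Fin n) → Prop},
      (∀ᶠ z in 𝓝 (q₀, q₀), P z) → ∀ᶠ z in l, P z := fun h => h.filter_mono inf_le_left
  have hpos : ∀ᶠ z in l, 0 < ‖z.2 - z.1‖ ∧ ‖z.2 - z.1‖ ≤ 1 := by
    filter_upwards [hll (eventually_norm_sub_le_one q₀),
      (eventually_principal.2 fun z hz => hz).filter_mono inf_le_right] with z h1 h2
    exact ⟨norm_pos_iff.2 (sub_ne_zero.2 h2), h1⟩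
  obtain ⟨C', hC'⟩ := jetBd_of_supBd (p := p) (T := T) (l := l) (φ := fun z => ρ z.1 z.2)
    (ρ := fun z => ‖z.2 - z.1‖) hpos (θ := e + θ) (c := 0) ⟨C, hll hC⟩
    (fun κ j hj => by
      obtain ⟨C, hC⟩ := hjet κ j hj q₀ hq
      exact ⟨C, by simpa using hll hC⟩) (e := e + θ / 2) (by linarith) s
  refine ⟨C', θ / 2, by positivity, ?_⟩
  rw [hl, eventually_inf_principal] at hC'
  filter_upwards [hC'] with z hz
  by_cases h : z.2 = z.1
  · rw [h, hρ, sub_self, norm_zero, Real.zero_rpow (by positivity), mul_zero]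
    exact isBound_jetBd.zero
  · exact hz h

variable (p) in
/-- Families of solutions of `∂ₜ v = L_q v + R`, with locally bounded derivatives in space. -/
structure Sol (Q : Set (EuclideanSpace ℝ (Fin n))) (T : ℝ)
    (L : EuclideanSpace ℝ (Fin n) → (F → ℝ) → F → ℝ)
    (v R : EuclideanSpace ℝ (Fin n) → F → ℝ → ℝ) : Prop where
  cont : ∀ q ∈ Q, ContinuousOn (fun y : F × ℝ => v q y.1 y.2) (univ ×ˢ Icc 0 T)
  smooth : ∀ q ∈ Q, SpaceSmooth p T (v q)
  eq : ∀ q ∈ Q, ∀ x, ∀ t ∈ Icc 0 T,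
    HasDerivWithinAt (v q x) (liftOp (L q) (v q) x t + R q x t) (Icc 0 T) t
  bdd : ∀ κ j, 1 ≤ j → ∀ q₀ ∈ Q, ∃ C, ∀ᶠ q in 𝓝 q₀, JetBd p T (some (κ, j)) (v q) C

/-- The increment of the operators, applied to the family itself. -/
lemma EllipticFamily.lift_sub_lift (hE : EllipticFamily p Q L A D)
    {v : F → ℝ → ℝ} (hv : SpaceSmooth p T v) {q q' : EuclideanSpace ℝ (Fin n)} (hq : q ∈ Q)
    (hq' : q' ∈ Q) {t : ℝ} (ht : t ∈ Icc 0 T) (x : F) :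
    liftOp (L q') v x t - liftOp (L q) v x t =
      ∑ m, (A m q' x t - A m q x t) * liftOp (D m) v x t := by
  simp only [liftOp, hE.rep q' hq' _ (hv t ht) x t, hE.rep q hq _ (hv t ht) x t,
    ← Finset.sum_sub_distrib, sub_mul]

/-- The difference z = v_q' - v_q satisfies ∂ₜz = L_q z + ∑ (A_q' - A_q) D v_q' + R_q' - R_q. The
sum is small because the derivatives of v_q' are locally bounded, and the part of R_q' - R_q
proportional to |z| is absorbed by the maximum principle. Interpolation then passes to all
derivatives. -/
theorem Sol.holder [CompactSpace F] (hE : EllipticFamily p Q L A D) (hQ : IsOpen Q) (hT : 0 ≤ T)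
    {e : ℝ} (he : 0 ≤ e) (he1 : e < 1) {v R : EuclideanSpace ℝ (Fin n) → F → ℝ → ℝ} (hv : Sol p Q T L v R)
    (hR : ∀ q₀ ∈ Q, ∃ K C θ : ℝ, 0 ≤ K ∧ 0 < θ ∧ ∀ᶠ z in 𝓝 (q₀, q₀), ∀ t ∈ Icc 0 T, ∀ x,
      |R z.2 x t - R z.1 x t| ≤ K * |v z.2 x t - v z.1 x t| + C * ‖z.2 - z.1‖ ^ (e + θ))
    (h0 : RemBd (SupBd T) Q e (fun q q' x _ => v q' x 0 - v q x 0)) :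
    RemBd (JetBd p T) Q e (fun q q' => v q' - v q) := by
  have hB := isBound_supBd (F := F) (T := T)
  refine remBd_jetBd_of_supBd he (fun q => sub_self _) (fun q₀ hq₀ => ?_)
    (fun κ j hj q₀ hq₀ => ?_)
  · have hG : RemBd (SupBd T) Q e (fun q q' => ∑ m, liftOp (D m) (v q') * (A m q' - A m q)) :=
      RemBd.sum hB he _ fun m _ => RemBd.locBd_mul
        (locBd_lift hQ (hE.op m) hv.smooth hv.bdd).snd
        ((hE.coeff T 1 m).holder_of_lt_one hB he he1)
    obtain ⟨K, C₁, θ₁, hK, hθ₁, h1⟩ := hR q₀ hq₀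
    obtain ⟨C₂, θ₂, hθ₂, h2⟩ := hG () q₀ hq₀
    obtain ⟨C₃, θ₃, hθ₃, h3⟩ := h0 () q₀ hq₀
    set θ := min θ₁ (min θ₂ θ₃) with hθ
    have hθ0 : 0 < θ := lt_min hθ₁ (lt_min hθ₂ hθ₃)
    refine ⟨Real.exp ((K + 1) * T) * (|C₁| + |C₂| + |C₃|), θ, hθ0, ?_⟩
    filter_upwards [h1, h2, h3, eventually_norm_sub_le_one q₀,
      eventually_fst_diag (hQ.mem_nhds hq₀), eventually_snd_diag (hQ.mem_nhds hq₀)]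
      with ⟨q, q'⟩ h1 h2 h3 hd hq hq'
    simp only at h1 h2 h3 hd hq hq' ⊢
    have hsm := (hv.smooth q' hq').sub (hv.smooth q hq)
    refine ⟨hsm, ?_⟩
    rw [mul_assoc]
    set d := ‖q' - q‖
    have hd0 : 0 ≤ d := norm_nonneg _
    have b1 : C₁ * d ^ (e + θ₁) ≤ |C₁| * d ^ (e + θ) :=
      mul_rpow_le_mul_rpow hd0 hd (by positivity) (by linarith [min_le_left θ₁ (min θ₂ θ₃)])
    have b2 : C₂ * d ^ (e + θ₂) ≤ |C₂| * d ^ (e + θ) :=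
      mul_rpow_le_mul_rpow hd0 hd (by positivity)
        (by linarith [min_le_right θ₁ (min θ₂ θ₃), min_le_left θ₂ θ₃])
    have b3 : C₃ * d ^ (e + θ₃) ≤ |C₃| * d ^ (e + θ) :=
      mul_rpow_le_mul_rpow hd0 hd (by positivity)
        (by linarith [min_le_right θ₁ (min θ₂ θ₃), min_le_right θ₂ θ₃])
    have p1 : 0 ≤ |C₁| * d ^ (e + θ) := by positivity
    have p2 : 0 ≤ |C₂| * d ^ (e + θ) := by positivity
    have p3 : 0 ≤ |C₃| * d ^ (e + θ) := by positivity
    refine hE.supBd hq (z := v q' - v q)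
      (r := fun x t => (∑ m, liftOp (D m) (v q') * (A m q' - A m q)) x t + (R q' x t - R q x t))
      ((hv.cont q' hq').sub (hv.cont q hq)) hsm (fun x t ht => ?_) hK (by positivity)
      (fun t ht x => ?_) (fun x => ?_)
    · refine ((hv.eq q' hq' x t ht).sub (hv.eq q hq x t ht)).congr_deriv ?_
      have e1 := hE.lift_sub_lift (hv.smooth q' hq') hq hq' ht x
      rw [(hE.isLinearOp hq).lift_sub (hv.smooth q' hq') (hv.smooth q hq) ht]
      simp only [Finset.sum_apply, Pi.mul_apply, Pi.sub_apply]
      have e2 : ∑ m, liftOp (D m) (v q') x t * (A m q' x t - A m q x t) =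
          ∑ m, (A m q' x t - A m q x t) * liftOp (D m) (v q') x t :=
        Finset.sum_congr rfl fun m _ => mul_comm _ _
      rw [e2, ← e1]
      ring
    · refine (abs_add_le _ _).trans ?_
      have c1 := h1 t ht x
      have c2 := h2 t ht x
      simp only [Pi.sub_apply] at c1 c2 ⊢
      nlinarith
    · have c3 := h3 0 ⟨le_rfl, hT⟩ x
      simp only [Pi.sub_apply] at c3 ⊢
      nlinarith
  · obtain ⟨C, hC⟩ := hv.bdd κ j hj q₀ hq₀
    refine ⟨C + |(-1 : ℝ)| * C, ?_⟩
    filter_upwards [eventually_fst_diag hC, eventually_snd_diag hC] with z h1 h2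
    have := isBound_jetBd.add h2 (isBound_jetBd.smul (-1) h1)
    rwa [neg_one_smul, ← sub_eq_add_neg] at this

end Family

end Elliptic

/-! ### Linearization in the parameter and dyadic difference quotients -/

section Differentiability

variable {p n : ℕ} {F : Type*} [TopologicalSpace F] [ChartedSpace (EuclideanSpace ℝ (Fin p)) F]
  [IsManifold (𝓡 p) ∞ F] {T : ℝ} {ι : Type*} [Fintype ι] {Q : Set (EuclideanSpace ℝ (Fin n))}
  {L : EuclideanSpace ℝ (Fin n) → (F → ℝ) → F → ℝ}
  {A : ι → EuclideanSpace ℝ (Fin n) → F → ℝ → ℝ} {D : ι → (F → ℝ) → F → ℝ}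

/-- The remainder in the linearization of `q ↦ L_q v_q + R_q`. -/
def linErr (L : EuclideanSpace ℝ (Fin n) → (F → ℝ) → F → ℝ)
    (v R a : EuclideanSpace ℝ (Fin n) → F → ℝ → ℝ)
    (N : Fin n → EuclideanSpace ℝ (Fin n) → F → ℝ → ℝ) (q q' : EuclideanSpace ℝ (Fin n)) :
    F → ℝ → ℝ := fun x t =>
  (liftOp (L q') (v q') x t + R q' x t) - (liftOp (L q) (v q) x t + R q x t) -
    liftOp (L q) (v q' - v q) x t - a q x t * (v q' x t - v q x t) -
    ∑ i, (q' i - q i) * N i q x t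

/-- The increment of the coefficients acting on v_q' splits into (A_q' - A_q - ∑ (q'_i - q_i) A'_i)
D v_q', the linear part ∑ (q'_i - q_i) A'_i D v_q, and the cross terms (q'_i - q_i) A'_i D(v_q' -
v_q). The cross terms are of order above one because v is Hölder continuous in q together with its
derivatives. -/
lemma remBd_linErr (hE : EllipticFamily p Q L A D) (hQ : IsOpen Q)
    {v R a : EuclideanSpace ℝ (Fin n) → F → ℝ → ℝ} (hv : Sol p Q T L v R)
    (hvH : RemBd (JetBd p T) Q 0 (fun q q' => v q' - v q))
    {ρ : Fin n → EuclideanSpace ℝ (Fin n) → F → ℝ → ℝ}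
    (hR : RemBd (SupBd T) Q 1
      (fun q q' => R q' - R q - a q * (v q' - v q) - ∑ i, (q' i - q i) • ρ i q))
    {A' : ι → Fin n → EuclideanSpace ℝ (Fin n) → F → ℝ → ℝ}
    (hA' : ∀ m i, LocBd (SupBd T) Q (A' m i))
    (hA : ∀ m, RemBd (SupBd T) Q 1
      (fun q q' => A m q' - A m q - ∑ i, (q' i - q i) • A' m i q)) :
    RemBd (SupBd T) Q 1
      (linErr L v R a fun i q => ρ i q + ∑ m, A' m i q * liftOp (D m) (v q)) := by
  have hB := isBound_supBd (F := F) (T := T)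
  have h1 : RemBd (SupBd T) Q 1 (fun q q' => ∑ m, liftOp (D m) (v q') *
      (A m q' - A m q - ∑ i, (q' i - q i) • A' m i q)) :=
    RemBd.sum hB zero_le_one _ fun m _ => RemBd.locBd_mul
      (locBd_lift hQ (hE.op m) hv.smooth hv.bdd).snd (hA m)
  have h2 : RemBd (SupBd T) Q 1 (fun q q' => ∑ m, ∑ i, (q' i - q i) •
      (A' m i q * liftOp (D m) (v q' - v q))) :=
    RemBd.sum hB zero_le_one _ fun m _ => RemBd.sum hB zero_le_one _ fun i _ =>
      ((RemBd.locBd_mul (hA' m i).fst (hvH.lift (hE.op m) le_rfl)).smul_disp hB le_rfl i).mono hB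
        zero_le_one (by norm_num)
  refine ((h1.add hB zero_le_one h2).add hB zero_le_one hR).congr_of_eqOn hQ
    fun q hq q' hq' t ht x => ?_
  have e1 := hE.lift_sub_lift (hv.smooth q' hq') hq hq' ht x
  have e2 : ∀ m, liftOp (D m) (v q' - v q) x t = liftOp (D m) (v q') x t - liftOp (D m) (v q) x t :=
    fun m => (hE.op m).lift_sub (hv.smooth q' hq') (hv.smooth q hq) ht x
  have e3 : liftOp (L q') (v q') x t - liftOp (L q) (v q) x t - liftOp (L q) (v q' - v q) x t =
      ∑ m, (A m q' x t - A m q x t) * liftOp (D m) (v q') x t := by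
    rw [(hE.isLinearOp hq).lift_sub (hv.smooth q' hq') (hv.smooth q hq) ht, ← e1]
    ring
  have e4 : linErr L v R a (fun i q => ρ i q + ∑ m, A' m i q * liftOp (D m) (v q)) q q' x t =
      ∑ m, (A m q' x t - A m q x t) * liftOp (D m) (v q') x t + (R q' x t - R q x t -
        a q x t * (v q' x t - v q x t)) - ∑ i, (q' i - q i) *
          (ρ i q + ∑ m, A' m i q * liftOp (D m) (v q)) x t := by
    rw [← e3, linErr]; ring
  rw [e4]
  simp only [Pi.add_apply, Finset.sum_apply, Pi.mul_apply, Pi.sub_apply, Pi.smul_apply,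
    smul_eq_mul, e2, mul_add, mul_sub, Finset.sum_add_distrib, Finset.sum_sub_distrib,
    Finset.mul_sum]
  have e5 : ∑ i, ∑ m, (q' i - q i) * (A' m i q x t * liftOp (D m) (v q) x t) =
      ∑ m, ∑ i, (q' i - q i) * (A' m i q x t * liftOp (D m) (v q) x t) := Finset.sum_comm
  have e6 : ∑ m, ∑ i, liftOp (D m) (v q') x t * ((q' i - q i) * A' m i q x t) =
      ∑ m, ∑ i, (q' i - q i) * (A' m i q x t * liftOp (D m) (v q') x t) :=
    Finset.sum_congr rfl fun m _ => Finset.sum_congr rfl fun i _ => by ring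
  have e7 : ∑ m, (A m q' x t - A m q x t) * liftOp (D m) (v q') x t =
      ∑ m, liftOp (D m) (v q') x t * A m q' x t - ∑ m, liftOp (D m) (v q') x t * A m q x t := by
    rw [← Finset.sum_sub_distrib]
    exact Finset.sum_congr rfl fun m _ => by ring
  rw [e5, e6, e7]
  ring

/-- The point used for the difference quotients in the direction of the `i`-th axis. -/
def dyadicPt (i : Fin n) (m : ℕ) (q : EuclideanSpace ℝ (Fin n)) : EuclideanSpace ℝ (Fin n) :=
  q + ((1 / 2 : ℝ) ^ m) • EuclideanSpace.single i (1 : ℝ)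

/-- Dyadic difference quotients in the direction of the `i`-th axis. -/
def dyadicQuot (v : EuclideanSpace ℝ (Fin n) → F → ℝ → ℝ) (i : Fin n) (m : ℕ)
    (q : EuclideanSpace ℝ (Fin n)) : F → ℝ → ℝ :=
  ((2 : ℝ) ^ m) • (v (dyadicPt i m q) - v q)

lemma norm_dyadicPt_sub (i : Fin n) (m : ℕ) (q : EuclideanSpace ℝ (Fin n)) :
    ‖dyadicPt i m q - q‖ = (1 / 2 : ℝ) ^ m := by
  simp [dyadicPt, norm_smul]

lemma sum_dyadicPt_sub (i : Fin n) (m : ℕ) (q : EuclideanSpace ℝ (Fin n)) (c : Fin n → ℝ) :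
    ∑ j, (dyadicPt i m q j - q j) * c j = (1 / 2 : ℝ) ^ m * c i := by
  have : ∀ j, dyadicPt i m q j - q j = if j = i then (1 / 2 : ℝ) ^ m else 0 := by
    intro j
    by_cases h : j = i
    · subst h; simp [dyadicPt]
    · simp [dyadicPt, h]
  simp [this]

lemma tendsto_dyadicPt (i : Fin n) (q₀ : EuclideanSpace ℝ (Fin n)) :
    Tendsto (fun y : ℕ × EuclideanSpace ℝ (Fin n) => (y.2, dyadicPt i y.1 y.2))
      (atTop ×ˢ 𝓝 q₀) (𝓝 (q₀, q₀)) := by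
  have h1 : Tendsto (fun y : ℕ × EuclideanSpace ℝ (Fin n) => y.2) (atTop ×ˢ 𝓝 q₀) (𝓝 q₀) :=
    tendsto_snd
  have h2 : Tendsto (fun y : ℕ × EuclideanSpace ℝ (Fin n) => (1 / 2 : ℝ) ^ y.1)
      (atTop ×ˢ 𝓝 q₀) (𝓝 0) :=
    (tendsto_pow_atTop_nhds_zero_of_lt_one (by norm_num) (by norm_num)).comp tendsto_fst
  refine h1.prodMk_nhds ?_
  have h3 := h1.add (h2.smul_const (EuclideanSpace.single i (1 : ℝ)))
  rwa [zero_smul, add_zero] at h3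

lemma tendsto_dyadicPt_succ (i : Fin n) (q₀ : EuclideanSpace ℝ (Fin n)) :
    Tendsto (fun y : ℕ × EuclideanSpace ℝ (Fin n) => (y.2, dyadicPt i (y.1 + 1) y.2))
      (atTop ×ˢ 𝓝 q₀) (𝓝 (q₀, q₀)) :=
  (tendsto_dyadicPt i q₀).comp (((tendsto_add_atTop_nat 1).comp tendsto_fst).prodMk tendsto_snd)

lemma two_pow_mul_half_rpow (m : ℕ) (C θ : ℝ) :
    (2 : ℝ) ^ m * (C * ((1 / 2 : ℝ) ^ m) ^ (1 + θ)) = C * ((1 / 2 : ℝ) ^ m) ^ θ := by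
  have h : (0 : ℝ) < (1 / 2 : ℝ) ^ m := by positivity
  rw [Real.rpow_add h, Real.rpow_one]
  have : (2 : ℝ) ^ m * (1 / 2 : ℝ) ^ m = 1 := by rw [← mul_pow]; norm_num
  calc (2 : ℝ) ^ m * (C * ((1 / 2 : ℝ) ^ m * ((1 / 2 : ℝ) ^ m) ^ θ))
      = ((2 : ℝ) ^ m * (1 / 2 : ℝ) ^ m) * (C * ((1 / 2 : ℝ) ^ m) ^ θ) := by ring
    _ = _ := by rw [this, one_mul]

lemma dyadicQuot_hasDerivWithinAt (hE : EllipticFamily p Q L A D)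
    {v R : EuclideanSpace ℝ (Fin n) → F → ℝ → ℝ} (hv : Sol p Q T L v R)
    (a : EuclideanSpace ℝ (Fin n) → F → ℝ → ℝ)
    (N : Fin n → EuclideanSpace ℝ (Fin n) → F → ℝ → ℝ) (i : Fin n) (m : ℕ)
    {q : EuclideanSpace ℝ (Fin n)} (hq : q ∈ Q) (hq' : dyadicPt i m q ∈ Q) (x : F) {t : ℝ}
    (ht : t ∈ Icc 0 T) :
    HasDerivWithinAt (dyadicQuot v i m q x) (liftOp (L q) (dyadicQuot v i m q) x t +
      (a q x t * dyadicQuot v i m q x t + N i q x t +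
        2 ^ m * linErr L v R a N q (dyadicPt i m q) x t)) (Icc 0 T) t := by
  refine (((hv.eq _ hq' x t ht).sub (hv.eq q hq x t ht)).const_mul ((2 : ℝ) ^ m)).congr_deriv ?_
  rw [dyadicQuot, (hE.isLinearOp hq).lift_smul _ ((hv.smooth _ hq').sub (hv.smooth q hq)) ht,
    linErr, sum_dyadicPt_sub]
  have : (2 : ℝ) ^ m * (1 / 2 : ℝ) ^ m = 1 := by rw [← mul_pow]; norm_num
  simp only [Pi.smul_apply, Pi.sub_apply, smul_eq_mul]
  linear_combination (N i q x t) * this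

/-- Both quotients solve the linearized equation with the same inhomogeneity N_i, up to 2^m times a
remainder of size 2^(-m(1+θ)). Their difference therefore solves a homogeneous equation up to
O(2^(-mθ)), and its initial values are as small. The filter in (m, q) makes everything locally
uniform in q. -/
theorem dyadicQuot_cauchy [CompactSpace F] (hE : EllipticFamily p Q L A D) (hQ : IsOpen Q)
    (hT : 0 ≤ T) {v R a : EuclideanSpace ℝ (Fin n) → F → ℝ → ℝ} (hv : Sol p Q T L v R)
    (ha : LocBd (SupBd T) Q a) {N v₀' : Fin n → EuclideanSpace ℝ (Fin n) → F → ℝ → ℝ}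
    (hN : RemBd (SupBd T) Q 1 (linErr L v R a N))
    (h0 : RemBd (SupBd T) Q 1
      (fun q q' x _ => v q' x 0 - v q x 0 - ∑ i, (q' i - q i) * v₀' i q x 0))
    (i : Fin n) {q₀ : EuclideanSpace ℝ (Fin n)} (hq₀ : q₀ ∈ Q)
    (s : Option (ChartCompact p F × ℕ)) :
    ∃ C r : ℝ, 0 ≤ r ∧ r < 1 ∧ ∀ᶠ y in atTop ×ˢ 𝓝 q₀,
      JetBd p T s (dyadicQuot v i (y.1 + 1) y.2 - dyadicQuot v i y.1 y.2) (C * r ^ y.1) := by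
  have hin : ∀ᶠ y : ℕ × EuclideanSpace ℝ (Fin n) in atTop ×ˢ 𝓝 q₀, y.2 ∈ Q ∧
      dyadicPt i y.1 y.2 ∈ Q ∧ dyadicPt i (y.1 + 1) y.2 ∈ Q := by
    have hm := hQ.mem_nhds hq₀
    filter_upwards [(tendsto_dyadicPt i q₀).eventually (eventually_fst_diag hm),
      (tendsto_dyadicPt i q₀).eventually (eventually_snd_diag hm),
      (tendsto_dyadicPt_succ i q₀).eventually (eventually_snd_diag hm)] with y h1 h2 h3
    exact ⟨h1, h2, h3⟩
  obtain ⟨K, hK⟩ := ha () q₀ hq₀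
  obtain ⟨C₁, θ₁, hθ₁, h1⟩ := hN () q₀ hq₀
  obtain ⟨C₂, θ₂, hθ₂, h2⟩ := h0 () q₀ hq₀
  set θ := min θ₁ θ₂ with hθ
  have hθ0 : 0 < θ := lt_min hθ₁ hθ₂
  have hpow : ∀ (m : ℕ) (C θ' : ℝ), θ ≤ θ' →
      C * ((1 / 2 : ℝ) ^ m) ^ θ' ≤ |C| * ((1 / 2 : ℝ) ^ m) ^ θ := fun m C θ' h =>
    mul_rpow_le_mul_rpow (by positivity) (pow_le_one₀ (by norm_num) (by norm_num)) hθ0.le h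
  have hpow' : ∀ (m : ℕ) (C θ' : ℝ), θ ≤ θ' →
      C * ((1 / 2 : ℝ) ^ (m + 1)) ^ θ' ≤ |C| * ((1 / 2 : ℝ) ^ m) ^ θ := fun m C θ' h => by
    refine (hpow (m + 1) C θ' h).trans (mul_le_mul_of_nonneg_left ?_ (abs_nonneg _))
    exact Real.rpow_le_rpow (by positivity)
      (pow_le_pow_of_le_one (by norm_num) (by norm_num) (Nat.le_succ m)) hθ0.le
  have hsup : ∃ C, ∀ᶠ y : ℕ × EuclideanSpace ℝ (Fin n) in atTop ×ˢ 𝓝 q₀, JetBd p T none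
      (dyadicQuot v i (y.1 + 1) y.2 - dyadicQuot v i y.1 y.2)
      (C * ((1 / 2 : ℝ) ^ y.1) ^ θ) := by
    refine ⟨Real.exp ((|K| + 1) * T) * (2 * (|C₁| + |C₂|)), ?_⟩
    filter_upwards [hin, (tendsto_snd (f := (atTop : Filter ℕ))).eventually hK,
      (tendsto_dyadicPt i q₀).eventually h1, (tendsto_dyadicPt_succ i q₀).eventually h1,
      (tendsto_dyadicPt i q₀).eventually h2, (tendsto_dyadicPt_succ i q₀).eventually h2]
      with ⟨m, q⟩ ⟨hq, hq', hq''⟩ hKq b1 b1' b2 b2'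
    simp only at hq hq' hq'' hKq b1 b1' b2 b2' ⊢
    have sm1 : SpaceSmooth p T (dyadicQuot v i (m + 1) q) :=
      ((hv.smooth _ hq'').sub (hv.smooth q hq)).smul _
    have sm2 : SpaceSmooth p T (dyadicQuot v i m q) :=
      ((hv.smooth _ hq').sub (hv.smooth q hq)).smul _
    refine ⟨sm1.sub sm2, ?_⟩
    rw [mul_assoc]
    rw [norm_dyadicPt_sub] at b1 b1' b2 b2'
    have p0 : 0 ≤ |C₁| * ((1 / 2 : ℝ) ^ m) ^ θ := by positivity
    have p1 : 0 ≤ |C₂| * ((1 / 2 : ℝ) ^ m) ^ θ := by positivity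
    have hscale : ∀ (k : ℕ) (y C θ' : ℝ), |y| ≤ C * ((1 / 2 : ℝ) ^ k) ^ (1 + θ') →
        |2 ^ k * y| ≤ C * ((1 / 2 : ℝ) ^ k) ^ θ' := fun k y C θ' h => by
      rw [abs_mul, abs_of_pos (by positivity : (0 : ℝ) < 2 ^ k), ← two_pow_mul_half_rpow]
      exact mul_le_mul_of_nonneg_left h (by positivity)
    refine hE.supBd hq (z := dyadicQuot v i (m + 1) q - dyadicQuot v i m q)
      (r := fun x t => a q x t * (dyadicQuot v i (m + 1) q - dyadicQuot v i m q) x t +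
        (2 ^ (m + 1) * linErr L v R a N q (dyadicPt i (m + 1) q) x t -
          2 ^ m * linErr L v R a N q (dyadicPt i m q) x t)) ?_ (sm1.sub sm2)
      (fun x t ht => ?_) (abs_nonneg K) (by positivity) (fun t ht x => ?_) (fun x => ?_)
    · exact (continuousOn_const.mul ((hv.cont _ hq'').sub (hv.cont q hq))).sub
        (continuousOn_const.mul ((hv.cont _ hq').sub (hv.cont q hq)))
    · refine ((dyadicQuot_hasDerivWithinAt hE hv a N i (m + 1) hq hq'' x ht).sub
        (dyadicQuot_hasDerivWithinAt hE hv a N i m hq hq' x ht)).congr_deriv ?_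
      rw [(hE.isLinearOp hq).lift_sub sm1 sm2 ht]
      simp only [Pi.sub_apply]
      ring
    · refine (abs_add_le _ _).trans (add_le_add ?_ ?_)
      · rw [abs_mul]
        exact mul_le_mul_of_nonneg_right ((hKq t ht x).trans (le_abs_self _)) (abs_nonneg _)
      · refine (abs_sub _ _).trans ?_
        have c1 := (hscale _ _ _ _ (b1 t ht x)).trans (hpow _ _ _ (min_le_left _ _))
        have c2 := (hscale _ _ _ _ (b1' t ht x)).trans (hpow' _ _ _ (min_le_left _ _))
        linarith
    · have c1 := b2 0 ⟨le_rfl, hT⟩ x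
      have c2 := b2' 0 ⟨le_rfl, hT⟩ x
      beta_reduce at c1 c2
      rw [sum_dyadicPt_sub (c := fun i => v₀' i q x 0)] at c1 c2
      have c1' := (hscale _ _ _ _ c1).trans (hpow _ _ _ (min_le_right _ _))
      have c2' := (hscale _ _ _ _ c2).trans (hpow' _ _ _ (min_le_right _ _))
      have e : (dyadicQuot v i (m + 1) q - dyadicQuot v i m q) x 0 =
          2 ^ (m + 1) * (v (dyadicPt i (m + 1) q) x 0 - v q x 0 -
            (1 / 2 : ℝ) ^ (m + 1) * v₀' i q x 0) -
          2 ^ m * (v (dyadicPt i m q) x 0 - v q x 0 - (1 / 2 : ℝ) ^ m * v₀' i q x 0) := by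
        have e1 : (2 : ℝ) ^ m * (1 / 2 : ℝ) ^ m = 1 := by rw [← mul_pow]; norm_num
        have e2 : (2 : ℝ) ^ (m + 1) * (1 / 2 : ℝ) ^ (m + 1) = 1 := by rw [← mul_pow]; norm_num
        simp only [dyadicQuot, Pi.smul_apply, Pi.sub_apply, smul_eq_mul]
        linear_combination (v₀' i q x 0) * e2 - (v₀' i q x 0) * e1
      rw [e]
      refine (abs_sub _ _).trans ?_
      linarith
  have hjet : ∀ (κ : ChartCompact p F) j, 1 ≤ j → ∃ C,
      ∀ᶠ y : ℕ × EuclideanSpace ℝ (Fin n) in atTop ×ˢ 𝓝 q₀, JetBd p T (some (κ, j))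
      (dyadicQuot v i (y.1 + 1) y.2 - dyadicQuot v i y.1 y.2)
      (C * ((1 / 2 : ℝ) ^ y.1) ^ (-1 : ℝ)) := by
    intro κ j hj
    obtain ⟨C, hC⟩ := hv.bdd κ j hj q₀ hq₀
    -- The difference of the quotients is 2^(m+1) v'' - 2^m v' - 2^m v, and these weights add up to
    -- 4 · 2^m. Such growth is harmless: interpolation admits any fixed negative power of ρ =
    -- 2^(-m).
    refine ⟨4 * C, ?_⟩
    filter_upwards [(tendsto_dyadicPt i q₀).eventually (eventually_fst_diag hC),
      (tendsto_dyadicPt i q₀).eventually (eventually_snd_diag hC),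
      (tendsto_dyadicPt_succ i q₀).eventually (eventually_snd_diag hC)] with ⟨m, q⟩ b1 b2 b3
    have hB := isBound_jetBd (p := p) (F := F) (T := T)
    have c := hB.add (hB.add (hB.smul (2 ^ (m + 1)) b3) (hB.smul (-(2 ^ m)) b2))
      (hB.smul (-(2 ^ m)) b1)
    convert c using 1
    · simp only [dyadicQuot]
      module
    · rw [Real.rpow_neg_one, abs_neg, abs_of_pos (by positivity : (0 : ℝ) < 2 ^ (m + 1)),
        abs_of_pos (by positivity : (0 : ℝ) < 2 ^ m), one_div, inv_pow, inv_inv, pow_succ]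
      ring
  obtain ⟨C, hC⟩ := jetBd_of_supBd (p := p) (T := T) (l := atTop ×ˢ 𝓝 q₀)
    (φ := fun y => dyadicQuot v i (y.1 + 1) y.2 - dyadicQuot v i y.1 y.2)
    (ρ := fun y => (1 / 2 : ℝ) ^ y.1) (Eventually.of_forall fun y =>
      ⟨by positivity, pow_le_one₀ (by norm_num) (by norm_num)⟩) hsup hjet
    (show θ / 2 < θ by linarith) s
  -- Decay of order ρ^(θ/2) with ρ = 2^(-m) is geometric with ratio 2^(-θ/2).
  refine ⟨C, (1 / 2 : ℝ) ^ (θ / 2), by positivity,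
    Real.rpow_lt_one (by norm_num) (by norm_num) (by positivity), ?_⟩
  filter_upwards [hC] with y hy
  convert hy using 2
  rw [← Real.rpow_natCast, ← Real.rpow_natCast, ← Real.rpow_mul (by norm_num),
    ← Real.rpow_mul (by norm_num), mul_comm]

end Differentiability

/-! ### Limits of difference quotients are derivatives in the parameter -/

section Differentiability

variable {p n : ℕ} {F : Type*} [TopologicalSpace F] [ChartedSpace (EuclideanSpace ℝ (Fin p)) F]
  [IsManifold (𝓡 p) ∞ F] {T : ℝ} {ι : Type*} [Fintype ι] {Q : Set (EuclideanSpace ℝ (Fin n))}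
  {L : EuclideanSpace ℝ (Fin n) → (F → ℝ) → F → ℝ}
  {A : ι → EuclideanSpace ℝ (Fin n) → F → ℝ → ℝ} {D : ι → (F → ℝ) → F → ℝ}

lemma eventually_dyadicPt_mem (hQ : IsOpen Q) (i : Fin n) {q₀ : EuclideanSpace ℝ (Fin n)}
    (hq₀ : q₀ ∈ Q) : ∀ᶠ y : ℕ × EuclideanSpace ℝ (Fin n) in atTop ×ˢ 𝓝 q₀, y.2 ∈ Q ∧
      dyadicPt i y.1 y.2 ∈ Q := by
  have hm := hQ.mem_nhds hq₀
  filter_upwards [(tendsto_dyadicPt i q₀).eventually (eventually_fst_diag hm),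
    (tendsto_dyadicPt i q₀).eventually (eventually_snd_diag hm)] with y h1 h2 using ⟨h1, h2⟩

lemma eventually_of_prod_nhds {q : EuclideanSpace ℝ (Fin n)}
    {P : ℕ × EuclideanSpace ℝ (Fin n) → Prop} (h : ∀ᶠ y in atTop ×ˢ 𝓝 q, P y) :
    ∀ᶠ m in atTop, P (m, q) :=
  (tendsto_id.prodMk tendsto_const_nhds).eventually h

/-- If consecutive difference quotients are geometrically close in all seminorms, then they
converge geometrically in all seminorms. -/
lemma exists_limit_dyadicQuot (hQ : IsOpen Q) {v : EuclideanSpace ℝ (Fin n) → F → ℝ → ℝ}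
    (hv : ∀ q ∈ Q, SpaceSmooth p T (v q)) (i : Fin n)
    (h : ∀ q₀ ∈ Q, ∀ s : Option (ChartCompact p F × ℕ), ∃ C r : ℝ, 0 ≤ r ∧ r < 1 ∧
      ∀ᶠ y in atTop ×ˢ 𝓝 q₀, JetBd p T s (dyadicQuot v i (y.1 + 1) y.2 - dyadicQuot v i y.1 y.2)
        (C * r ^ y.1)) :
    ∃ w : EuclideanSpace ℝ (Fin n) → F → ℝ → ℝ, (∀ q ∈ Q, SpaceSmooth p T (w q)) ∧
      (∀ q ∈ Q, JetTendsto p T (fun m => dyadicQuot v i m q) (w q)) ∧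
      ∀ q₀ ∈ Q, ∀ s : Option (ChartCompact p F × ℕ), ∃ C r : ℝ, 0 ≤ r ∧ r < 1 ∧
        ∀ᶠ y in atTop ×ˢ 𝓝 q₀, JetBd p T s (w y.2 - dyadicQuot v i y.1 y.2) (C * r ^ y.1) := by
  have hsm : ∀ m q, q ∈ Q → dyadicPt i m q ∈ Q → SpaceSmooth p T (dyadicQuot v i m q) :=
    fun m q hq hq' => ((hv _ hq').sub (hv q hq)).smul _
  have hex : ∀ q, ∃ ψ : F → ℝ → ℝ, q ∈ Q →
      SpaceSmooth p T ψ ∧ JetTendsto p T (fun m => dyadicQuot v i m q) ψ := by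
    intro q
    by_cases hq : q ∈ Q
    · obtain ⟨ψ, hψ⟩ := exists_jetTendsto (p := p) (T := T) (φ := fun m => dyadicQuot v i m q)
        (by
          filter_upwards [eventually_of_prod_nhds (eventually_dyadicPt_mem hQ i hq)] with m hm
          exact hsm m q hm.1 hm.2)
        (fun s => by
          obtain ⟨C, r, h0, h1, hC⟩ := h q hq s
          exact ⟨C, r, h0, h1, eventually_of_prod_nhds hC⟩)
      exact ⟨ψ, fun _ => hψ⟩
    · exact ⟨0, fun h => absurd h hq⟩
  choose w hw using hex
  refine ⟨w, fun q hq => (hw q hq).1, fun q hq => (hw q hq).2, fun q₀ hq₀ s => ?_⟩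
  obtain ⟨C, r, h0, h1, hC⟩ := h q₀ hq₀ s
  refine ⟨C / (1 - r), r, h0, h1, ?_⟩
  -- A product neighbourhood is needed: summing the geometric tail at a given q uses the estimate
  -- for all k ≥ m at that same q.
  obtain ⟨pa, ha, pb, hb, hab⟩ := eventually_prod_iff.1
    (hC.and (eventually_dyadicPt_mem hQ i hq₀))
  obtain ⟨M, hM⟩ := eventually_atTop.1 ha
  rw [eventually_prod_iff]
  refine ⟨fun m => M ≤ m, eventually_ge_atTop M, pb, hb, fun {m} hm {q} hq => ?_⟩
  have hqQ : q ∈ Q := (hab (hM M le_rfl) hq).2.1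
  have := (hw q hqQ).2.jetBd (hw q hqQ).1
    (fun k hk => hsm k q hqQ (hab (hM k hk) hq).2.2) h1
    (fun k hk => (hab (hM k hk) hq).1) hm
  refine this.mono (le_of_eq ?_)
  ring

lemma tendsto_geometric_const {C r : ℝ} (h0 : 0 ≤ r) (h1 : r < 1) :
    Tendsto (fun m : ℕ => C * r ^ m) atTop (𝓝 0) := by
  simpa using (tendsto_pow_atTop_nhds_zero_of_lt_one h0 h1).const_mul C

lemma tendsto_half_rpow {C θ : ℝ} (hθ : 0 < θ) :
    Tendsto (fun m : ℕ => C * ((1 / 2 : ℝ) ^ m) ^ θ) atTop (𝓝 0) := by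
  have : ∀ m : ℕ, C * ((1 / 2 : ℝ) ^ m) ^ θ = C * ((1 / 2 : ℝ) ^ θ) ^ m := fun m => by
    rw [← Real.rpow_natCast, ← Real.rpow_natCast, ← Real.rpow_mul (by norm_num),
      ← Real.rpow_mul (by norm_num), mul_comm (m : ℝ)]
  simp only [this]
  exact tendsto_geometric_const (by positivity)
    (Real.rpow_lt_one (by norm_num) (by norm_num) hθ)

lemma EllipticFamily.exists_supBd_lift (hE : EllipticFamily p Q L A D)
    {q : EuclideanSpace ℝ (Fin n)} (hq : q ∈ Q) : ∃ K : ℝ, 0 ≤ K ∧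
      ∀ (χ : F → ℝ → ℝ) (δ : ℝ), SpaceSmooth p T χ → (∀ m, SupBd T () (liftOp (D m) χ) δ) →
        SupBd T () (liftOp (L q) χ) (K * δ) := by
  have hA : ∀ m, ∃ C, SupBd T () (A m q) C := fun m => by
    obtain ⟨C, hC⟩ := (hE.coeff T 0 m).locBd () q hq
    exact ⟨C, hC.self_of_nhds⟩
  choose C hC using hA
  refine ⟨∑ m, |C m|, Finset.sum_nonneg fun _ _ => abs_nonneg _, fun χ δ hχ hδ t ht x => ?_⟩
  have : liftOp (L q) χ x t = ∑ m, A m q x t * liftOp (D m) χ x t := by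
    simp only [liftOp, hE.rep q hq _ (hχ t ht) x t]
  rw [this, Finset.sum_mul]
  refine (Finset.abs_sum_le_sum_abs _ _).trans (Finset.sum_le_sum fun m _ => ?_)
  rw [abs_mul]
  exact mul_le_mul ((hC m t ht x).trans (le_abs_self _)) (hδ m t ht x) (abs_nonneg _)
    (abs_nonneg _)

/-- All terms of the equations for the quotients converge uniformly in time, so the limit solves the
linearized equation. It is again a family of solutions in the sense of `Sol`, which is what lets the
argument be iterated. -/
lemma Sol.of_limit_dyadicQuot (hE : EllipticFamily p Q L A D) (hQ : IsOpen Q)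
    {v R a : EuclideanSpace ℝ (Fin n) → F → ℝ → ℝ} (hv : Sol p Q T L v R)
    (hvb : LocBd (SupBd T) Q v) (ha : LocBd (SupBd T) Q a)
    {N : Fin n → EuclideanSpace ℝ (Fin n) → F → ℝ → ℝ}
    (hN : RemBd (SupBd T) Q 1 (linErr L v R a N)) (i : Fin n)
    {w : EuclideanSpace ℝ (Fin n) → F → ℝ → ℝ} (hw : ∀ q ∈ Q, SpaceSmooth p T (w q))
    (hlim : ∀ q₀ ∈ Q, ∀ s : Option (ChartCompact p F × ℕ), ∃ C r : ℝ, 0 ≤ r ∧ r < 1 ∧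
      ∀ᶠ y in atTop ×ˢ 𝓝 q₀, JetBd p T s (w y.2 - dyadicQuot v i y.1 y.2) (C * r ^ y.1)) :
    Sol p Q T L w (fun q => a q * w q + N i q) ∧ LocBd (SupBd T) Q w := by
  have hB := isBound_jetBd (p := p) (F := F) (T := T)
  have hsmall : ∀ q ∈ Q, ∀ s : Option (ChartCompact p F × ℕ), ∀ ε > 0,
      ∀ᶠ m in atTop, JetBd p T s (w q - dyadicQuot v i m q) ε := by
    intro q hq s ε hε
    obtain ⟨C, r, h0, h1, hC⟩ := hlim q hq s
    filter_upwards [eventually_of_prod_nhds hC,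
      (tendsto_geometric_const (C := C) h0 h1).eventually_le_const hε] with m h2 h3
    exact h2.mono h3
  have hbdd : ∀ s : Option (ChartCompact p F × ℕ),
      (∀ q₀ ∈ Q, ∃ C, ∀ᶠ q in 𝓝 q₀, JetBd p T s (v q) C) →
      ∀ q₀ ∈ Q, ∃ C, ∀ᶠ q in 𝓝 q₀, JetBd p T s (w q) C := by
    intro s hs q₀ hq₀
    obtain ⟨C, hC⟩ := hs q₀ hq₀
    obtain ⟨C', r, h0, h1, hC'⟩ := hlim q₀ hq₀ s
    -- One index m is fixed that serves all q near q₀: w_q is then within a constant of a single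
    -- difference quotient, and this quotient inherits the bound on v.
    have h2 := (hC'.and (((tendsto_dyadicPt i q₀).eventually (eventually_fst_diag hC)).and
      ((tendsto_dyadicPt i q₀).eventually (eventually_snd_diag hC)))).curry
    obtain ⟨m, hm⟩ := h2.exists
    refine ⟨C' * r ^ m + |(2 : ℝ) ^ m| * (C + |(-1 : ℝ)| * C), ?_⟩
    filter_upwards [hm] with q ⟨b1, b2, b3⟩
    have := hB.add b1 (hB.smul (2 ^ m) (hB.add b3 (hB.smul (-1) b2)))
    convert this using 1
    simp only [dyadicQuot]
    module
  have hloc : LocBd (SupBd T) Q w := by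
    intro _ q₀ hq₀
    obtain ⟨C, hC⟩ := hbdd none (fun q₀ hq₀ => by
      obtain ⟨C, hC⟩ := hvb () q₀ hq₀
      exact ⟨C, by filter_upwards [hC, hQ.mem_nhds hq₀] with q h1 h2 using ⟨hv.smooth q h2, h1⟩⟩)
      q₀ hq₀
    exact ⟨C, hC.mono fun q h => h.2⟩
  refine ⟨⟨fun q hq => ?_, hw, fun q hq x t ht => ?_, fun κ j hj => hbdd _ (hv.bdd κ j hj)⟩, hloc⟩
  · have hunif : TendstoUniformlyOn (fun m (y : F × ℝ) => dyadicQuot v i m q y.1 y.2)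
        (fun y => w q y.1 y.2) atTop (univ ×ˢ Icc 0 T) := by
      rw [Metric.tendstoUniformlyOn_iff]
      intro ε hε
      filter_upwards [hsmall q hq none (ε / 2) (by positivity)] with m hm y hy
      rw [Real.dist_eq]
      have := hm.2 y.2 hy.2 y.1
      simp only [Pi.sub_apply] at this
      linarith
    refine hunif.continuousOn (Eventually.frequently ?_)
    filter_upwards [eventually_of_prod_nhds (eventually_dyadicPt_mem hQ i hq)] with m hm
    exact continuousOn_const.mul ((hv.cont _ hm.2).sub (hv.cont q hq))
  · have hev := eventually_of_prod_nhds (eventually_dyadicPt_mem hQ i hq)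
    refine hasDerivWithinAt_of_tendstoUniformlyOn (convex_Icc 0 T)
      (φ := fun m => dyadicQuot v i m q x)
      (ψ := fun m t => liftOp (L q) (dyadicQuot v i m q) x t +
        (a q x t * dyadicQuot v i m q x t + N i q x t +
          2 ^ m * linErr L v R a N q (dyadicPt i m q) x t))
      (ψ' := fun t => liftOp (L q) (w q) x t + (a q * w q + N i q) x t) ?_ ?_ ?_ ht
    · filter_upwards [hev] with m hm t ht
      exact dyadicQuot_hasDerivWithinAt hE hv a N i m hm.1 hm.2 x ht
    · rw [Metric.tendstoUniformlyOn_iff]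
      intro ε hε
      obtain ⟨K, hK, hKb⟩ := hE.exists_supBd_lift (T := T) hq
      obtain ⟨K', hK'⟩ := ha () q hq
      have hK'q := hK'.self_of_nhds
      obtain ⟨C, θ, hθ, hC⟩ := hN () q hq
      -- With this δ the errors in L_q and in the term a w together stay below ε/4; a further ε/4 is
      -- left for the linearization error.
      set δ := ε / (4 * (K + |K'| + 1)) with hδ
      have hden : 0 < 4 * (K + |K'| + 1) := by positivity
      have hδ0 : 0 < δ := by positivity
      have hδε : δ * (4 * (K + |K'| + 1)) = ε := by rw [hδ]; field_simp
      have hD : ∀ k, ∀ᶠ m in atTop, SupBd T () (liftOp (D k) (w q - dyadicQuot v i m q)) δ := by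
        intro k
        obtain ⟨I, -, hI⟩ := (hE.op k).bound
        have : ∀ᶠ m in atTop, ∀ s ∈ I, JetBd p T (some s) (w q - dyadicQuot v i m q) δ :=
          (Filter.eventually_all_finset I).2 fun s _ => hsmall q hq (some s) δ hδ0
        filter_upwards [this, hsmall q hq none δ hδ0] with m h1 h2
        exact hI T _ _ h2.1 h1
      filter_upwards [Filter.eventually_all.2 hD, hsmall q hq none δ hδ0, hev,
        eventually_of_prod_nhds ((tendsto_dyadicPt i q).eventually hC),
        (tendsto_half_rpow (C := C) hθ).eventually_lt_const (show 0 < ε / 4 by positivity)]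
        with m h1 h2 h3 h4 h5 t ht
      have sm : SpaceSmooth p T (dyadicQuot v i m q) :=
        ((hv.smooth _ h3.2).sub (hv.smooth q hq)).smul _
      have c1 := hKb _ δ ((hw q hq).sub sm) h1 t ht x
      rw [(hE.isLinearOp hq).lift_sub (hw q hq) sm ht] at c1
      have c2 := h2.2 t ht x
      have c3 := hK'q t ht x
      have c4 := h4 t ht x
      simp only [norm_dyadicPt_sub] at c4
      have c5 : |2 ^ m * linErr L v R a N q (dyadicPt i m q) x t| ≤ ε / 4 := by
        rw [abs_mul, abs_of_pos (by positivity : (0 : ℝ) < 2 ^ m)]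
        refine (mul_le_mul_of_nonneg_left c4 (by positivity)).trans ?_
        rw [two_pow_mul_half_rpow]
        exact h5.le
      have c6 : |a q x t * (w q x t - dyadicQuot v i m q x t)| ≤ |K'| * δ := by
        rw [abs_mul]
        exact mul_le_mul (c3.trans (le_abs_self _)) c2 (abs_nonneg _) (abs_nonneg _)
      rw [Real.dist_eq]
      simp only [Pi.add_apply, Pi.mul_apply]
      have e : liftOp (L q) (w q) x t + (a q x t * w q x t + N i q x t) -
          (liftOp (L q) (dyadicQuot v i m q) x t + (a q x t * dyadicQuot v i m q x t + N i q x t +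
            2 ^ m * linErr L v R a N q (dyadicPt i m q) x t)) =
          (liftOp (L q) (w q) x t - liftOp (L q) (dyadicQuot v i m q) x t) +
          a q x t * (w q x t - dyadicQuot v i m q x t) -
          2 ^ m * linErr L v R a N q (dyadicPt i m q) x t := by ring
      rw [e]
      refine (abs_sub _ _).trans_lt ?_
      have c7 := abs_add_le (liftOp (L q) (w q) x t - liftOp (L q) (dyadicQuot v i m q) x t)
        (a q x t * (w q x t - dyadicQuot v i m q x t))
      nlinarith
    · intro s hs
      rw [Metric.tendsto_atTop']
      intro ε hε
      obtain ⟨M, hM⟩ := eventually_atTop.1 (hsmall q hq none (ε / 2) (by positivity))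
      refine ⟨M, fun m hm => ?_⟩
      have := (hM m hm.le).2 s hs x
      rw [dist_comm, Real.dist_eq]
      simp only [Pi.sub_apply] at this
      linarith

/-- Differentiability in the parameter of a family of solutions. -/
theorem Sol.exists_deriv [CompactSpace F] (hE : EllipticFamily p Q L A D) (hQ : IsOpen Q)
    (hT : 0 ≤ T) {v R a : EuclideanSpace ℝ (Fin n) → F → ℝ → ℝ} (hv : Sol p Q T L v R)
    (hvH : RemBd (JetBd p T) Q 0 (fun q q' => v q' - v q))
    (hvb : LocBd (SupBd T) Q v) (ha : LocBd (SupBd T) Q a)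
    {ρ : Fin n → EuclideanSpace ℝ (Fin n) → F → ℝ → ℝ}
    (hR : RemBd (SupBd T) Q 1
      (fun q q' => R q' - R q - a q * (v q' - v q) - ∑ i, (q' i - q i) • ρ i q))
    {A' : ι → Fin n → EuclideanSpace ℝ (Fin n) → F → ℝ → ℝ}
    (hA' : ∀ m i, LocBd (SupBd T) Q (A' m i))
    (hA : ∀ m, RemBd (SupBd T) Q 1
      (fun q q' => A m q' - A m q - ∑ i, (q' i - q i) • A' m i q))
    {v₀' : Fin n → EuclideanSpace ℝ (Fin n) → F → ℝ → ℝ}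
    (h0 : RemBd (SupBd T) Q 1
      (fun q q' x _ => v q' x 0 - v q x 0 - ∑ i, (q' i - q i) * v₀' i q x 0)) :
    ∃ w : Fin n → EuclideanSpace ℝ (Fin n) → F → ℝ → ℝ,
      (∀ i, Sol p Q T L (w i)
        (fun q => a q * w i q + (ρ i q + ∑ m, A' m i q * liftOp (D m) (v q)))) ∧
      (∀ i, LocBd (SupBd T) Q (w i)) ∧ (∀ i, ∀ q ∈ Q, ∀ x, w i q x 0 = v₀' i q x 0) ∧
      RemBd (JetBd p T) Q 1 (fun q q' => v q' - v q - ∑ i, (q' i - q i) • w i q) := by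
  have hN := remBd_linErr hE hQ hv hvH hR hA' hA
  set N : Fin n → EuclideanSpace ℝ (Fin n) → F → ℝ → ℝ :=
    fun i q => ρ i q + ∑ m, A' m i q * liftOp (D m) (v q) with hNdef
  have hlim := fun i => exists_limit_dyadicQuot hQ hv.smooth i fun q₀ hq₀ s =>
    dyadicQuot_cauchy hE hQ hT hv ha hN h0 i hq₀ s
  choose w hw hwt hwl using hlim
  have hsol := fun i => Sol.of_limit_dyadicQuot hE hQ hv hvb ha hN i (hw i) (hwl i)
  have hw0 : ∀ i, ∀ q ∈ Q, ∀ x, w i q x 0 = v₀' i q x 0 := by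
    intro i q hq x
    have h1 := (hwt i q hq).pointwise (t := 0) ⟨le_rfl, hT⟩ x
    refine tendsto_nhds_unique h1 ?_
    obtain ⟨C, θ, hθ, hC⟩ := h0 () q hq
    rw [tendsto_iff_dist_tendsto_zero]
    refine squeeze_zero' (Eventually.of_forall fun _ => dist_nonneg) ?_
      (tendsto_half_rpow (C := C) hθ)
    filter_upwards [eventually_of_prod_nhds ((tendsto_dyadicPt i q).eventually hC)] with m hm
    have h2 := hm 0 ⟨le_rfl, hT⟩ x
    beta_reduce at h2
    rw [sum_dyadicPt_sub (c := fun i => v₀' i q x 0), norm_dyadicPt_sub] at h2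
    rw [Real.dist_eq, ← two_pow_mul_half_rpow]
    have e1 : (2 : ℝ) ^ m * (1 / 2 : ℝ) ^ m = 1 := by rw [← mul_pow]; norm_num
    have e : dyadicQuot v i m q x 0 - v₀' i q x 0 =
        2 ^ m * (v (dyadicPt i m q) x 0 - v q x 0 - (1 / 2 : ℝ) ^ m * v₀' i q x 0) := by
      simp only [dyadicQuot, Pi.smul_apply, Pi.sub_apply, smul_eq_mul]
      linear_combination (v₀' i q x 0) * e1
    rw [e, abs_mul, abs_of_pos (by positivity : (0 : ℝ) < 2 ^ m)]
    exact mul_le_mul_of_nonneg_left h2 (by positivity)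
  refine ⟨w, fun i => (hsol i).1, fun i => (hsol i).2, hw0, ?_⟩
  have hB := isBound_jetBd (p := p) (F := F) (T := T)
  -- The remainder v_q' - v_q - ∑ (q'_i - q_i) w_i solves ∂ₜz = L_q z + a_q z + `linErr`, with
  -- initial values of order above one. Its sup norm is thus of order above one, and since its
  -- derivatives are locally bounded, interpolation applies.
  refine remBd_jetBd_of_supBd zero_le_one (fun q => by simp) (fun q₀ hq₀ => ?_)
    (fun κ j hj q₀ hq₀ => ?_)
  · obtain ⟨K, hK⟩ := ha () q₀ hq₀
    obtain ⟨C₁, θ₁, hθ₁, h1⟩ := hN () q₀ hq₀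
    obtain ⟨C₂, θ₂, hθ₂, h2⟩ := h0 () q₀ hq₀
    set θ := min θ₁ θ₂ with hθ
    have hθ0 : 0 < θ := lt_min hθ₁ hθ₂
    refine ⟨Real.exp ((|K| + 1) * T) * (|C₁| + |C₂|), θ, hθ0, ?_⟩
    filter_upwards [eventually_fst_diag hK, h1, h2, eventually_norm_sub_le_one q₀,
      eventually_fst_diag (hQ.mem_nhds hq₀), eventually_snd_diag (hQ.mem_nhds hq₀)]
      with ⟨q, q'⟩ hKq b1 b2 hd hq hq'
    simp only at hKq b1 b2 hd hq hq' ⊢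
    set d := ‖q' - q‖
    have hd0 : 0 ≤ d := norm_nonneg _
    have c1 : C₁ * d ^ (1 + θ₁) ≤ |C₁| * d ^ (1 + θ) :=
      mul_rpow_le_mul_rpow hd0 hd (by positivity) (by linarith [min_le_left θ₁ θ₂])
    have c2 : C₂ * d ^ (1 + θ₂) ≤ |C₂| * d ^ (1 + θ) :=
      mul_rpow_le_mul_rpow hd0 hd (by positivity) (by linarith [min_le_right θ₁ θ₂])
    have p1 : 0 ≤ |C₁| * d ^ (1 + θ) := by positivity
    have p2 : 0 ≤ |C₂| * d ^ (1 + θ) := by positivity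
    have smw : SpaceSmooth p T (∑ i, (q' i - q i) • w i q) :=
      SpaceSmooth.sum _ fun i _ => (hw i q hq).smul _
    have smv := (hv.smooth q' hq').sub (hv.smooth q hq)
    have hsm := smv.sub smw
    refine ⟨hsm, ?_⟩
    rw [mul_assoc]
    refine hE.supBd hq (z := v q' - v q - ∑ i, (q' i - q i) • w i q)
      (r := fun x t => a q x t * (v q' - v q - ∑ i, (q' i - q i) • w i q) x t +
        linErr L v R a N q q' x t) ?_ hsm (fun x t ht => ?_) (abs_nonneg K) (by positivity)
        (fun t ht x => ?_) (fun x => ?_)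
    · refine ((hv.cont q' hq').sub (hv.cont q hq)).sub ?_
      simp only [Finset.sum_apply, Pi.smul_apply, smul_eq_mul]
      exact continuousOn_finsetSum _ fun i _ => continuousOn_const.mul ((hsol i).1.cont q hq)
    · have hs : HasDerivWithinAt ((∑ i, (q' i - q i) • w i q) x)
          (∑ i, (q' i - q i) * (liftOp (L q) (w i q) x t + (a q x t * w i q x t + N i q x t)))
          (Icc 0 T) t := by
        have := HasDerivWithinAt.fun_sum (u := Finset.univ) (A := fun i t => (q' i - q i) * w i q x t)
          (fun i _ => ((hsol i).1.eq q hq x t ht).const_mul (q' i - q i))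
        have e : (∑ i, (q' i - q i) • w i q) x = fun s => ∑ i, (q' i - q i) * w i q x s := by
          ext s
          simp
        rw [e]
        exact this
      refine (((hv.eq q' hq' x t ht).sub (hv.eq q hq x t ht)).sub hs).congr_deriv ?_
      rw [(hE.isLinearOp hq).lift_sub smv smw ht,
        (hE.isLinearOp hq).lift_sum _ _ (fun i => hw i q hq) ht, linErr]
      simp only [Pi.sub_apply, Finset.sum_apply, Pi.smul_apply, smul_eq_mul, mul_add, mul_sub,
        Finset.sum_add_distrib, Finset.mul_sum]
      have e1 : ∑ i, (q' i - q i) * (a q x t * w i q x t) =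
          ∑ i, a q x t * ((q' i - q i) * w i q x t) :=
        Finset.sum_congr rfl fun i _ => by ring
      rw [e1]
      ring
    · refine (abs_add_le _ _).trans (add_le_add ?_ ?_)
      · rw [abs_mul]
        exact mul_le_mul_of_nonneg_right ((hKq t ht x).trans (le_abs_self _)) (abs_nonneg _)
      · have := b1 t ht x
        nlinarith
    · have c3 := b2 0 ⟨le_rfl, hT⟩ x
      simp only [Pi.sub_apply, Finset.sum_apply, Pi.smul_apply, smul_eq_mul, hw0 _ q hq x]
      nlinarith
  · obtain ⟨C, hC⟩ := hv.bdd κ j hj q₀ hq₀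
    have hwb := fun i => (hsol i).1.bdd κ j hj q₀ hq₀
    choose C' hC' using hwb
    refine ⟨C + |(-1 : ℝ)| * C + |(-1 : ℝ)| * ∑ i, |C' i|, ?_⟩
    filter_upwards [eventually_fst_diag hC, eventually_snd_diag hC,
      eventually_fst_diag (Filter.eventually_all.2 hC'), eventually_norm_sub_le_one q₀]
      with ⟨q, q'⟩ b1 b2 b3 hd
    have hsum : ∀ I : Finset (Fin n), JetBd p T (some (κ, j)) (∑ i ∈ I, (q' i - q i) • w i q)
        (∑ i ∈ I, |C' i|) := by
      intro I
      classical
      induction I using Finset.induction_on with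
      | empty => simpa using hB.zero
      | insert i I hi ih =>
        rw [Finset.sum_insert hi, Finset.sum_insert hi]
        refine hB.add (hB.mono (hB.smul _ (b3 i)) ?_) ih
        calc |q' i - q i| * C' i ≤ |q' i - q i| * |C' i| :=
              mul_le_mul_of_nonneg_left (le_abs_self _) (abs_nonneg _)
          _ ≤ 1 * |C' i| := mul_le_mul_of_nonneg_right
              ((abs_sub_apply_le q q' i).trans hd) (abs_nonneg _)
          _ = _ := one_mul _
    have := hB.add (hB.add b2 (hB.smul (-1) b1)) (hB.smul (-1) (hsum Finset.univ))
    convert this using 1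
    module

end Differentiability

/-! ### Higher derivatives in the parameter: linear equations -/

section HigherOrder

variable {p n : ℕ} {F : Type*} [TopologicalSpace F] [ChartedSpace (EuclideanSpace ℝ (Fin p)) F]
  {T : ℝ} {ι : Type*} [Fintype ι] {Q : Set (EuclideanSpace ℝ (Fin n))}
  {L : EuclideanSpace ℝ (Fin n) → (F → ℝ) → F → ℝ}
  {A : ι → EuclideanSpace ℝ (Fin n) → F → ℝ → ℝ} {D : ι → (F → ℝ) → F → ℝ}

lemma RemBd.at_zero (hT : 0 ≤ T) {e : ℝ}
    {ρ : EuclideanSpace ℝ (Fin n) → EuclideanSpace ℝ (Fin n) → F → ℝ → ℝ}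
    (h : RemBd (SupBd T) Q e ρ) : RemBd (SupBd T) Q e (fun q q' x _ => ρ q q' x 0) := by
  intro s q₀ hq
  obtain ⟨C, θ, hθ, hC⟩ := h s q₀ hq
  exact ⟨C, θ, hθ, hC.mono fun z hz t _ x => hz 0 ⟨le_rfl, hT⟩ x⟩

lemma RemBd.supBd {e : ℝ}
    {ρ : EuclideanSpace ℝ (Fin n) → EuclideanSpace ℝ (Fin n) → F → ℝ → ℝ}
    (h : RemBd (JetBd p T) Q e ρ) : RemBd (SupBd T) Q e ρ := by
  intro s q₀ hq
  obtain ⟨C, θ, hθ, hC⟩ := h none q₀ hq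
  exact ⟨C, θ, hθ, hC.mono fun z hz => hz.2⟩

lemma LocBd.supBd {r : EuclideanSpace ℝ (Fin n) → F → ℝ → ℝ}
    (h : LocBd (JetBd p T) Q r) : LocBd (SupBd T) Q r := by
  intro s q₀ hq
  obtain ⟨C, hC⟩ := h none q₀ hq
  exact ⟨C, hC.mono fun z hz => hz.2⟩

lemma CkH.supBd {k : ℕ} {r : EuclideanSpace ℝ (Fin n) → F → ℝ → ℝ}
    (h : CkH (JetBd p T) Q k r) : CkH (SupBd T) Q k r := by
  induction k generalizing r with
  | zero => exact ⟨h.1.supBd, h.2.supBd⟩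
  | succ k ih =>
    obtain ⟨h1, r', hr', hrem⟩ := h
    exact ⟨h1.supBd, r', fun i => ih (hr' i), hrem.supBd⟩

lemma Sol.locBd {v R : EuclideanSpace ℝ (Fin n) → F → ℝ → ℝ} (hQ : IsOpen Q)
    (hv : Sol p Q T L v R) (hvb : LocBd (SupBd T) Q v) : LocBd (JetBd p T) Q v := by
  have h0 : ∀ q₀ ∈ Q, ∃ C, ∀ᶠ q in 𝓝 q₀, JetBd p T none (v q) C := fun q₀ hq₀ => by
    obtain ⟨C, hC⟩ := hvb () q₀ hq₀
    exact ⟨C, by filter_upwards [hC, hQ.mem_nhds hq₀] with q h1 h2 using ⟨hv.smooth q h2, h1⟩⟩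
  intro s q₀ hq₀
  match s with
  | none => exact h0 q₀ hq₀
  | some (κ, 0) =>
    obtain ⟨C, hC⟩ := h0 q₀ hq₀
    exact ⟨C, hC.mono fun q hq => hq.some_zero⟩
  | some (κ, j + 1) => exact hv.bdd κ (j + 1) (by omega) q₀ hq₀

variable [IsManifold (𝓡 p) ∞ F]

/-- Smooth dependence on the parameter for families of solutions of linear equations. -/
theorem Sol.ckH_of_linear [CompactSpace F] (hE : EllipticFamily p Q L A D) (hQ : IsOpen Q)
    (hT : 0 ≤ T) (k : ℕ) {v a b v₀ : EuclideanSpace ℝ (Fin n) → F → ℝ → ℝ}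
    (hv : Sol p Q T L v (fun q => a q * v q + b q)) (hvb : LocBd (SupBd T) Q v)
    (ha : CkH (SupBd T) Q k a) (hb : CkH (SupBd T) Q k b) (hv₀ : CkH (SupBd T) Q k v₀)
    (h0 : ∀ q ∈ Q, ∀ x, v q x 0 = v₀ q x 0) : CkH (JetBd p T) Q k v := by
  have hB := isBound_supBd (F := F) (T := T)
  have hholder : ∀ {k : ℕ} {v a b v₀ : EuclideanSpace ℝ (Fin n) → F → ℝ → ℝ},
      Sol p Q T L v (fun q => a q * v q + b q) → LocBd (SupBd T) Q v →
      CkH (SupBd T) Q k a → CkH (SupBd T) Q k b → CkH (SupBd T) Q k v₀ →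
      (∀ q ∈ Q, ∀ x, v q x 0 = v₀ q x 0) → RemBd (JetBd p T) Q 0 (fun q q' => v q' - v q) := by
    intro k v a b v₀ hv hvb ha hb hv₀ h0
    refine hv.holder hE hQ hT le_rfl zero_lt_one (fun q₀ hq₀ => ?_) ?_
    · obtain ⟨K, hK⟩ := ha.locBd () q₀ hq₀
      obtain ⟨C, θ, hθ, hC⟩ :=
        ((RemBd.locBd_mul hvb.fst (ha.holder hB)).add hB le_rfl (hb.holder hB)) () q₀ hq₀
      refine ⟨|K|, C, θ, abs_nonneg _, hθ, ?_⟩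
      filter_upwards [eventually_snd_diag hK, hC] with ⟨q, q'⟩ h1 h2 t ht x
      have c1 := h1 t ht x
      have c2 := h2 t ht x
      simp only [Pi.add_apply, Pi.mul_apply, Pi.sub_apply] at c1 c2 ⊢
      have e : a q' x t * v q' x t + b q' x t - (a q x t * v q x t + b q x t) =
          a q' x t * (v q' x t - v q x t) +
            (v q x t * (a q' x t - a q x t) + (b q' x t - b q x t)) := by ring
      rw [e]
      refine (abs_add_le _ _).trans (add_le_add ?_ c2)
      rw [abs_mul]
      exact mul_le_mul_of_nonneg_right (c1.trans (le_abs_self _)) (abs_nonneg _)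
    · exact ((hv₀.holder hB).at_zero hT).congr_of_eqOn hQ fun q hq q' hq' t _ x => by
        simp [h0 q hq, h0 q' hq']
  induction k generalizing v a b v₀ with
  | zero => exact ⟨hv.locBd hQ hvb, hholder hv hvb ha hb hv₀ h0⟩
  | succ k ih =>
    have hvH := hholder hv hvb ha hb hv₀ h0
    have hvk := ih hv hvb (ha.of_succ hB) (hb.of_succ hB) (hv₀.of_succ hB) h0
    have hak := ha.of_succ hB
    obtain ⟨ha1, a', ha', harem⟩ := ha
    obtain ⟨hb1, b', hb', hbrem⟩ := hb
    obtain ⟨hv1, v', hv', hvrem⟩ := hv₀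
    have hcoeff := fun m => hE.coeff T (k + 1) m
    choose hA1 A' hA' hArem using hcoeff
    obtain ⟨w, hwS, hwb, hw0, hwrem⟩ := hv.exists_deriv hE hQ hT hvH hvb ha1
      (ρ := fun i q => a' i q * v q + b' i q) (A' := A') (v₀' := v')
      (by
        -- The remainder of a v + b is v_q' times the remainder of a, plus the remainder of b, plus
        -- the cross terms (q'_i - q_i) a'_i (v_q' - v_q).
        have hcross := RemBd.sum hB zero_le_one Finset.univ fun i _ =>
          ((RemBd.locBd_mul ((ha' i).locBd.fst) hvH.supBd).smul_disp hB le_rfl i).mono hB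
            zero_le_one (by norm_num : (1 : ℝ) ≤ 1 + 0)
        convert ((RemBd.locBd_mul hvb.snd harem).add hB zero_le_one hbrem).add hB
          zero_le_one hcross using 3
        simp only [smul_add, Finset.sum_add_distrib, mul_sub, smul_sub, Finset.sum_sub_distrib,
          Finset.mul_sum, mul_smul_comm]
        have e1 : ∀ q q' : EuclideanSpace ℝ (Fin n),
          ∑ i, (q' i - q i) • (v q' * a' i q) = ∑ i, (q' i - q i) • (a' i q * v q') := fun q q' =>
            Finset.sum_congr rfl fun i _ => by rw [mul_comm]
        rw [e1]
        ring)
      (fun m i => (hA' m i).locBd) hArem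
      (((hvrem).at_zero hT).congr_of_eqOn hQ fun q hq q' hq' t _ x => by
        simp [h0 q hq, h0 q' hq'])
    refine ⟨hv.locBd hQ hvb, w, fun i => ?_, hwrem⟩
    -- The derivative w_i solves a linear equation with the same a. Its inhomogeneity involves v and
    -- its spatial derivatives, and these are of class k by the induction hypothesis for v.
    refine ih (hwS i) (hwb i) hak ?_ (hv' i) (hw0 i)
    exact (((ha' i).mul hvk.supBd).add hB (hb' i)).add hB
      (CkH.sum hB _ fun m _ => (hA' m i).mul (hvk.lift hQ (hE.op m)))

end HigherOrder

/-! ### Substituting a family into a smooth nonlinearity -/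

section Substitution

variable {n : ℕ} {F : Type*} {J : Set ℝ} {Q : Set (EuclideanSpace ℝ (Fin n))} {T : ℝ}

/-- Functions of `(s, q)` with a parameter `x`, smooth on `J × Q`, with derivatives of order at
least `m` bounded uniformly in `x` and `s` and locally uniformly in `q`. -/
structure BddSmooth (J : Set ℝ) (Q : Set (EuclideanSpace ℝ (Fin n))) (m : ℕ)
    (g : F → ℝ × EuclideanSpace ℝ (Fin n) → ℝ) : Prop where
  smooth : ∀ x, ContDiffOn ℝ ∞ (g x) (J ×ˢ Q)
  bdd : ∀ k, m ≤ k → ∀ q₀ ∈ Q, ∃ C : ℝ, ∀ᶠ q in 𝓝 q₀, ∀ x, ∀ s ∈ J,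
    ‖iteratedFDerivWithin ℝ k (g x) (J ×ˢ Q) (s, q)‖ ≤ C

/-- The directional derivative of a function on `J × Q` with a parameter. -/
def dirDeriv (J : Set ℝ) (Q : Set (EuclideanSpace ℝ (Fin n)))
    (e : ℝ × EuclideanSpace ℝ (Fin n)) (g : F → ℝ × EuclideanSpace ℝ (Fin n) → ℝ) (x : F)
    (a : ℝ × EuclideanSpace ℝ (Fin n)) : ℝ :=
  fderivWithin ℝ (g x) (J ×ˢ Q) a e

/-- Substitution of a family of functions into a nonlinearity. -/
def subst (g : F → ℝ × EuclideanSpace ℝ (Fin n) → ℝ)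
    (v : EuclideanSpace ℝ (Fin n) → F → ℝ → ℝ) (q : EuclideanSpace ℝ (Fin n)) : F → ℝ → ℝ :=
  fun x t => g x (v q x t, q)

lemma BddSmooth.bddSmooth_dirDeriv (hQ : IsOpen Q) (hJQ : UniqueDiffOn ℝ (J ×ˢ Q)) {m : ℕ}
    {g : F → ℝ × EuclideanSpace ℝ (Fin n) → ℝ} (hg : BddSmooth J Q (m + 1) g)
    (e : ℝ × EuclideanSpace ℝ (Fin n)) : BddSmooth J Q m (dirDeriv J Q e g) where
  smooth x := ((hg.smooth x).fderivWithin hJQ (by simp)).clm_apply contDiffOn_const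
  bdd k hk q₀ hq₀ := by
    obtain ⟨C, hC⟩ := hg.bdd (k + 1) (by omega) q₀ hq₀
    refine ⟨‖e‖ * C, ?_⟩
    filter_upwards [hC, hQ.mem_nhds hq₀] with q hq hqQ x s hs
    have ha : (s, q) ∈ J ×ˢ Q := ⟨hs, hqQ⟩
    have h1 : ContDiffOn ℝ ∞ (fderivWithin ℝ (g x) (J ×ˢ Q)) (J ×ˢ Q) :=
      (hg.smooth x).fderivWithin hJQ (by simp)
    have h2 := norm_iteratedFDerivWithin_clm_apply_const (c := e) (h1 _ ha) hJQ ha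
      (n := k) (by exact_mod_cast le_top)
    refine h2.trans (mul_le_mul_of_nonneg_left ?_ (norm_nonneg _))
    rw [norm_iteratedFDerivWithin_fderivWithin hJQ ha]
    exact hq x s hs

lemma BddSmooth.of_succ {m : ℕ} {g : F → ℝ × EuclideanSpace ℝ (Fin n) → ℝ}
    (hg : BddSmooth J Q m g) : BddSmooth J Q (m + 1) g :=
  ⟨hg.smooth, fun k hk => hg.bdd k (by omega)⟩

/-- The mean value inequality of first and second order on the convex set J × ball. Derivatives are
taken within J × Q because J may contain its end points. -/
lemma BddSmooth.taylor (hJ : Convex ℝ J) (hQ : IsOpen Q) (hJQ : UniqueDiffOn ℝ (J ×ˢ Q))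
    {g : F → ℝ × EuclideanSpace ℝ (Fin n) → ℝ} (hg : BddSmooth J Q 1 g)
    {q₀ : EuclideanSpace ℝ (Fin n)} (hq₀ : q₀ ∈ Q) :
    ∃ C : ℝ, 0 ≤ C ∧ ∀ᶠ z in 𝓝 (q₀, q₀), ∀ x, ∀ s ∈ J, ∀ s' ∈ J,
      |g x (s', z.2) - g x (s, z.1)| ≤ C * (|s' - s| + ‖z.2 - z.1‖) ∧
      |g x (s', z.2) - g x (s, z.1) - fderivWithin ℝ (g x) (J ×ˢ Q) (s, z.1)
        (s' - s, z.2 - z.1)| ≤ C * (|s' - s| + ‖z.2 - z.1‖) ^ 2 := by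
  obtain ⟨C₁, hC₁⟩ := hg.bdd 1 le_rfl q₀ hq₀
  obtain ⟨C₂, hC₂⟩ := hg.bdd 2 (by norm_num) q₀ hq₀
  obtain ⟨r, hr, hrQ'⟩ := Metric.eventually_nhds_iff_ball.1
    ((hC₁.and hC₂).and (hQ.mem_nhds hq₀))
  have hrQ : Metric.ball q₀ r ⊆ Q := fun q hq => (hrQ' q hq).2
  have hball := Metric.ball_mem_nhds q₀ hr
  refine ⟨|C₁| + |C₂|, by positivity, ?_⟩
  filter_upwards [eventually_fst_diag hball, eventually_snd_diag hball] with ⟨q, q'⟩ hq hq' x s hs s' hs'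
  simp only at hq hq' ⊢
  set S := J ×ˢ Metric.ball q₀ r with hS
  have hSc : Convex ℝ S := hJ.prod (convex_ball q₀ r)
  have hSsub : S ⊆ J ×ˢ Q := prod_mono_right hrQ
  have hd : ∀ a ∈ S, HasFDerivWithinAt (g x) (fderivWithin ℝ (g x) (J ×ˢ Q) a) S a := fun a ha =>
    (((hg.smooth x).differentiableOn (by simp)) a (hSsub ha)).hasFDerivWithinAt.mono hSsub
  have hd2 : ∀ a ∈ S, HasFDerivWithinAt (fderivWithin ℝ (g x) (J ×ˢ Q))
      (fderivWithin ℝ (fderivWithin ℝ (g x) (J ×ˢ Q)) (J ×ˢ Q) a) S a := fun a ha =>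
    ((((hg.smooth x).fderivWithin hJQ (m := 1) (by norm_cast)).differentiableOn one_ne_zero) a
      (hSsub ha)).hasFDerivWithinAt.mono hSsub
  have b1 : ∀ a ∈ S, ‖fderivWithin ℝ (g x) (J ×ˢ Q) a‖ ≤ |C₁| := fun a ha => by
    rw [← norm_iteratedFDerivWithin_one (g x) (hJQ a (hSsub ha))]
    exact ((hrQ' a.2 ha.2).1.1 x a.1 ha.1).trans (le_abs_self _)
  have b2 : ∀ a ∈ S, ‖fderivWithin ℝ (fderivWithin ℝ (g x) (J ×ˢ Q)) (J ×ˢ Q) a‖ ≤ |C₂| :=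
    fun a ha => by
      rw [← norm_iteratedFDerivWithin_one _ (hJQ a (hSsub ha)),
        norm_iteratedFDerivWithin_fderivWithin hJQ (hSsub ha)]
      exact ((hrQ' a.2 ha.2).1.2 x a.1 ha.1).trans (le_abs_self _)
  have ha : ((s, q) : ℝ × EuclideanSpace ℝ (Fin n)) ∈ S := ⟨hs, hq⟩
  have ha' : ((s', q') : ℝ × EuclideanSpace ℝ (Fin n)) ∈ S := ⟨hs', hq'⟩
  have hnorm : ‖((s', q') : ℝ × EuclideanSpace ℝ (Fin n)) - (s, q)‖ ≤ |s' - s| + ‖q' - q‖ := by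
    rw [Prod.mk_sub_mk, Prod.norm_def]
    exact max_le (le_add_of_nonneg_right (norm_nonneg _)) (le_add_of_nonneg_left (abs_nonneg _))
  have hN0 : 0 ≤ |s' - s| + ‖q' - q‖ := by positivity
  constructor
  · have h := hSc.norm_image_sub_le_of_norm_hasFDerivWithin_le hd b1 ha ha'
    refine h.trans ?_
    exact mul_le_mul (le_add_of_nonneg_right (abs_nonneg _)) hnorm (norm_nonneg _) (by positivity)
  -- Intersecting with the closed ball that just reaches the second point keeps the set convex and
  -- bounds the change of the first derivative by |C₂| times the displacement.
  · set S' := S ∩ Metric.closedBall (s, q) ‖((s', q') : ℝ × EuclideanSpace ℝ (Fin n)) - (s, q)‖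
      with hS'
    have h := (hSc.inter (convex_closedBall _ _)).norm_image_sub_le_of_norm_hasFDerivWithin_le'
      (f := g x) (s := S') (φ := fderivWithin ℝ (g x) (J ×ˢ Q) (s, q))
      (C := |C₂| * ‖((s', q') : ℝ × EuclideanSpace ℝ (Fin n)) - (s, q)‖)
      (fun a ha => (hd a ha.1).mono inter_subset_left)
      (fun a haS => by
        refine (hSc.norm_image_sub_le_of_norm_hasFDerivWithin_le hd2 b2 ha haS.1).trans ?_
        refine mul_le_mul_of_nonneg_left ?_ (abs_nonneg _)
        simpa [dist_eq_norm] using haS.2)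
      ⟨ha, Metric.mem_closedBall_self (norm_nonneg _)⟩
      ⟨ha', by rw [Metric.mem_closedBall, dist_eq_norm]⟩
    rw [Real.norm_eq_abs, Prod.mk_sub_mk] at h
    refine h.trans ?_
    rw [Prod.mk_sub_mk] at hnorm
    rw [pow_two, ← mul_assoc]
    refine mul_le_mul (mul_le_mul (le_add_of_nonneg_left (abs_nonneg _)) hnorm (norm_nonneg _)
      (by positivity)) hnorm (norm_nonneg _) (by positivity)

lemma fderivWithin_prod_apply (g : F → ℝ × EuclideanSpace ℝ (Fin n) → ℝ) (x : F)
    (a : ℝ × EuclideanSpace ℝ (Fin n)) (σ : ℝ) (δ : EuclideanSpace ℝ (Fin n)) :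
    fderivWithin ℝ (g x) (J ×ˢ Q) a (σ, δ) = dirDeriv J Q (1, 0) g x a * σ +
      ∑ i, δ i * dirDeriv J Q (0, EuclideanSpace.single i 1) g x a := by
  have e : ((σ, δ) : ℝ × EuclideanSpace ℝ (Fin n)) =
      σ • ((1 : ℝ), (0 : EuclideanSpace ℝ (Fin n))) +
        ∑ i, δ i • ((0 : ℝ), EuclideanSpace.single i (1 : ℝ)) := by
    refine Prod.ext ?_ ?_
    · simp [Prod.fst_sum]
    · simp only [Prod.snd_add, Prod.smul_snd, smul_zero, zero_add, Prod.snd_sum]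
      ext j
      simp [Pi.single_apply]
  rw [e, map_add, map_smul, map_sum]
  simp only [map_smul, dirDeriv, smul_eq_mul]
  ring

/-- The Taylor remainder is quadratic in |v_q' - v_q| + |q' - q|, so a Hölder exponent above 1/2 for
v already makes it of order above one. Differentiability of v is not needed. -/
lemma BddSmooth.remBd_subst (hJ : Convex ℝ J) (hQ : IsOpen Q) (hJQ : UniqueDiffOn ℝ (J ×ˢ Q))
    {g : F → ℝ × EuclideanSpace ℝ (Fin n) → ℝ} (hg : BddSmooth J Q 1 g)
    {v : EuclideanSpace ℝ (Fin n) → F → ℝ → ℝ}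
    (hvJ : ∀ q ∈ Q, ∀ x, ∀ t ∈ Icc 0 T, v q x t ∈ J)
    (hv : RemBd (SupBd T) Q (1 / 2) (fun q q' => v q' - v q)) :
    RemBd (SupBd T) Q 1 (fun q q' => subst g v q' - subst g v q -
      subst (dirDeriv J Q (1, 0) g) v q * (v q' - v q) -
      ∑ i, (q' i - q i) • subst (dirDeriv J Q (0, EuclideanSpace.single i 1) g) v q) := by
  intro _ q₀ hq₀
  obtain ⟨C, hC0, hC⟩ := hg.taylor hJ hQ hJQ hq₀
  obtain ⟨C', θ, hθ, hC'⟩ := hv () q₀ hq₀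
  -- The cap 1/2 keeps 1/2 + η ≤ 1, so that |q' - q| is also bounded by the power 1/2 + η of itself.
  set η := min θ (1 / 2) with hη
  have hη0 : 0 < η := lt_min hθ (by norm_num)
  refine ⟨C * (|C'| + 1) ^ 2, 2 * η, by positivity, ?_⟩
  filter_upwards [hC, hC', eventually_norm_sub_le_one q₀, eventually_fst_diag (hQ.mem_nhds hq₀),
    eventually_snd_diag (hQ.mem_nhds hq₀)] with ⟨q, q'⟩ h1 h2 hd hq hq' t ht x
  have b1 := (h1 x _ (hvJ q hq x t ht) _ (hvJ q' hq' x t ht)).2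
  have b2 := h2 t ht x
  simp only [Pi.sub_apply] at b2 hd hq hq' b1
  set d := ‖q' - q‖
  have hd0 : 0 ≤ d := norm_nonneg _
  have c1 : C' * d ^ (1 / 2 + θ) ≤ |C'| * d ^ (1 / 2 + η) :=
    mul_rpow_le_mul_rpow hd0 hd (by positivity) (by linarith [min_le_left θ (1 / 2)])
  have c2 : d ≤ d ^ (1 / 2 + η) := by
    have := mul_rpow_le_mul_rpow (C := 1) (a := 1 / 2 + η) (b := 1) hd0 hd (by positivity)
      (by linarith [min_le_right θ (1 / 2)])
    simpa using this
  rw [fderivWithin_prod_apply] at b1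
  simp only [Pi.sub_apply, Pi.mul_apply, Finset.sum_apply, Pi.smul_apply, smul_eq_mul, subst]
  refine le_trans (le_of_eq ?_) (b1.trans ?_)
  · congr 1
    simp only [PiLp.sub_apply]
    ring
  · rw [mul_assoc]
    refine mul_le_mul_of_nonneg_left ?_ hC0
    have e : d ^ (1 + 2 * η) = (d ^ (1 / 2 + η)) ^ 2 := by
      rw [← Real.rpow_natCast, ← Real.rpow_mul hd0]
      congr 1
      push_cast
      ring
    rw [e, ← mul_pow]
    refine pow_le_pow_left₀ (by positivity) ?_ 2
    linarith

lemma BddSmooth.locBd_subst (hQ : IsOpen Q)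
    {g : F → ℝ × EuclideanSpace ℝ (Fin n) → ℝ} (hg : BddSmooth J Q 0 g)
    {v : EuclideanSpace ℝ (Fin n) → F → ℝ → ℝ}
    (hvJ : ∀ q ∈ Q, ∀ x, ∀ t ∈ Icc 0 T, v q x t ∈ J) : LocBd (SupBd T) Q (subst g v) := by
  intro _ q₀ hq₀
  obtain ⟨C, hC⟩ := hg.bdd 0 le_rfl q₀ hq₀
  refine ⟨C, ?_⟩
  filter_upwards [hC, hQ.mem_nhds hq₀] with q hCq hq t ht x
  have := hCq x (v q x t) (hvJ q hq x t ht)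
  rwa [norm_iteratedFDerivWithin_zero] at this

/-- The chain rule, by induction on k over all nonlinearities at once: the partial derivatives of
the composite involve substitutions of directional derivatives of g, which again satisfy the
hypotheses. -/
lemma BddSmooth.ckH_subst (hJ : Convex ℝ J) (hQ : IsOpen Q) (hJQ : UniqueDiffOn ℝ (J ×ˢ Q))
    {k : ℕ} {g : F → ℝ × EuclideanSpace ℝ (Fin n) → ℝ} (hg : BddSmooth J Q 0 g)
    {v : EuclideanSpace ℝ (Fin n) → F → ℝ → ℝ}
    (hvJ : ∀ q ∈ Q, ∀ x, ∀ t ∈ Icc 0 T, v q x t ∈ J) (hv : CkH (SupBd T) Q k v) :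
    CkH (SupBd T) Q k (subst g v) := by
  have hB := isBound_supBd (F := F) (T := T)
  induction k generalizing g with
  | zero =>
    refine ⟨hg.locBd_subst hQ hvJ, fun _ q₀ hq₀ => ?_⟩
    obtain ⟨C, hC0, hC⟩ := hg.of_succ.taylor hJ hQ hJQ hq₀
    obtain ⟨C', θ, hθ, hC'⟩ := hv.2 () q₀ hq₀
    set η := min θ 1 with hη
    have hη0 : 0 < η := lt_min hθ one_pos
    refine ⟨C * (|C'| + 1), η, hη0, ?_⟩
    filter_upwards [hC, hC', eventually_norm_sub_le_one q₀, eventually_fst_diag (hQ.mem_nhds hq₀),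
      eventually_snd_diag (hQ.mem_nhds hq₀)] with ⟨q, q'⟩ h1 h2 hd hq hq' t ht x
    have b1 := (h1 x _ (hvJ q hq x t ht) _ (hvJ q' hq' x t ht)).1
    have b2 := h2 t ht x
    simp only [Pi.sub_apply] at b2 hd hq hq' b1
    set d := ‖q' - q‖
    have hd0 : 0 ≤ d := norm_nonneg _
    rw [zero_add] at b2 ⊢
    have c1 : C' * d ^ θ ≤ |C'| * d ^ η :=
      mul_rpow_le_mul_rpow hd0 hd (by positivity) (min_le_left θ 1)
    have c2 : d ≤ d ^ η := by
      have := mul_rpow_le_mul_rpow (C := 1) (a := η) (b := 1) hd0 hd (by positivity)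
        (min_le_right θ 1)
      simpa using this
    refine b1.trans ?_
    rw [mul_assoc]
    exact mul_le_mul_of_nonneg_left (by linarith) hC0
  | succ k ih =>
    have hvk := hv.of_succ hB
    have hv2 := hv.holder_of_lt_one hB (e := 1 / 2) (by norm_num) (by norm_num)
    obtain ⟨hv1, v', hv', hvrem⟩ := hv
    refine ⟨hg.locBd_subst hQ hvJ, fun i q => subst (dirDeriv J Q (1, 0) g) v q * v' i q +
      subst (dirDeriv J Q (0, EuclideanSpace.single i 1) g) v q, fun i => ?_, ?_⟩
    · exact ((ih (hg.of_succ.bddSmooth_dirDeriv hQ hJQ _) hvk).mul (hv' i)).add hB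
        (ih (hg.of_succ.bddSmooth_dirDeriv hQ hJQ _) hvk)
    · convert (hg.of_succ.remBd_subst hJ hQ hJQ hvJ hv2).add hB zero_le_one
        (RemBd.locBd_mul ((hg.of_succ.bddSmooth_dirDeriv hQ hJQ (1, 0)).locBd_subst hQ hvJ).fst hvrem) using 3
      simp only [smul_add, Finset.sum_add_distrib, mul_sub, Finset.mul_sum, mul_smul_comm]
      ring

end Substitution

/-! ### Smooth dependence for semilinear equations -/

section Nonlinear

variable {p n : ℕ} {F : Type*} [TopologicalSpace F] [ChartedSpace (EuclideanSpace ℝ (Fin p)) F]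
  [IsManifold (𝓡 p) ∞ F] [CompactSpace F]
  {T : ℝ} {ι : Type*} [Fintype ι] {J : Set ℝ} {Q : Set (EuclideanSpace ℝ (Fin n))}
  {L : EuclideanSpace ℝ (Fin n) → (F → ℝ) → F → ℝ}
  {A : ι → EuclideanSpace ℝ (Fin n) → F → ℝ → ℝ} {D : ι → (F → ℝ) → F → ℝ}

/-- `Sol` bounds only derivatives. For the single parameter q₀ the solution is bounded by
compactness of F × [0, T], and Hölder continuity carries this bound to nearby parameters. -/
lemma Sol.locBd_of_holder {v R : EuclideanSpace ℝ (Fin n) → F → ℝ → ℝ} (hv : Sol p Q T L v R)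
    {e : ℝ} (he : 0 ≤ e) (h : RemBd (SupBd T) Q e (fun q q' => v q' - v q)) :
    LocBd (SupBd T) Q v := by
  intro _ q₀ hq₀
  obtain ⟨M, hM⟩ := (isCompact_univ.prod isCompact_Icc).exists_bound_of_continuousOn (hv.cont q₀ hq₀)
  obtain ⟨C, θ, hθ, hC⟩ := h () q₀ hq₀
  refine ⟨M + |C|, ?_⟩
  have ht : Tendsto (fun q : EuclideanSpace ℝ (Fin n) => (q₀, q)) (𝓝 q₀) (𝓝 (q₀, q₀)) :=
    (Continuous.prodMk_right q₀).tendsto q₀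
  filter_upwards [ht.eventually hC, ht.eventually (eventually_norm_sub_le_one q₀)]
    with q h1 hd t ht x
  have b1 := h1 t ht x
  have b2 := hM (x, t) ⟨mem_univ _, ht⟩
  simp only [Pi.sub_apply, Real.norm_eq_abs] at b1 b2 hd
  have b3 : C * ‖q - q₀‖ ^ (e + θ) ≤ |C| := by
    have := mul_rpow_le_mul_rpow (C := C) (a := 0) (b := e + θ) (norm_nonneg _) hd le_rfl
      (by positivity)
    simpa using this
  have : v q x t = v q₀ x t + (v q x t - v q₀ x t) := by ring
  rw [this]
  exact (abs_add_le _ _).trans (by linarith)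

/-- Smooth dependence on the parameter for families of solutions of semilinear equations. -/
theorem Sol.ckH_of_semilinear (hE : EllipticFamily p Q L A D) (hQ : IsOpen Q) (hT : 0 ≤ T)
    (hJ : Convex ℝ J) (hJQ : UniqueDiffOn ℝ (J ×ˢ Q))
    {f : F → ℝ × EuclideanSpace ℝ (Fin n) → ℝ} (hf : BddSmooth J Q 1 f)
    {v v₀ : EuclideanSpace ℝ (Fin n) → F → ℝ → ℝ} (hv : Sol p Q T L v (subst f v))
    (hvJ : ∀ q ∈ Q, ∀ x, ∀ t ∈ Icc 0 T, v q x t ∈ J) (hv₀ : ∀ k, CkH (SupBd T) Q k v₀)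
    (h0 : ∀ q ∈ Q, ∀ x, v q x 0 = v₀ q x 0) (k : ℕ) : CkH (JetBd p T) Q k v := by
  have hB := isBound_supBd (F := F) (T := T)
  -- The nonlinearity is Lipschitz in (s, q), so exponents up to one are available in sup norm.
  -- Exponent 1/2 (plus some θ) is what `BddSmooth.remBd_subst` needs.
  have hvH : RemBd (JetBd p T) Q (1 / 2) (fun q q' => v q' - v q) := by
    refine hv.holder hE hQ hT (by norm_num) (by norm_num) (fun q₀ hq₀ => ?_) ?_
    · obtain ⟨C, hC0, hC⟩ := hf.taylor hJ hQ hJQ hq₀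
      refine ⟨C, C, 1 / 2, hC0, by norm_num, ?_⟩
      filter_upwards [hC, eventually_fst_diag (hQ.mem_nhds hq₀),
        eventually_snd_diag (hQ.mem_nhds hq₀)] with z h1 hq hq' t ht x
      have := (h1 x _ (hvJ _ hq x t ht) _ (hvJ _ hq' x t ht)).1
      rw [show (1 / 2 + 1 / 2 : ℝ) = 1 by norm_num, Real.rpow_one, ← mul_add]
      exact this
    · exact (((hv₀ 1).holder_of_lt_one hB (by norm_num) (by norm_num)).at_zero hT).congr_of_eqOn hQ
        fun q hq q' hq' t _ x => by simp [h0 q hq, h0 q' hq']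
  have hvb := hv.locBd_of_holder (by norm_num) hvH.supBd
  induction k with
  | zero =>
    exact ⟨hv.locBd hQ hvb, hvH.mono isBound_jetBd le_rfl (by norm_num)⟩
  | succ k ih =>
    obtain ⟨hv1, v', hv', hvrem⟩ := hv₀ (k + 1)
    have hcoeff := fun m => hE.coeff T (k + 1) m
    choose hA1 A' hA' hArem using hcoeff
    have hsub : ∀ e, CkH (SupBd T) Q k (subst (dirDeriv J Q e f) v) := fun e =>
      (hf.bddSmooth_dirDeriv hQ hJQ e).ckH_subst hJ hQ hJQ hvJ ih.supBd
    obtain ⟨w, hwS, hwb, hw0, hwrem⟩ := hv.exists_deriv hE hQ hT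
      (hvH.mono isBound_jetBd le_rfl (by norm_num)) hvb (hsub (1, 0)).locBd
      (ρ := fun i q => subst (dirDeriv J Q (0, EuclideanSpace.single i 1) f) v q) (A' := A')
      (v₀' := v') (hf.remBd_subst hJ hQ hJQ hvJ hvH.supBd) (fun m i => (hA' m i).locBd) hArem
      ((hvrem.at_zero hT).congr_of_eqOn hQ fun q hq q' hq' t _ x => by simp [h0 q hq, h0 q' hq'])
    refine ⟨hv.locBd hQ hvb, w, fun i => ?_, hwrem⟩
    -- The derivatives solve the linearized equation, with coefficient ∂f/∂s along v. This is of
    -- class k because v is, so the linear theorem applies.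
    exact (hwS i).ckH_of_linear hE hQ hT k (hwb i) (hsub (1, 0))
      ((hsub _).add hB (CkH.sum hB _ fun m _ => (hA' m i).mul (ih.lift hQ (hE.op m)))) (hv' i)
      (hw0 i)

end Nonlinear

/-! ### Joint smoothness in space and parameter -/

section JointRegularity

variable {p n : ℕ} {F : Type*} [TopologicalSpace F] [ChartedSpace (EuclideanSpace ℝ (Fin p)) F]
  [IsManifold (𝓡 p) ∞ F] {T : ℝ} {Q : Set (EuclideanSpace ℝ (Fin n))}

lemma contDiffOn_coprod {X E₁ E₂ G : Type*} [NormedAddCommGroup X] [NormedSpace ℝ X]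
    [NormedAddCommGroup E₁] [NormedSpace ℝ E₁] [NormedAddCommGroup E₂] [NormedSpace ℝ E₂]
    [NormedAddCommGroup G] [NormedSpace ℝ G] {m : WithTop ℕ∞} {S : Set X} {f : X → E₁ →L[ℝ] G}
    {g : X → E₂ →L[ℝ] G} (hf : ContDiffOn ℝ m f S) (hg : ContDiffOn ℝ m g S) :
    ContDiffOn ℝ m (fun x => (f x).coprod (g x)) S := by
  have h1 : ContDiffOn ℝ m (fun x => (f x).comp (ContinuousLinearMap.fst ℝ E₁ E₂)) S :=
    hf.clm_comp contDiffOn_const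
  have h2 : ContDiffOn ℝ m (fun x => (g x).comp (ContinuousLinearMap.snd ℝ E₁ E₂)) S :=
    hg.clm_comp contDiffOn_const
  refine (h1.add h2).congr fun x _ => ?_
  ext <;> simp

variable (p) in
/-- Small balls in charts, as compact parts of chart domains. -/
def ballChart (x₀ : F) (y : EuclideanSpace ℝ (Fin p)) (r : ℝ)
    (h : Metric.closedBall y r ⊆ (extChartAt (𝓡 p) x₀).target) : ChartCompact p F where
  center := x₀
  carrier := (extChartAt (𝓡 p) x₀).symm '' Metric.closedBall y r
  isCompact := (isCompact_closedBall y r).image_of_continuousOn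
    ((continuousOn_extChartAt_symm x₀).mono h)
  subset := by
    rintro _ ⟨z, hz, rfl⟩
    exact (extChartAt (𝓡 p) x₀).map_target (h hz)

variable (p) in
/-- The `j`-th derivative in the chart around `x₀` of the members of a family, at time `t`. -/
def famJet (t : ℝ) (x₀ : F) (j : ℕ) (v : EuclideanSpace ℝ (Fin n) → F → ℝ → ℝ)
    (y : EuclideanSpace ℝ (Fin p)) (q : EuclideanSpace ℝ (Fin n)) :
    ContinuousMultilinearMap ℝ (fun _ : Fin j => EuclideanSpace ℝ (Fin p)) ℝ :=
  iteratedFDeriv ℝ j (rep p x₀ (fun x => v q x t)) y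

lemma exists_ballChart (x₀ : F) {y : EuclideanSpace ℝ (Fin p)}
    (hy : y ∈ (extChartAt (𝓡 p) x₀).target) : ∃ κ : ChartCompact p F, κ.center = x₀ ∧
      ∀ᶠ z in 𝓝 y, (extChartAt (𝓡 p) x₀).symm z ∈ κ.carrier ∧ z ∈ (extChartAt (𝓡 p) x₀).target := by
  obtain ⟨r, hr, hsub⟩ := Metric.nhds_basis_closedBall.mem_iff.1
    ((isOpen_extChartAt_target (I := 𝓡 p) x₀).mem_nhds hy)
  refine ⟨ballChart p x₀ y r hsub, rfl, ?_⟩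
  filter_upwards [Metric.closedBall_mem_nhds y hr] with z hz
  exact ⟨mem_image_of_mem _ hz, hsub hz⟩

lemma famJet_eq_jet (t : ℝ) (x₀ : F) (j : ℕ) (v : EuclideanSpace ℝ (Fin n) → F → ℝ → ℝ)
    {y : EuclideanSpace ℝ (Fin p)} (hy : y ∈ (extChartAt (𝓡 p) x₀).target)
    (q : EuclideanSpace ℝ (Fin n)) : famJet p t x₀ j v y q =
      jet p j x₀ (fun x => v q x t) ((extChartAt (𝓡 p) x₀).symm y) := by
  rw [famJet, jet, (extChartAt (𝓡 p) x₀).right_inv hy]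

lemma jet_sum {ι : Type*} (I : Finset ι) {φ : ι → F → ℝ} (c : ι → ℝ)
    (hφ : ∀ i, ContMDiff (𝓡 p) 𝓘(ℝ, ℝ) ∞ (φ i)) (j : ℕ) (x₀ : F) {x : F}
    (hx : x ∈ (extChartAt (𝓡 p) x₀).source) :
    ContMDiff (𝓡 p) 𝓘(ℝ, ℝ) ∞ (fun x => ∑ i ∈ I, c i * φ i x) ∧
    jet p j x₀ (fun x => ∑ i ∈ I, c i * φ i x) x = ∑ i ∈ I, c i • jet p j x₀ (φ i) x := by
  classical
  induction I using Finset.induction_on with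
  | empty =>
    refine ⟨by simpa using contMDiff_const, ?_⟩
    have : rep p x₀ (fun _ : F => (0 : ℝ)) = fun _ => 0 := rfl
    simp only [Finset.sum_empty, jet, this]
    simp
  | insert i I hi ih =>
    have h1 : ContMDiff (𝓡 p) 𝓘(ℝ, ℝ) ∞ (fun x => c i * φ i x) := contMDiff_const.mul (hφ i)
    simp only [Finset.sum_insert hi]
    exact ⟨h1.add ih.1, by rw [jet_add h1 ih.1 j x₀ hx, jet_const_mul (hφ i) _ _ _ hx, ih.2]⟩

lemma CkH.spaceSmooth {k : ℕ} {v : EuclideanSpace ℝ (Fin n) → F → ℝ → ℝ}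
    (h : CkH (JetBd p T) Q k v) : ∀ q ∈ Q, SpaceSmooth p T (v q) := fun q hq => by
  obtain ⟨C, hC⟩ := h.locBd none q hq
  exact hC.self_of_nhds.smooth

/-- Continuity in y for fixed q, combined with a Hölder estimate in q that is uniform on a small
ball around y. -/
lemma CkH.continuousOn_famJet {t : ℝ} (ht : t ∈ Icc 0 T)
    (x₀ : F) {k : ℕ} {v : EuclideanSpace ℝ (Fin n) → F → ℝ → ℝ} (h : CkH (JetBd p T) Q k v)
    (hQ : IsOpen Q) (j : ℕ) : ContinuousOn (fun z : _ × _ => famJet p t x₀ j v z.1 z.2)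
      ((extChartAt (𝓡 p) x₀).target ×ˢ Q) := by
  rintro ⟨y, q⟩ ⟨hy, hq⟩
  refine ContinuousAt.continuousWithinAt ?_
  simp only at hy hq
  obtain ⟨κ, rfl, hκ⟩ := exists_ballChart (p := p) x₀ hy
  obtain ⟨C, θ, hθ, hC⟩ := h.holder isBound_jetBd (some (κ, j)) q hq
  have hsm := h.spaceSmooth
  have h1 : Tendsto (fun z : _ × _ => famJet p t κ.center j v z.1 q) (𝓝 (y, q))
      (𝓝 (famJet p t κ.center j v y q)) := by
    have : ContinuousAt (fun z => famJet p t κ.center j v z q) y :=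
      (differentiableAt_iteratedFDeriv_of_contDiffOn (isOpen_extChartAt_target _)
        (contDiffOn_rep (hsm q hq t ht) κ.center) j hy).continuousAt
    exact this.tendsto.comp (continuous_fst.tendsto (y, q))
  have h2 : Tendsto (fun z : _ × _ => famJet p t κ.center j v z.1 z.2 -
      famJet p t κ.center j v z.1 q) (𝓝 (y, q)) (𝓝 0) := by
    have hlim : Tendsto (fun z : EuclideanSpace ℝ (Fin p) × EuclideanSpace ℝ (Fin n) =>
        C * ‖z.2 - q‖ ^ (0 + θ)) (𝓝 (y, q)) (𝓝 0) := by
      have : ContinuousAt (fun z : EuclideanSpace ℝ (Fin p) × EuclideanSpace ℝ (Fin n) =>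
          C * ‖z.2 - q‖ ^ (0 + θ)) (y, q) :=
        continuousAt_const.mul (ContinuousAt.rpow_const (by fun_prop) (Or.inr (by linarith)))
      have h3 := this.tendsto
      simp only [sub_self, norm_zero] at h3
      rwa [Real.zero_rpow (by linarith), mul_zero] at h3
    refine squeeze_zero_norm' ?_ hlim
    have ht2 : Tendsto (fun z : EuclideanSpace ℝ (Fin p) × EuclideanSpace ℝ (Fin n) => (q, z.2))
        (𝓝 (y, q)) (𝓝 (q, q)) := by
      apply Continuous.tendsto (by fun_prop) (y, q)
    filter_upwards [ht2.eventually hC, (continuous_fst.tendsto (y, q)).eventually hκ,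
      (continuous_snd.tendsto (y, q)).eventually (hQ.mem_nhds hq)] with z h3 h4 h5
    have h6 := h3.2 t ht _ h4.1
    rw [famJet_eq_jet _ _ _ _ h4.2, famJet_eq_jet _ _ _ _ h4.2,
      ← jet_sub (hsm _ h5 t ht) (hsm q hq t ht) j _ (κ.subset h4.1)]
    exact h6
  have h3 := h2.add h1
  simp only [sub_add_cancel, zero_add] at h3
  exact h3

lemma hasFDerivAt_famJet {t : ℝ} (ht : t ∈ Icc 0 T) (hQ : IsOpen Q)
    (x₀ : F) {v : EuclideanSpace ℝ (Fin n) → F → ℝ → ℝ}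
    {v' : Fin n → EuclideanSpace ℝ (Fin n) → F → ℝ → ℝ}
    (hv : ∀ q ∈ Q, SpaceSmooth p T (v q)) (hv' : ∀ i, ∀ q ∈ Q, SpaceSmooth p T (v' i q))
    (h : RemBd (JetBd p T) Q 1 (fun q q' => v q' - v q - ∑ i, (q' i - q i) • v' i q)) (j : ℕ)
    {y : EuclideanSpace ℝ (Fin p)} (hy : y ∈ (extChartAt (𝓡 p) x₀).target)
    {q : EuclideanSpace ℝ (Fin n)} (hq : q ∈ Q) :
    HasFDerivAt (fun q => famJet p t x₀ j v y q)
      (∑ i, (EuclideanSpace.proj i : EuclideanSpace ℝ (Fin n) →L[ℝ] ℝ).smulRight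
        (famJet p t x₀ j (v' i) y q)) q := by
  obtain ⟨κ, rfl, hκ⟩ := exists_ballChart (p := p) x₀ hy
  have hκ := hκ.self_of_nhds
  obtain ⟨C, θ, hθ, hC⟩ := h (some (κ, j)) q hq
  refine HasFDerivAt.of_isLittleO ?_
  rw [Asymptotics.isLittleO_iff]
  intro ε hε
  have ht2 : Tendsto (fun q' : EuclideanSpace ℝ (Fin n) => (q, q')) (𝓝 q) (𝓝 (q, q)) :=
    (Continuous.prodMk_right q).tendsto q
  have hlim : ∀ᶠ q' in 𝓝 q, C * ‖q' - q‖ ^ θ < ε := by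
    have : ContinuousAt (fun q' : EuclideanSpace ℝ (Fin n) => C * ‖q' - q‖ ^ θ) q :=
      continuousAt_const.mul (ContinuousAt.rpow_const (by fun_prop) (Or.inr hθ.le))
    have h3 := this.tendsto
    simp only [sub_self, norm_zero] at h3
    rw [Real.zero_rpow hθ.ne', mul_zero] at h3
    exact h3.eventually_lt_const hε
  filter_upwards [ht2.eventually hC, hlim, hQ.mem_nhds hq] with q' h1 h2 hq'
  have h3 := h1.2 t ht _ hκ.1
  have hs := κ.subset hκ.1
  have hsum := jet_sum (p := p) Finset.univ (fun i => q' i - q i) (fun i => hv' i q hq t ht) j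
    κ.center hs
  have e : (fun x => (v q' - v q - ∑ i, (q' i - q i) • v' i q) x t) = fun x =>
      (v q' x t - v q x t) - ∑ i, (q' i - q i) * v' i q x t := by
    ext x; simp
  rw [e, jet_sub ((hv q' hq' t ht).sub (hv q hq t ht)) hsum.1 j _ hs,
    jet_sub (hv q' hq' t ht) (hv q hq t ht) j _ hs, hsum.2] at h3
  simp only [famJet_eq_jet _ _ _ _ hy, _root_.sum_apply,
    ContinuousLinearMap.smulRight_apply, PiLp.proj_apply, PiLp.sub_apply]
  refine h3.trans ?_
  rw [Real.rpow_add_of_nonneg (norm_nonneg _) zero_le_one hθ.le, Real.rpow_one]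
  calc C * (‖q' - q‖ * ‖q' - q‖ ^ θ) = (C * ‖q' - q‖ ^ θ) * ‖q' - q‖ := by ring
    _ ≤ ε * ‖q' - q‖ := mul_le_mul_of_nonneg_right h2.le (norm_nonneg _)

/-- The y-derivative of the jet of order j is the jet of order j + 1, and its q-derivatives are the
jets of order j of the derivative families. Both are continuous, so the jet is differentiable in (y,
q), and both are of class k by induction on k over all j and all families. -/
lemma CkH.contDiffOn_famJet {t : ℝ} (ht : t ∈ Icc 0 T) (hQ : IsOpen Q) (x₀ : F) (k : ℕ)
    {v : EuclideanSpace ℝ (Fin n) → F → ℝ → ℝ} (h : CkH (JetBd p T) Q k v) (j : ℕ) :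
    ContDiffOn ℝ k (fun z : _ × _ => famJet p t x₀ j v z.1 z.2)
      ((extChartAt (𝓡 p) x₀).target ×ˢ Q) := by
  induction k generalizing v j with
  | zero => exact contDiffOn_zero.2 (h.continuousOn_famJet ht x₀ hQ j)
  | succ k ih =>
    have ho := (isOpen_extChartAt_target (I := 𝓡 p) x₀)
    have hO := ho.prod hQ
    have hk := h.of_succ isBound_jetBd
    have hsm := h.spaceSmooth
    obtain ⟨h1, v', hv', hrem⟩ := h
    push_cast
    rw [contDiffOn_succ_iff_hasFDerivWithinAt_of_uniqueDiffOn hO.uniqueDiffOn]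
    refine ⟨by simp, fun z => ContinuousLinearMap.coprod
      (continuousMultilinearCurryLeftEquiv ℝ (fun _ : Fin (j + 1) => EuclideanSpace ℝ (Fin p)) ℝ
        (famJet p t x₀ (j + 1) v z.1 z.2))
      (∑ i, (EuclideanSpace.proj i : EuclideanSpace ℝ (Fin n) →L[ℝ] ℝ).smulRight
        (famJet p t x₀ j (v' i) z.1 z.2)), ?_, fun z hz => ?_⟩
    · have e : ∀ z : EuclideanSpace ℝ (Fin p) × EuclideanSpace ℝ (Fin n),
          (∑ i, (EuclideanSpace.proj i : EuclideanSpace ℝ (Fin n) →L[ℝ] ℝ).smulRight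
            (famJet p t x₀ j (v' i) z.1 z.2)) = ∑ i, ContinuousLinearMap.smulRightL ℝ _ _
              (EuclideanSpace.proj i : EuclideanSpace ℝ (Fin n) →L[ℝ] ℝ)
              (famJet p t x₀ j (v' i) z.1 z.2) := fun z => rfl
      simp only [e]
      refine contDiffOn_coprod ?_ (ContDiffOn.sum fun i _ => ?_)
      · exact (LinearIsometryEquiv.contDiff _).comp_contDiffOn (ih hk (j + 1))
      · exact (ContinuousLinearMap.contDiff _).comp_contDiffOn (ih (hv' i) j)
    · have hc1 : ContinuousOn (fun z : _ × _ => famJet p t x₀ (j + 1) v z.1 z.2) _ :=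
        hk.continuousOn_famJet ht x₀ hQ (j + 1)
      have hc2 := fun i => (hv' i).continuousOn_famJet ht x₀ hQ j
      have key := hasStrictFDerivAt_uncurry_coprod (𝕜 := ℝ) (u := z)
        (f := fun y q => famJet p t x₀ j v y q)
        (f₁ := fun y q => (continuousMultilinearCurryLeftEquiv ℝ
          (fun _ : Fin (j + 1) => EuclideanSpace ℝ (Fin p)) ℝ
            (famJet p t x₀ (j + 1) v y q)))
        (f₂ := fun y q => (∑ i, (EuclideanSpace.proj i : EuclideanSpace ℝ (Fin n) →L[ℝ] ℝ).smulRight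
          (famJet p t x₀ j (v' i) y q))) ?_ ?_ ?_ ?_
      · exact key.hasFDerivAt.hasFDerivWithinAt
      · filter_upwards [hO.mem_nhds hz] with w hw
        have := (differentiableAt_iteratedFDeriv_of_contDiffOn ho
          (contDiffOn_rep (hsm _ hw.2 t ht) x₀) j hw.1).hasFDerivAt
        rw [fderiv_iteratedFDeriv] at this
        exact this
      · filter_upwards [hO.mem_nhds hz] with w hw
        exact hasFDerivAt_famJet ht hQ x₀ hsm (fun i => (hv' i).spaceSmooth) hrem j hw.1 hw.2
      · exact ((LinearIsometryEquiv.continuous _).continuousAt).comp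
          (hc1.continuousAt (hO.mem_nhds hz))
      · have e : (↿fun y q => ∑ i, (EuclideanSpace.proj i : EuclideanSpace ℝ (Fin n) →L[ℝ]
            ℝ).smulRight (famJet p t x₀ j (v' i) y q)) =
            fun z : _ × _ => ∑ i, ContinuousLinearMap.smulRightL ℝ _ _
              (EuclideanSpace.proj i : EuclideanSpace ℝ (Fin n) →L[ℝ] ℝ)
              (famJet p t x₀ j (v' i) z.1 z.2) := rfl
        rw [e]
        refine tendsto_finsetSum _ fun i _ => ?_
        exact ((ContinuousLinearMap.continuous _).continuousAt).comp
          ((hc2 i).continuousAt (hO.mem_nhds hz))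

/-- Smoothness in the variables and the parameter jointly. -/
theorem contMDiffOn_of_ckH (hQ : IsOpen Q) {v : EuclideanSpace ℝ (Fin n) → F → ℝ → ℝ}
    (h : ∀ k, CkH (JetBd p T) Q k v) {t : ℝ} (ht : t ∈ Icc 0 T) :
    ContMDiffOn ((𝓡 p).prod (𝓡 n)) 𝓘(ℝ, ℝ) ∞
      (fun z : F × EuclideanSpace ℝ (Fin n) => v z.2 z.1 t) (univ ×ˢ Q) := by
  rintro ⟨x₀, q₀⟩ ⟨-, hq₀⟩
  have hO := (isOpen_extChartAt_target (I := 𝓡 p) x₀).prod hQ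
  have h1 : ContDiffOn ℝ ∞ (fun z : EuclideanSpace ℝ (Fin p) × EuclideanSpace ℝ (Fin n) =>
      famJet p t x₀ 0 v z.1 z.2 0) ((extChartAt (𝓡 p) x₀).target ×ˢ Q) := by
    rw [contDiffOn_infty]
    intro k
    exact (ContinuousMultilinearMap.apply ℝ (fun _ : Fin 0 => EuclideanSpace ℝ (Fin p)) ℝ
      0).contDiff.comp_contDiffOn ((h k).contDiffOn_famJet ht hQ x₀ k 0)
  have h2 : ContMDiffOn ((𝓡 p).prod (𝓡 n)) 𝓘(ℝ, ℝ) ∞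
      (fun z : F × EuclideanSpace ℝ (Fin n) => famJet p t x₀ 0 v (extChartAt (𝓡 p) x₀ z.1) z.2 0)
      ((extChartAt (𝓡 p) x₀).source ×ˢ Q) := by
    have h3 : ContMDiffOn ((𝓡 p).prod (𝓡 n)) (𝓘(ℝ, EuclideanSpace ℝ (Fin p) × EuclideanSpace ℝ (Fin n)))
      ∞ (fun z : F × EuclideanSpace ℝ (Fin n) => (extChartAt (𝓡 p) x₀ z.1, z.2))
      ((extChartAt (𝓡 p) x₀).source ×ˢ Q) := by
      refine ContMDiffOn.prodMk_space ?_ contMDiffOn_snd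
      refine (contMDiffOn_extChartAt (x := x₀)).comp contMDiffOn_fst ?_
      rintro z hz
      simpa using hz.1
    exact (contMDiffOn_iff_contDiffOn.2 h1).comp h3 fun z hz =>
      ⟨(extChartAt (𝓡 p) x₀).map_source hz.1, hz.2⟩
  have hmem : (extChartAt (𝓡 p) x₀).source ×ˢ Q ∈ 𝓝 (x₀, q₀) :=
    prod_mem_nhds (extChartAt_source_mem_nhds x₀) (hQ.mem_nhds hq₀)
  refine ContMDiffAt.contMDiffWithinAt ?_
  refine (h2.contMDiffAt hmem).congr_of_eventuallyEq ?_
  filter_upwards [hmem] with z hz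
  simp only [famJet, iteratedFDeriv_zero_apply, rep, (extChartAt (𝓡 p) x₀).left_inv hz.1]

end JointRegularity

/-! ### Derivatives along slices of a product -/

section Slices

variable {E V : Type*} [NormedAddCommGroup E] [NormedSpace ℝ E] [NormedAddCommGroup V]
  [NormedSpace ℝ V]

open scoped Pointwise in
-- The slice is h composed with a translation and with the inclusion of the second factor, a linear
-- map of norm at most one.
lemma norm_iteratedFDerivWithin_slice_le {U : Set E} {S : Set V} (hU : IsOpen U)
    (hS : UniqueDiffOn ℝ S) {h : E × V → ℝ} (hh : ContDiffOn ℝ ∞ h (U ×ˢ S)) {y : E}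
    (hy : y ∈ U) {a : V} (ha : a ∈ S) (k : ℕ) :
    ‖iteratedFDerivWithin ℝ k (fun b => h (y, b)) S a‖ ≤
      ‖iteratedFDerivWithin ℝ k h (U ×ˢ S) (y, a)‖ := by
  have hUS : UniqueDiffOn ℝ (U ×ˢ S) := hU.uniqueDiffOn.prod hS
  set c : E × V := (y, 0) with hc
  set h' : E × V → ℝ := fun z => h (z + c) with hh'
  set S' : Set (E × V) := (fun z => z + c) ⁻¹' (U ×ˢ S) with hS'
  have hS'' : S' = ((fun z => z + y) ⁻¹' U) ×ˢ S := by
    ext ⟨z, b⟩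
    simp [hS', hc]
  have hS'u : UniqueDiffOn ℝ S' := by
    rw [hS'']
    exact (hU.preimage (by fun_prop)).uniqueDiffOn.prod hS
  have hh'c : ContDiffOn ℝ ∞ h' S' := hh.comp (by fun_prop) (mapsTo_preimage _ _)
  have hpre : (ContinuousLinearMap.inr ℝ E V) ⁻¹' S' = S := by
    ext b
    simp [hS'', hy]
  have hmem : ContinuousLinearMap.inr ℝ E V a ∈ S' := by
    change a ∈ (ContinuousLinearMap.inr ℝ E V) ⁻¹' S'
    rwa [hpre]
  have h1 := (ContinuousLinearMap.inr ℝ E V).iteratedFDerivWithin_comp_right hh'c hS'u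
    (by rwa [hpre]) hmem (i := k) (by exact_mod_cast le_top)
  rw [hpre] at h1
  have h2 : (h' ∘ ContinuousLinearMap.inr ℝ E V) = fun b => h (y, b) := by
    ext b
    simp [hh', hc]
  rw [h2] at h1
  have h3 : iteratedFDerivWithin ℝ k h' S' (ContinuousLinearMap.inr ℝ E V a) =
      iteratedFDerivWithin ℝ k h (U ×ˢ S) (y, a) := by
    have e1 : c +ᵥ S' = U ×ˢ S := by
      ext z
      rw [Set.mem_vadd_set_iff_neg_vadd_mem]
      simp [hS', add_comm]
    have e2 : ContinuousLinearMap.inr ℝ E V a + c = (y, a) := by simp [hc]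
    rw [hh', iteratedFDerivWithin_comp_add_right, e1, e2]
  rw [h1, h3]
  refine (ContinuousMultilinearMap.norm_compContinuousLinearMap_le _ _).trans ?_
  refine mul_le_of_le_one_right (norm_nonneg _) ?_
  exact Finset.prod_le_one (fun _ _ => norm_nonneg _) fun _ _ => ContinuousLinearMap.norm_inr_le_one ℝ E V

end Slices

/-! ### Passing from a finite atlas to families -/

section Cover

variable {p n : ℕ} {F : Type*} {J : Set ℝ} {Q : Set (EuclideanSpace ℝ (Fin n))} {T : ℝ}
  {α : Type*} [Finite α]

/-- In `BddSmooth` the point x is a mere label, so the chart `a x` may jump with x. Finiteness of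
the cover gives one constant for all charts. -/
lemma bddSmooth_of_cover (hQ : IsOpen Q) (hJQ : UniqueDiffOn ℝ (J ×ˢ Q)) (a : F → α)
    (pr : F → EuclideanSpace ℝ (Fin p)) {U : α → Set (EuclideanSpace ℝ (Fin p))}
    (hU : ∀ i, IsOpen (U i)) (hpr : ∀ x, pr x ∈ U (a x))
    {h : α → EuclideanSpace ℝ (Fin p) × (ℝ × EuclideanSpace ℝ (Fin n)) → ℝ}
    (hh : ∀ i, ContDiffOn ℝ ∞ (h i) (U i ×ˢ (J ×ˢ Q))) {m : ℕ}
    (hb : ∀ k, m ≤ k → ∀ i, ∀ q₀ ∈ Q, ∃ C : ℝ, ∀ᶠ q in 𝓝 q₀, ∀ x, a x = i → ∀ s ∈ J,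
      ‖iteratedFDerivWithin ℝ k (h i) (U i ×ˢ (J ×ˢ Q)) (pr x, (s, q))‖ ≤ C) :
    BddSmooth J Q m (fun x b => h (a x) (pr x, b)) where
  smooth x := (hh (a x)).comp (by fun_prop) fun b hb => ⟨hpr x, hb⟩
  bdd k hk q₀ hq₀ := by
    have : ∀ i, ∃ C : ℝ, ∀ᶠ q in 𝓝 q₀, ∀ x, a x = i → ∀ s ∈ J,
      ‖iteratedFDerivWithin ℝ k (h i) (U i ×ˢ (J ×ˢ Q)) (pr x, (s, q))‖ ≤ C := fun i => hb k hk i q₀ hq₀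
    choose C hC using this
    obtain ⟨M, hM⟩ := (Set.finite_range C).bddAbove
    refine ⟨M, ?_⟩
    filter_upwards [Filter.eventually_all.2 hC, hQ.mem_nhds hq₀] with q h1 hq x s hs
    refine (norm_iteratedFDerivWithin_slice_le (hU (a x)) hJQ (hh (a x)) (hpr x) ⟨hs, hq⟩ k).trans ?_
    exact (h1 (a x) x rfl s hs).trans (hM (mem_range_self _))

/-- Functions that are smooth in the variables and in the parameter, in a finite atlas, are smooth
families. -/
lemma ckH_of_cover (hQ : IsOpen Q) (a : F → α)
    (pr : F → EuclideanSpace ℝ (Fin p)) {U K : α → Set (EuclideanSpace ℝ (Fin p))}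
    (hU : ∀ i, IsOpen (U i)) (hK : ∀ i, IsCompact (K i)) (hKU : ∀ i, K i ⊆ U i)
    (hpr : ∀ x, pr x ∈ K (a x))
    {h : α → EuclideanSpace ℝ (Fin p) × EuclideanSpace ℝ (Fin n) → ℝ}
    (hh : ∀ i, ContDiffOn ℝ ∞ (h i) (U i ×ˢ Q)) (k : ℕ) :
    CkH (SupBd T) Q k (fun q x _ => h (a x) (pr x, q)) := by
  -- A dummy variable s ∈ [0, 1] turns the claim into the case v = 0 of `BddSmooth.ckH_subst`.
  set J : Set ℝ := Icc 0 1
  have hJQ : UniqueDiffOn ℝ (J ×ˢ Q) := (uniqueDiffOn_Icc one_pos).prod hQ.uniqueDiffOn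
  have hh' : ∀ i, ContDiffOn ℝ ∞ (fun z : EuclideanSpace ℝ (Fin p) ×
      (ℝ × EuclideanSpace ℝ (Fin n)) => h i (z.1, z.2.2)) (U i ×ˢ (J ×ˢ Q)) := fun i =>
    (hh i).comp (by fun_prop) fun z hz => ⟨hz.1, hz.2.2⟩
  have hS := bddSmooth_of_cover hQ hJQ a pr hU (fun x => hKU _ (hpr x)) hh' (m := 0)
    (fun k _ i q₀ hq₀ => by
      obtain ⟨r, hr, hrQ⟩ := Metric.nhds_basis_closedBall.mem_iff.1 (hQ.mem_nhds hq₀)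
      have hc := (hh' i).continuousOn_iteratedFDerivWithin (m := k) (by exact_mod_cast le_top)
        ((hU i).uniqueDiffOn.prod hJQ)
      obtain ⟨C, hC⟩ := ((hK i).prod (isCompact_Icc.prod
        (isCompact_closedBall q₀ r))).exists_bound_of_continuousOn
          (hc.mono (prod_mono (hKU i) (prod_mono_right hrQ)))
      refine ⟨C, ?_⟩
      filter_upwards [Metric.closedBall_mem_nhds q₀ hr] with q hq x hx s hs
      exact hC _ ⟨hx ▸ hpr x, hs, hq⟩)
  exact hS.ckH_subst (v := fun _ _ _ => 0) (convex_Icc 0 1) hQ hJQ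
    (fun q _ x t _ => ⟨le_rfl, zero_le_one⟩) (CkH.zero isBound_supBd k)

lemma exists_finite_chartCover [TopologicalSpace F] [ChartedSpace (EuclideanSpace ℝ (Fin p)) F]
    [CompactSpace F] : ∃ (I : Finset F) (κ : F → ChartCompact p F) (a : F → I),
      ∀ x, x ∈ (κ (a x)).carrier := by
  have : ∀ x : F, ∃ κ : ChartCompact p F, κ.carrier ∈ 𝓝 x := fun x => by
    obtain ⟨r, hr, hsub⟩ := Metric.nhds_basis_closedBall.mem_iff.1
      ((isOpen_extChartAt_target (I := 𝓡 p) x).mem_nhds (mem_extChartAt_target x))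
    refine ⟨ballChart p x (extChartAt (𝓡 p) x x) r hsub, ?_⟩
    filter_upwards [extChartAt_source_mem_nhds (I := 𝓡 p) x,
      (continuousAt_extChartAt (I := 𝓡 p) x).preimage_mem_nhds (Metric.closedBall_mem_nhds _ hr)]
      with y hy hy'
    exact ⟨_, hy', (extChartAt (𝓡 p) x).left_inv hy⟩
  choose κ hκ using this
  obtain ⟨I, -, hI⟩ := isCompact_univ.elim_nhds_subcover (fun x => (κ x).carrier) fun x _ => hκ x
  have : ∀ x : F, ∃ i : I, x ∈ (κ i).carrier := fun x => by
    obtain ⟨i, hi, hx⟩ := mem_iUnion₂.1 (hI (mem_univ x))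
    exact ⟨⟨i, hi⟩, hx⟩
  choose a ha using this
  exact ⟨I, κ, a, ha⟩

end Cover

/-! ### Rules for partial derivatives -/

section PartialDerivatives

variable {p : ℕ} {y : EuclideanSpace ℝ (Fin p)}

lemma partialDeriv_congr {h h' : EuclideanSpace ℝ (Fin p) → ℝ} (e : h =ᶠ[𝓝 y] h') (i : Fin p) :
    partialDeriv i h y = partialDeriv i h' y := by
  rw [partialDeriv, partialDeriv, e.fderiv_eq]

lemma partialDeriv_mul {h h' : EuclideanSpace ℝ (Fin p) → ℝ} (i : Fin p)
    (hh : DifferentiableAt ℝ h y) (hh' : DifferentiableAt ℝ h' y) :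
    partialDeriv i (fun z => h z * h' z) y = partialDeriv i h y * h' y + h y * partialDeriv i h' y := by
  simp only [partialDeriv, fderiv_fun_mul hh hh']
  simp
  ring

lemma partialDeriv_const_mul {h : EuclideanSpace ℝ (Fin p) → ℝ} (i : Fin p) (c : ℝ)
    (hh : DifferentiableAt ℝ h y) :
    partialDeriv i (fun z => c * h z) y = c * partialDeriv i h y := by
  rw [partialDeriv_mul i (differentiableAt_const c) hh]
  simp [partialDeriv]

lemma partialDeriv_sum {ι : Type*} (I : Finset ι) {h : ι → EuclideanSpace ℝ (Fin p) → ℝ} (i : Fin p)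
    (hh : ∀ j ∈ I, DifferentiableAt ℝ (h j) y) :
    partialDeriv i (fun z => ∑ j ∈ I, h j z) y = ∑ j ∈ I, partialDeriv i (h j) y := by
  simp only [partialDeriv, fderiv_fun_sum hh, _root_.sum_apply]

lemma partialDeriv_comp {h : EuclideanSpace ℝ (Fin p) → ℝ}
    {Φ : EuclideanSpace ℝ (Fin p) → EuclideanSpace ℝ (Fin p)} (i : Fin p)
    (hh : DifferentiableAt ℝ h (Φ y)) (hΦ : DifferentiableAt ℝ Φ y) :
    partialDeriv i (fun z => h (Φ z)) y =
      ∑ l, partialDeriv l h (Φ y) * partialDeriv i (fun z => Φ z l) y := by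
  have h1 : fderiv ℝ (fun z => h (Φ z)) y = (fderiv ℝ h (Φ y)).comp (fderiv ℝ Φ y) :=
    fderiv_comp y hh hΦ
  have h2 : ∀ l, partialDeriv i (fun z => Φ z l) y =
      (fderiv ℝ Φ y (EuclideanSpace.single i 1)) l := fun l => by
    have : HasFDerivAt (fun z => Φ z l) ((EuclideanSpace.proj l :
        EuclideanSpace ℝ (Fin p) →L[ℝ] ℝ).comp (fderiv ℝ Φ y)) y :=
      (EuclideanSpace.proj l : EuclideanSpace ℝ (Fin p) →L[ℝ] ℝ).hasFDerivAt.comp y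
        hΦ.hasFDerivAt
    rw [partialDeriv, this.fderiv]
    simp
  simp only [h2]
  rw [partialDeriv, h1, ContinuousLinearMap.comp_apply]
  set v := fderiv ℝ Φ y (EuclideanSpace.single i 1)
  have h3 : v = ∑ l, v l • EuclideanSpace.single l (1 : ℝ) := by
    ext j
    simp [Pi.single_apply]
  conv_lhs => rw [h3]
  rw [map_sum]
  refine Finset.sum_congr rfl fun l _ => ?_
  rw [map_smul, smul_eq_mul, partialDeriv, mul_comm]

lemma partialDeriv_comm {h : EuclideanSpace ℝ (Fin p) → ℝ} (hh : ContDiffAt ℝ 2 h y) (i j : Fin p) :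
    partialDeriv i (partialDeriv j h) y = partialDeriv j (partialDeriv i h) y := by
  have hd : DifferentiableAt ℝ (fderiv ℝ h) y :=
    (hh.fderiv_right (m := 1) (by norm_num)).differentiableAt (by norm_num)
  have e : ∀ a b : Fin p, partialDeriv a (partialDeriv b h) y =
      fderiv ℝ (fderiv ℝ h) y (EuclideanSpace.single a 1) (EuclideanSpace.single b 1) :=
    fun a b => by
      have : HasFDerivAt (partialDeriv b h) _ y :=
        hd.hasFDerivAt.clm_apply (hasFDerivAt_const (EuclideanSpace.single b (1 : ℝ)) y)
      rw [partialDeriv, this.fderiv]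
      simp
  rw [e, e]
  exact (hh.isSymmSndFDerivAt (by simp)) _ _

lemma contDiffAt_partialDeriv {h : EuclideanSpace ℝ (Fin p) → ℝ} {m m' : WithTop ℕ∞}
    (hh : ContDiffAt ℝ m' h y) (hm : m + 1 ≤ m') (i : Fin p) :
    ContDiffAt ℝ m (partialDeriv i h) y :=
  (hh.fderiv_right hm).clm_apply contDiffAt_const

end PartialDerivatives

/-! ### Determinants, adjugates and inverses of smooth matrices -/

section Determinants

variable {p : ℕ} {X : Type*} [NormedAddCommGroup X] [NormedSpace ℝ X] {N : Type*} [Fintype N]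
  [DecidableEq N]

lemma contDiffAt_det {M : X → Matrix N N ℝ} {x : X} {m : WithTop ℕ∞}
    (hM : ∀ a b, ContDiffAt ℝ m (fun z => M z a b) x) : ContDiffAt ℝ m (fun z => (M z).det) x := by
  simp only [Matrix.det_apply']
  refine ContDiffAt.sum fun σ _ => contDiffAt_const.mul ?_
  exact contDiffAt_prod fun i _ => hM _ _

lemma contDiffAt_adjugate {M : X → Matrix N N ℝ} {x : X} {m : WithTop ℕ∞}
    (hM : ∀ a b, ContDiffAt ℝ m (fun z => M z a b) x) (i j : N) :
    ContDiffAt ℝ m (fun z => (M z).adjugate i j) x := by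
  simp only [Matrix.adjugate_apply]
  refine contDiffAt_det fun a b => ?_
  by_cases h : a = j
  · subst h
    simp only [Matrix.updateRow_self]
    exact contDiffAt_const
  · simp only [Matrix.updateRow_ne h]
    exact hM a b

lemma contDiffAt_matrix_inv {M : X → Matrix N N ℝ} {x : X} {m : WithTop ℕ∞}
    (hM : ∀ a b, ContDiffAt ℝ m (fun z => M z a b) x) (h0 : (M x).det ≠ 0) (i j : N) :
    ContDiffAt ℝ m (fun z => (M z)⁻¹ i j) x := by
  simp only [Matrix.inv_def, Matrix.smul_apply, smul_eq_mul, Ring.inverse_eq_inv']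
  exact ((contDiffAt_det hM).inv h0).mul (contDiffAt_adjugate hM i j)

/-- Jacobi's formula: the determinant is multilinear in the rows, and the determinant with row a
replaced by the differentiated row is expanded by Cramer's rule. -/
lemma partialDeriv_det {M : EuclideanSpace ℝ (Fin p) → Matrix N N ℝ}
    {y : EuclideanSpace ℝ (Fin p)} (hM : ∀ a b, DifferentiableAt ℝ (fun z => M z a b) y)
    (i : Fin p) : partialDeriv i (fun z => (M z).det) y =
      ∑ a, ∑ b, (M y).adjugate b a * partialDeriv i (fun z => M z a b) y := by
  set d : ContinuousMultilinearMap ℝ (fun _ : N => N → ℝ) ℝ :=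
    { toMultilinearMap := (Matrix.detRowAlternating (n := N) (R := ℝ)).toMultilinearMap
      cont := by
        change Continuous fun M : N → N → ℝ => Matrix.det M
        exact continuous_id.matrix_det } with hd
  have hM' : HasFDerivAt (fun z => (fun a b => M z a b : N → N → ℝ))
      (ContinuousLinearMap.pi fun a => ContinuousLinearMap.pi fun b =>
        fderiv ℝ (fun z => M z a b) y) y :=
    hasFDerivAt_pi.2 fun a => hasFDerivAt_pi.2 fun b => (hM a b).hasFDerivAt
  have h1 : HasFDerivAt (fun z => (M z).det) _ y := (d.hasFDerivAt _).comp y hM'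
  rw [partialDeriv, h1.fderiv]
  change d.linearDeriv (fun a b => M y a b)
    (fun a b => partialDeriv i (fun z => M z a b) y) = _
  rw [ContinuousMultilinearMap.linearDeriv_apply]
  refine Finset.sum_congr rfl fun a _ => ?_
  change ((M y).updateRow a _).det = _
  rw [← Matrix.cramer_transpose_apply, Matrix.cramer_eq_adjugate_mulVec, Matrix.mulVec,
    dotProduct]
  refine Finset.sum_congr rfl fun b _ => ?_
  rw [← Matrix.adjugate_transpose]
  rfl

end Determinants

/-! ### The Piola identity -/

section Piola

variable {p : ℕ} {y : EuclideanSpace ℝ (Fin p)}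
  {Φ : EuclideanSpace ℝ (Fin p) → EuclideanSpace ℝ (Fin p)}

/-- The Jacobian matrix. -/
def jacMatrix (Φ : EuclideanSpace ℝ (Fin p) → EuclideanSpace ℝ (Fin p))
    (y : EuclideanSpace ℝ (Fin p)) : Matrix (Fin p) (Fin p) ℝ :=
  Matrix.of fun l i => partialDeriv i (fun z => Φ z l) y

lemma contDiffAt_coord {m : WithTop ℕ∞} (hΦ : ContDiffAt ℝ m Φ y) (l : Fin p) :
    ContDiffAt ℝ m (fun z => Φ z l) y :=
  (EuclideanSpace.proj l : EuclideanSpace ℝ (Fin p) →L[ℝ] ℝ).contDiff.contDiffAt.comp y hΦ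

lemma contDiffAt_jacMatrix {m m' : WithTop ℕ∞} (hΦ : ContDiffAt ℝ m' Φ y) (hm : m + 1 ≤ m')
    (l i : Fin p) : ContDiffAt ℝ m (fun z => jacMatrix Φ z l i) y :=
  contDiffAt_partialDeriv (contDiffAt_coord hΦ l) hm i

/-- The rows of the cofactor matrix of a Jacobian matrix are free of divergence. -/
lemma sum_partialDeriv_adjugate (hΦ : ContDiffAt ℝ 2 Φ y) (h0 : (jacMatrix Φ y).det ≠ 0)
    (k : Fin p) : ∑ i, partialDeriv i (fun z => (jacMatrix Φ z).adjugate i k) y = 0 := by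
  have hJ : ∀ a b, ContDiffAt ℝ 1 (fun z => jacMatrix Φ z a b) y := fun a b =>
    contDiffAt_jacMatrix hΦ (by norm_num) a b
  have hJd : ∀ a b, DifferentiableAt ℝ (fun z => jacMatrix Φ z a b) y := fun a b =>
    (hJ a b).differentiableAt one_ne_zero
  have hAd : ∀ a b, DifferentiableAt ℝ (fun z => (jacMatrix Φ z).adjugate a b) y := fun a b =>
    (contDiffAt_adjugate hJ a b).differentiableAt one_ne_zero
  set A := (jacMatrix Φ y).adjugate with hA
  set H : Fin p → Fin p → Fin p → ℝ := fun a i b => partialDeriv i (fun z => jacMatrix Φ z a b) y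
  have hsymm : ∀ a i b, H a i b = H a b i := fun a i b =>
    partialDeriv_comm (contDiffAt_coord hΦ a) i b
  have hdet : ∀ i, partialDeriv i (fun z => (jacMatrix Φ z).det) y = ∑ a, ∑ b, A b a * H a i b :=
    fun i => partialDeriv_det hJd i
  -- This differentiates (Jacobian) · (adjugate) = det · 1; multiplying by the adjugate then
  -- isolates the derivative of the adjugate, up to the factor det.
  have hprod : ∀ i a, ∑ b, (H a i b * A b k + jacMatrix Φ y a b *
      partialDeriv i (fun z => (jacMatrix Φ z).adjugate b k) y) =
      (1 : Matrix (Fin p) (Fin p) ℝ) a k * partialDeriv i (fun z => (jacMatrix Φ z).det) y := by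
    intro i a
    have e1 : (fun z => ∑ b, jacMatrix Φ z a b * (jacMatrix Φ z).adjugate b k) =
        fun z => (1 : Matrix (Fin p) (Fin p) ℝ) a k * (jacMatrix Φ z).det := by
      ext z
      have := congrFun (congrFun (Matrix.mul_adjugate (jacMatrix Φ z)) a) k
      rw [Matrix.mul_apply] at this
      rw [this]
      simp [mul_comm]
    have e2 := congrArg (fun h => partialDeriv i h y) e1
    beta_reduce at e2
    rw [partialDeriv_sum _ _ (fun b _ => (hJd a b).fun_mul (hAd b k)), partialDeriv_const_mul _ _
      ((contDiffAt_det hJ).differentiableAt one_ne_zero)] at e2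
    rw [← e2]
    exact Finset.sum_congr rfl fun b _ => (partialDeriv_mul i (hJd a b) (hAd b k)).symm
  have hmul : ∀ i, ∑ a, A i a * ∑ b, jacMatrix Φ y a b *
      partialDeriv i (fun z => (jacMatrix Φ z).adjugate b k) y =
      (jacMatrix Φ y).det * partialDeriv i (fun z => (jacMatrix Φ z).adjugate i k) y := by
    intro i
    simp only [Finset.mul_sum]
    rw [Finset.sum_comm]
    have : ∀ b, ∑ a, A i a * (jacMatrix Φ y a b *
        partialDeriv i (fun z => (jacMatrix Φ z).adjugate b k) y) =
        (jacMatrix Φ y).det * (1 : Matrix (Fin p) (Fin p) ℝ) i b *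
          partialDeriv i (fun z => (jacMatrix Φ z).adjugate b k) y := by
      intro b
      have := congrFun (congrFun (Matrix.adjugate_mul (jacMatrix Φ y)) i) b
      rw [Matrix.mul_apply, Matrix.smul_apply, smul_eq_mul] at this
      rw [← this, Finset.sum_mul]
      exact Finset.sum_congr rfl fun a _ => by rw [mul_assoc]
    simp only [this, Matrix.one_apply]
    simp
  have key : (jacMatrix Φ y).det *
      ∑ i, partialDeriv i (fun z => (jacMatrix Φ z).adjugate i k) y = 0 := by
    rw [Finset.mul_sum]
    have e : ∀ i, (jacMatrix Φ y).det * partialDeriv i (fun z => (jacMatrix Φ z).adjugate i k) y =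
        A i k * (∑ a, ∑ b, A b a * H a i b) - ∑ a, A i a * ∑ b, H a i b * A b k := by
      intro i
      have e1 : ∀ a, ∑ b, jacMatrix Φ y a b *
          partialDeriv i (fun z => (jacMatrix Φ z).adjugate b k) y =
          (1 : Matrix (Fin p) (Fin p) ℝ) a k * (∑ a, ∑ b, A b a * H a i b) -
            ∑ b, H a i b * A b k := fun a => by
        rw [← hdet, ← hprod i a, Finset.sum_add_distrib]; ring
      rw [← hmul]
      simp only [e1, mul_sub, Finset.sum_sub_distrib]
      congr 1
      simp [Matrix.one_apply]
    simp only [e, Finset.sum_sub_distrib, Finset.mul_sum]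
    rw [sub_eq_zero]
    -- Exchanging the names i and b makes the two triple sums agree, because H a i b = ∂_i ∂_b Φ_a
    -- is symmetric in i and b.
    have e2 : ∑ i, ∑ a, ∑ b, A i a * (H a i b * A b k) =
        ∑ b, ∑ a, ∑ i, A i a * (H a i b * A b k) := by
      rw [Finset.sum_comm]
      conv_rhs => rw [Finset.sum_comm]
      exact Finset.sum_congr rfl fun a _ => Finset.sum_comm
    rw [e2]
    refine Finset.sum_congr rfl fun i _ => Finset.sum_congr rfl fun a _ =>
      Finset.sum_congr rfl fun b _ => ?_
    rw [hsymm a i b]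
    ring
  exact (mul_eq_zero.1 key).resolve_left h0

/-- The Piola identity. -/
lemma sum_partialDeriv_piola (hΦ : ContDiffAt ℝ 2 Φ y) (h0 : (jacMatrix Φ y).det ≠ 0)
    {V : Fin p → EuclideanSpace ℝ (Fin p) → ℝ} (hV : ∀ k, DifferentiableAt ℝ (V k) (Φ y)) :
    ∑ i, partialDeriv i (fun z => ∑ k, (jacMatrix Φ z).adjugate i k * V k (Φ z)) y =
      (jacMatrix Φ y).det * ∑ k, partialDeriv k (V k) (Φ y) := by
  have hJ : ∀ a b, ContDiffAt ℝ 1 (fun z => jacMatrix Φ z a b) y := fun a b =>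
    contDiffAt_jacMatrix hΦ (by norm_num) a b
  have hAd : ∀ a b, DifferentiableAt ℝ (fun z => (jacMatrix Φ z).adjugate a b) y := fun a b =>
    (contDiffAt_adjugate hJ a b).differentiableAt one_ne_zero
  have hΦd : DifferentiableAt ℝ Φ y := hΦ.differentiableAt two_ne_zero
  have hVd : ∀ k, DifferentiableAt ℝ (fun z => V k (Φ z)) y := fun k => (hV k).comp y hΦd
  have e : ∀ i, partialDeriv i (fun z => ∑ k, (jacMatrix Φ z).adjugate i k * V k (Φ z)) y =
      ∑ k, (partialDeriv i (fun z => (jacMatrix Φ z).adjugate i k) y * V k (Φ y) +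
        ∑ l, partialDeriv l (V k) (Φ y) *
          (jacMatrix Φ y l i * (jacMatrix Φ y).adjugate i k)) := by
    intro i
    rw [partialDeriv_sum _ _ fun k _ => (hAd i k).fun_mul (hVd k)]
    refine Finset.sum_congr rfl fun k _ => ?_
    rw [partialDeriv_mul _ (hAd i k) (hVd k), partialDeriv_comp i (hV k) hΦd, Finset.mul_sum]
    congr 1
    refine Finset.sum_congr rfl fun l _ => ?_
    simp only [jacMatrix, Matrix.of_apply]
    ring
  simp only [e]
  rw [Finset.sum_comm]
  simp only [Finset.sum_add_distrib, ← Finset.sum_mul, sum_partialDeriv_adjugate hΦ h0, zero_mul,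
    zero_add]
  rw [Finset.mul_sum]
  refine Finset.sum_congr rfl fun k _ => ?_
  rw [Finset.sum_comm]
  simp only [← Finset.mul_sum]
  have : ∀ l, ∑ i, jacMatrix Φ y l i * (jacMatrix Φ y).adjugate i k =
      (jacMatrix Φ y).det * (1 : Matrix (Fin p) (Fin p) ℝ) l k := fun l => by
    have := congrFun (congrFun (Matrix.mul_adjugate (jacMatrix Φ y)) l) k
    rwa [Matrix.mul_apply, Matrix.smul_apply, smul_eq_mul] at this
  simp only [this, Matrix.one_apply]
  simp [mul_comm]

end Piola

/-! ### The Laplacian in coordinates: invariance and maximum principle -/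

section LaplacianInCoordinates

variable {p : ℕ}

/-- The Laplace-Beltrami operator of a metric `G` on an open subset of `ℝᵖ`. -/
def lapCoord (G : EuclideanSpace ℝ (Fin p) → Matrix (Fin p) (Fin p) ℝ)
    (w : EuclideanSpace ℝ (Fin p) → ℝ) (y : EuclideanSpace ℝ (Fin p)) : ℝ :=
  (Real.sqrt (G y).det)⁻¹ * ∑ i, partialDeriv i
    (fun z => Real.sqrt (G z).det * ∑ j, (G z)⁻¹ i j * partialDeriv j w z) y

/-- The coefficients of the terms of first order of the Laplace-Beltrami operator. -/
def lapDrift (G : EuclideanSpace ℝ (Fin p) → Matrix (Fin p) (Fin p) ℝ) (j : Fin p)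
    (y : EuclideanSpace ℝ (Fin p)) : ℝ :=
  (Real.sqrt (G y).det)⁻¹ * ∑ i, partialDeriv i (fun z => Real.sqrt (G z).det * (G z)⁻¹ i j) y

variable {y : EuclideanSpace ℝ (Fin p)}

lemma contDiffAt_sqrt_det {X N : Type*} [NormedAddCommGroup X] [NormedSpace ℝ X] [Fintype N]
    [DecidableEq N] {M : X → Matrix N N ℝ} {x : X} {m : WithTop ℕ∞}
    (hM : ∀ a b, ContDiffAt ℝ m (fun z => M z a b) x) (h0 : 0 < (M x).det) :
    ContDiffAt ℝ m (fun z => Real.sqrt (M z).det) x :=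
  (contDiffAt_det hM).sqrt h0.ne'

lemma lapCoord_eq {G : EuclideanSpace ℝ (Fin p) → Matrix (Fin p) (Fin p) ℝ}
    (hG : ∀ a b, ContDiffAt ℝ 1 (fun z => G z a b) y) (h0 : 0 < (G y).det)
    {w : EuclideanSpace ℝ (Fin p) → ℝ} (hw : ContDiffAt ℝ 2 w y) :
    lapCoord G w y = ∑ i, ∑ j, (G y)⁻¹ i j * partialDeriv i (partialDeriv j w) y +
      ∑ j, lapDrift G j y * partialDeriv j w y := by
  have hρ := (contDiffAt_sqrt_det hG h0).differentiableAt one_ne_zero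
  have hI : ∀ i j, DifferentiableAt ℝ (fun z => (G z)⁻¹ i j) y := fun i j =>
    (contDiffAt_matrix_inv hG h0.ne' i j).differentiableAt one_ne_zero
  have hw1 : ∀ j, DifferentiableAt ℝ (partialDeriv j w) y := fun j =>
    (contDiffAt_partialDeriv (m := 1) hw (by norm_num) j).differentiableAt one_ne_zero
  have e : ∀ i, partialDeriv i
      (fun z => Real.sqrt (G z).det * ∑ j, (G z)⁻¹ i j * partialDeriv j w z) y =
      ∑ j, (partialDeriv i (fun z => Real.sqrt (G z).det * (G z)⁻¹ i j) y * partialDeriv j w y +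
        Real.sqrt (G y).det * ((G y)⁻¹ i j * partialDeriv i (partialDeriv j w) y)) := by
    intro i
    have e1 : (fun z => Real.sqrt (G z).det * ∑ j, (G z)⁻¹ i j * partialDeriv j w z) =
        fun z => ∑ j, (Real.sqrt (G z).det * (G z)⁻¹ i j) * partialDeriv j w z := by
      ext z
      rw [Finset.mul_sum]
      exact Finset.sum_congr rfl fun j _ => by ring
    rw [e1, partialDeriv_sum _ _ fun j _ => (hρ.fun_mul (hI i j)).fun_mul (hw1 j)]
    refine Finset.sum_congr rfl fun j _ => ?_
    rw [partialDeriv_mul i (hρ.fun_mul (hI i j)) (hw1 j)]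
    ring
  have hs : Real.sqrt (G y).det ≠ 0 := (Real.sqrt_pos.2 h0).ne'
  rw [lapCoord]
  simp only [e, Finset.sum_add_distrib, mul_add]
  rw [add_comm]
  congr 1
  · simp only [← Finset.mul_sum]
    rw [← mul_assoc, inv_mul_cancel₀ hs, one_mul]
  · simp only [lapDrift]
    rw [Finset.sum_comm]
    simp only [Finset.mul_sum, Finset.sum_mul]
    exact Finset.sum_congr rfl fun j _ => Finset.sum_congr rfl fun i _ => by ring

/-- The Laplace-Beltrami operator does not depend on the coordinates. -/
theorem lapCoord_comp {Φ : EuclideanSpace ℝ (Fin p) → EuclideanSpace ℝ (Fin p)}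
    (hΦ : ContDiffAt ℝ 2 Φ y) (hJ : (jacMatrix Φ y).det ≠ 0)
    {G G' : EuclideanSpace ℝ (Fin p) → Matrix (Fin p) (Fin p) ℝ}
    (hG : ∀ᶠ z in 𝓝 y, G z = (jacMatrix Φ z).transpose * G' (Φ z) * jacMatrix Φ z)
    (hG' : ∀ a b, ContDiffAt ℝ 1 (fun z => G' z a b) (Φ y)) (h0 : 0 < (G' (Φ y)).det)
    {w w' : EuclideanSpace ℝ (Fin p) → ℝ} (hw' : ContDiffAt ℝ 2 w' (Φ y))
    (hw : w =ᶠ[𝓝 y] fun z => w' (Φ z)) : lapCoord G w y = lapCoord G' w' (Φ y) := by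
  set V : Fin p → EuclideanSpace ℝ (Fin p) → ℝ := fun k z =>
    Real.sqrt (G' z).det * ∑ j, (G' z)⁻¹ k j * partialDeriv j w' z with hVdef
  have hV : ∀ k, DifferentiableAt ℝ (V k) (Φ y) := fun k => by
    refine ((contDiffAt_sqrt_det hG' h0).differentiableAt one_ne_zero).fun_mul
      (DifferentiableAt.fun_sum fun j _ => ?_)
    exact ((contDiffAt_matrix_inv hG' h0.ne' k j).differentiableAt one_ne_zero).fun_mul
      ((contDiffAt_partialDeriv (m := 1) hw' (by norm_num) j).differentiableAt one_ne_zero)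
  have hJc : ∀ a b, ContDiffAt ℝ 1 (fun z => jacMatrix Φ z a b) y := fun a b =>
    contDiffAt_jacMatrix hΦ (by norm_num) a b
  have hdc : ContinuousAt (fun z => (jacMatrix Φ z).det) y := (contDiffAt_det hJc).continuousAt
  -- The sign of the Jacobian determinant, constant near y. It accounts for the absolute value in
  -- √det G = |det J| √det G'.
  set s : ℝ := |(jacMatrix Φ y).det| / (jacMatrix Φ y).det with hs
  have hsign : ∀ᶠ z in 𝓝 y, (jacMatrix Φ z).det ≠ 0 ∧
      |(jacMatrix Φ z).det| = s * (jacMatrix Φ z).det := by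
    rcases lt_or_gt_of_ne hJ with h | h
    · filter_upwards [hdc.eventually_lt_const h] with z hz
      refine ⟨hz.ne, ?_⟩
      rw [hs, abs_of_neg h, abs_of_neg hz, neg_div, div_self h.ne]
      ring
    · filter_upwards [hdc.eventually_const_lt h] with z hz
      refine ⟨hz.ne', ?_⟩
      rw [hs, abs_of_pos h, abs_of_pos hz, div_self h.ne', one_mul]
  have hsqrt : ∀ z, G z = (jacMatrix Φ z).transpose * G' (Φ z) * jacMatrix Φ z →
      Real.sqrt (G z).det = |(jacMatrix Φ z).det| * Real.sqrt (G' (Φ z)).det := by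
    intro z hz
    rw [hz, Matrix.det_mul, Matrix.det_mul, Matrix.det_transpose,
      show (jacMatrix Φ z).det * (G' (Φ z)).det * (jacMatrix Φ z).det =
        (jacMatrix Φ z).det ^ 2 * (G' (Φ z)).det by ring, Real.sqrt_mul (sq_nonneg _),
      Real.sqrt_sq_eq_abs]
  have hΦd : ∀ᶠ z in 𝓝 y, DifferentiableAt ℝ Φ z :=
    (hΦ.eventually (by simp)).mono fun z hz => hz.differentiableAt two_ne_zero
  have hwd : ∀ᶠ z in 𝓝 y, DifferentiableAt ℝ w' (Φ z) :=
    hΦ.continuousAt.eventually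
      ((hw'.eventually (by simp)).mono fun z hz => hz.differentiableAt two_ne_zero)
  -- The flux √det G · grad w transforms by the adjugate of the Jacobian, exactly the form whose
  -- divergence the Piola identity computes.
  have hflux : ∀ᶠ z in 𝓝 y, ∀ i, Real.sqrt (G z).det * ∑ j, (G z)⁻¹ i j * partialDeriv j w z =
      s * ∑ k, (jacMatrix Φ z).adjugate i k * V k (Φ z) := by
    filter_upwards [hsign, hG, hΦd, hwd, hw.eventuallyEq_nhds] with z h1 h2 h3 h4 h5 i
    have e1 : (fun j => partialDeriv j w z) =
        (jacMatrix Φ z).transpose.mulVec fun l => partialDeriv l w' (Φ z) := by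
      ext j
      rw [partialDeriv_congr h5, partialDeriv_comp j h4 h3, Matrix.mulVec, dotProduct]
      exact Finset.sum_congr rfl fun l _ => mul_comm _ _
    have e2 : ∑ j, (G z)⁻¹ i j * partialDeriv j w z =
        ((G z)⁻¹.mulVec fun j => partialDeriv j w z) i := rfl
    have e3 : (G z)⁻¹ * (jacMatrix Φ z).transpose = (jacMatrix Φ z)⁻¹ * (G' (Φ z))⁻¹ := by
      rw [h2, Matrix.mul_inv_rev, Matrix.mul_inv_rev, Matrix.mul_assoc, Matrix.mul_assoc,
        Matrix.nonsing_inv_mul _ (by rw [Matrix.det_transpose]; exact h1.1.isUnit), Matrix.mul_one]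
    rw [hsqrt z h2, e2, e1, Matrix.mulVec_mulVec, e3, ← Matrix.mulVec_mulVec, Matrix.mulVec,
      dotProduct, Finset.mul_sum, Finset.mul_sum]
    refine Finset.sum_congr rfl fun k _ => ?_
    rw [Matrix.inv_def, Matrix.smul_apply, smul_eq_mul, Ring.inverse_eq_inv', h1.2]
    simp only [hVdef, Matrix.mulVec, dotProduct]
    field_simp [h1.1]
  have hA : ∀ i, DifferentiableAt ℝ
      (fun z => ∑ k, (jacMatrix Φ z).adjugate i k * V k (Φ z)) y := fun i =>
    DifferentiableAt.fun_sum fun k _ =>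
      ((contDiffAt_adjugate hJc i k).differentiableAt one_ne_zero).fun_mul
        ((hV k).comp y (hΦ.differentiableAt two_ne_zero))
  have e : ∀ i, partialDeriv i
      (fun z => Real.sqrt (G z).det * ∑ j, (G z)⁻¹ i j * partialDeriv j w z) y =
      s * partialDeriv i (fun z => ∑ k, (jacMatrix Φ z).adjugate i k * V k (Φ z)) y := fun i => by
    rw [partialDeriv_congr (hflux.mono fun z hz => hz i), partialDeriv_const_mul i s (hA i)]
  rw [lapCoord, lapCoord]
  simp only [e, ← Finset.mul_sum]
  rw [sum_partialDeriv_piola hΦ hJ hV, hsqrt y hG.self_of_nhds, mul_inv, ← mul_assoc s,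
    ← hsign.self_of_nhds.2]
  have : |(jacMatrix Φ y).det| ≠ 0 := abs_ne_zero.2 hJ
  field_simp
  rfl

/-- A positive second derivative would make t a local minimum as well, so φ would be locally
constant and its second derivative zero. -/
lemma deriv_deriv_nonpos_of_isLocalMax {φ : ℝ → ℝ} {t : ℝ} (h : IsLocalMax φ t)
    (hc : ContinuousAt φ t) : deriv (deriv φ) t ≤ 0 := by
  by_contra! hpos
  have h1 := isLocalMin_of_deriv_deriv_pos hpos h.deriv_eq_zero hc
  have h2 : φ =ᶠ[𝓝 t] fun _ => φ t := by
    filter_upwards [h, h1] with s hs hs' using le_antisymm hs hs'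
  have h3 : deriv φ =ᶠ[𝓝 t] fun _ => 0 := by
    filter_upwards [h2.eventuallyEq_nhds] with s hs
    rw [hs.deriv_eq, deriv_const]
  rw [h3.deriv_eq, deriv_const] at hpos
  exact hpos.false

lemma sum_partialDeriv_nonpos_of_isLocalMax {w : EuclideanSpace ℝ (Fin p) → ℝ}
    (hw : ContDiffAt ℝ 2 w y) (h : IsLocalMax w y) (b : Fin p → ℝ) :
    ∑ i, ∑ j, b i * b j * partialDeriv i (partialDeriv j w) y ≤ 0 := by
  set v : EuclideanSpace ℝ (Fin p) := ∑ i, b i • EuclideanSpace.single i (1 : ℝ) with hv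
  set ℓ : ℝ → EuclideanSpace ℝ (Fin p) := fun t => y + t • v with hℓ
  have hℓd : ∀ t, HasDerivAt ℓ v t := fun t => by
    have h := ((hasDerivAt_id t).smul_const v).const_add y
    rw [one_smul] at h
    exact h
  have hℓ0 : ℓ 0 = y := by simp [hℓ]
  have hℓc : Tendsto ℓ (𝓝 0) (𝓝 y) := by
    simpa only [hℓ0] using (hℓd 0).continuousAt.tendsto
  have hwd : ∀ᶠ z in 𝓝 y, DifferentiableAt ℝ w z :=
    (hw.eventually (by simp)).mono fun z hz => hz.differentiableAt two_ne_zero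
  have h1 : deriv (w ∘ ℓ) =ᶠ[𝓝 0] fun t => fderiv ℝ w (ℓ t) v := by
    filter_upwards [hℓc.eventually hwd] with t ht
    exact (ht.hasFDerivAt.comp_hasDerivAt t (hℓd t)).deriv
  have hd : DifferentiableAt ℝ (fderiv ℝ w) y :=
    (hw.fderiv_right (m := 1) (by norm_num)).differentiableAt (by norm_num)
  have h2 : HasDerivAt (fun t => fderiv ℝ w (ℓ t) v) (fderiv ℝ (fderiv ℝ w) y v v) 0 := by
    have h3 : HasDerivAt (fun t => fderiv ℝ w (ℓ t)) (fderiv ℝ (fderiv ℝ w) y v) 0 :=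
      HasFDerivAt.comp_hasDerivAt 0 (by rw [hℓ0]; exact hd.hasFDerivAt) (hℓd 0)
    simpa using h3.clm_apply (hasDerivAt_const (0 : ℝ) v)
  have hmax : IsLocalMax (w ∘ ℓ) 0 := by
    have := hℓc.eventually h
    filter_upwards [this] with t ht
    simpa only [Function.comp, hℓ0] using ht
  have h3 := deriv_deriv_nonpos_of_isLocalMax hmax (by
    refine ContinuousAt.comp ?_ (hℓd 0).continuousAt
    rw [hℓ0]
    exact hw.continuousAt)
  rw [h1.deriv_eq, h2.deriv] at h3
  refine le_trans (le_of_eq ?_) h3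
  have e : ∀ i j : Fin p, partialDeriv i (partialDeriv j w) y =
      fderiv ℝ (fderiv ℝ w) y (EuclideanSpace.single i 1) (EuclideanSpace.single j 1) :=
    fun i j => by
      have : HasFDerivAt (partialDeriv j w) _ y :=
        hd.hasFDerivAt.clm_apply (hasFDerivAt_const (EuclideanSpace.single j (1 : ℝ)) y)
      rw [partialDeriv, this.fderiv]
      simp
  simp only [hv, map_sum, map_smul, _root_.sum_apply, _root_.smul_apply, smul_eq_mul, e]
  rw [Finset.sum_comm]
  refine Finset.sum_congr rfl fun j _ => ?_
  rw [Finset.mul_sum]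
  exact Finset.sum_congr rfl fun i _ => by ring

open scoped MatrixOrder in
/-- The maximum principle at a point, in coordinates. -/
lemma lapCoord_nonpos_of_isLocalMax {G : EuclideanSpace ℝ (Fin p) → Matrix (Fin p) (Fin p) ℝ}
    (hG : ∀ a b, ContDiffAt ℝ 1 (fun z => G z a b) y) (hpos : (G y).PosDef)
    {w : EuclideanSpace ℝ (Fin p) → ℝ} (hw : ContDiffAt ℝ 2 w y) (h : IsLocalMax w y) :
    lapCoord G w y ≤ 0 := by
  rw [lapCoord_eq hG hpos.det_pos hw]
  have h1 : ∀ j, partialDeriv j w y = 0 := fun j => by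
    rw [partialDeriv, h.fderiv_eq_zero]
    rfl
  simp only [h1, mul_zero, Finset.sum_const_zero, add_zero]
  -- Writing the inverse metric as BᵀB turns its contraction with the Hessian into a sum of values
  -- of the Hessian form on the rows of B, each nonpositive.
  obtain ⟨B, hB⟩ := CStarAlgebra.nonneg_iff_eq_star_mul_self.1 hpos.inv.posSemidef.nonneg
  rw [hB, Matrix.star_eq_conjTranspose]
  have e : ∑ i, ∑ j, (B.conjTranspose * B) i j * partialDeriv i (partialDeriv j w) y =
      ∑ k, ∑ i, ∑ j, B k i * B k j * partialDeriv i (partialDeriv j w) y := by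
    simp only [Matrix.mul_apply, Finset.sum_mul, Matrix.conjTranspose_apply, star_trivial]
    conv_rhs => rw [Finset.sum_comm]
    exact Finset.sum_congr rfl fun i _ => Finset.sum_comm
  rw [e]
  exact Finset.sum_nonpos fun k _ => sum_partialDeriv_nonpos_of_isLocalMax hw h _

end LaplacianInCoordinates

/-! ### The metric in charts: positivity, change of chart, smoothness -/

section Gram

variable {p n : ℕ} {F : Type*} [TopologicalSpace F] [ChartedSpace (EuclideanSpace ℝ (Fin p)) F]
  [IsManifold (𝓡 p) ∞ F]

/-- The derivative of the inverse of a chart, as a map of the model space. -/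
def chartSymmDeriv (x₀ : F) (y : EuclideanSpace ℝ (Fin p)) :
    EuclideanSpace ℝ (Fin p) →L[ℝ] EuclideanSpace ℝ (Fin p) :=
  mfderiv (𝓡 p) (𝓡 p) (extChartAt (𝓡 p) x₀).symm y

/-- A Riemannian metric at a point, as a bilinear form on the model space. -/
def metricForm (g : ContMDiffRiemannianMetric (𝓡 p) ∞ (EuclideanSpace ℝ (Fin p))
      (fun x : F => TangentSpace (𝓡 p) x)) (b : F) :
    EuclideanSpace ℝ (Fin p) →L[ℝ] EuclideanSpace ℝ (Fin p) →L[ℝ] ℝ :=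
  g.inner b

lemma gramMatrix_apply (g : ContMDiffRiemannianMetric (𝓡 p) ∞ (EuclideanSpace ℝ (Fin p))
      (fun x : F => TangentSpace (𝓡 p) x)) (x₀ : F) (y : EuclideanSpace ℝ (Fin p)) (i j : Fin p) :
    gramMatrix g x₀ y i j = metricForm g ((extChartAt (𝓡 p) x₀).symm y)
      (chartSymmDeriv x₀ y (EuclideanSpace.single i 1))
      (chartSymmDeriv x₀ y (EuclideanSpace.single j 1)) := rfl

lemma bilin_apply (B : EuclideanSpace ℝ (Fin p) →L[ℝ] EuclideanSpace ℝ (Fin p) →L[ℝ] ℝ)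
    (A : EuclideanSpace ℝ (Fin p) →L[ℝ] EuclideanSpace ℝ (Fin p)) (v w : EuclideanSpace ℝ (Fin p)) :
    B (A v) (A w) = ∑ i, ∑ j, v i * (B (A (EuclideanSpace.single i 1))
      (A (EuclideanSpace.single j 1)) * w j) := by
  have h : ∀ v : EuclideanSpace ℝ (Fin p), v = ∑ l, v l • EuclideanSpace.single l (1 : ℝ) :=
    fun v => by
      ext j
      simp [Pi.single_apply]
  conv_lhs => rw [h v, h w]
  simp only [map_sum, map_smul, _root_.sum_apply, _root_.smul_apply, smul_eq_mul, Finset.mul_sum]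
  refine (Finset.sum_comm).trans ?_
  exact Finset.sum_congr rfl fun i _ => Finset.sum_congr rfl fun j _ => by ring

lemma chartSymmDeriv_injective (x₀ : F) {y : EuclideanSpace ℝ (Fin p)}
    (hy : y ∈ (extChartAt (𝓡 p) x₀).target) : Function.Injective (chartSymmDeriv x₀ y) := by
  have : IsManifold (𝓡 p) 1 F := IsManifold.of_le (n := ∞) (by norm_cast)
  have h := isInvertible_mfderivWithin_extChartAt_symm (I := 𝓡 p) hy
  rw [ModelWithCorners.range_eq_univ, mfderivWithin_univ] at h
  exact h.bijective.injective

lemma gramMatrix_posDef (g : ContMDiffRiemannianMetric (𝓡 p) ∞ (EuclideanSpace ℝ (Fin p))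
      (fun x : F => TangentSpace (𝓡 p) x)) (x₀ : F) {y : EuclideanSpace ℝ (Fin p)}
    (hy : y ∈ (extChartAt (𝓡 p) x₀).target) : (gramMatrix g x₀ y).PosDef := by
  refine Matrix.PosDef.of_dotProduct_mulVec_pos ?_ fun b hb => ?_
  · ext i j
    exact g.symm _ _ _
  · have h1 : chartSymmDeriv x₀ y (WithLp.toLp 2 b) ≠ 0 := by
      rw [Ne, map_eq_zero_iff _ (chartSymmDeriv_injective x₀ hy)]
      intro h
      exact hb (by simpa using congrArg WithLp.ofLp h)
    have h2 : 0 < metricForm g ((extChartAt (𝓡 p) x₀).symm y)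
        (chartSymmDeriv x₀ y (WithLp.toLp 2 b)) (chartSymmDeriv x₀ y (WithLp.toLp 2 b)) :=
      g.pos _ _ h1
    rw [bilin_apply] at h2
    simp only [dotProduct, Matrix.mulVec, star_trivial, Finset.mul_sum, gramMatrix_apply]
    exact h2

variable (p) in
/-- The change of coordinates from the chart around `x₀` to the chart around `c`. -/
def transition (x₀ c : F) (y : EuclideanSpace ℝ (Fin p)) : EuclideanSpace ℝ (Fin p) :=
  extChartAt (𝓡 p) c ((extChartAt (𝓡 p) x₀).symm y)

lemma eventually_mem_charts (x₀ c : F) {y : EuclideanSpace ℝ (Fin p)}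
    (hy : y ∈ (extChartAt (𝓡 p) x₀).target)
    (hc : (extChartAt (𝓡 p) x₀).symm y ∈ (extChartAt (𝓡 p) c).source) :
    ∀ᶠ z in 𝓝 y, z ∈ (extChartAt (𝓡 p) x₀).target ∧
      (extChartAt (𝓡 p) x₀).symm z ∈ (extChartAt (𝓡 p) c).source := by
  have h1 := (isOpen_extChartAt_target (I := 𝓡 p) x₀).mem_nhds hy
  have h2 : ContinuousAt (extChartAt (𝓡 p) x₀).symm y := continuousAt_extChartAt_symm'' hy
  filter_upwards [h1, h2.preimage_mem_nhds ((isOpen_extChartAt_source c).mem_nhds hc)]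
    with z h3 h4 using ⟨h3, h4⟩

lemma contDiffAt_transition (x₀ c : F) {y : EuclideanSpace ℝ (Fin p)}
    (hy : y ∈ (extChartAt (𝓡 p) x₀).target)
    (hc : (extChartAt (𝓡 p) x₀).symm y ∈ (extChartAt (𝓡 p) c).source) :
    ContDiffAt ℝ ∞ (transition p x₀ c) y := by
  rw [← contMDiffAt_iff_contDiffAt]
  have h1 : ContMDiffAt (𝓡 p) (𝓡 p) ∞ (extChartAt (𝓡 p) x₀).symm y :=
    (contMDiffOn_extChartAt_symm x₀).contMDiffAt
      ((isOpen_extChartAt_target (I := 𝓡 p) x₀).mem_nhds hy)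
  have h2 : ContMDiffAt (𝓡 p) 𝓘(ℝ, EuclideanSpace ℝ (Fin p)) ∞ (extChartAt (𝓡 p) c)
      ((extChartAt (𝓡 p) x₀).symm y) :=
    contMDiffAt_extChartAt' (by simpa using hc)
  exact h2.comp y h1

lemma chartSymmDeriv_transition (x₀ c : F) {y : EuclideanSpace ℝ (Fin p)}
    (hy : y ∈ (extChartAt (𝓡 p) x₀).target)
    (hc : (extChartAt (𝓡 p) x₀).symm y ∈ (extChartAt (𝓡 p) c).source)
    (v : EuclideanSpace ℝ (Fin p)) : chartSymmDeriv x₀ y v =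
      chartSymmDeriv c (transition p x₀ c y) (fderiv ℝ (transition p x₀ c) y v) := by
  have hΦ := contDiffAt_transition x₀ c hy hc
  have hmem : transition p x₀ c y ∈ (extChartAt (𝓡 p) c).target :=
    (extChartAt (𝓡 p) c).map_source hc
  have e1 : (extChartAt (𝓡 p) x₀).symm =ᶠ[𝓝 y]
      (extChartAt (𝓡 p) c).symm ∘ transition p x₀ c := by
    filter_upwards [eventually_mem_charts x₀ c hy hc] with z hz
    exact ((extChartAt (𝓡 p) c).left_inv hz.2).symm
  have h1 : MDifferentiableAt (𝓡 p) (𝓡 p) (extChartAt (𝓡 p) c).symm (transition p x₀ c y) :=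
    ((contMDiffOn_extChartAt_symm (n := ∞) c).contMDiffAt
      ((isOpen_extChartAt_target (I := 𝓡 p) c).mem_nhds hmem)).mdifferentiableAt (by simp)
  have h2 : HasMFDerivAt (𝓡 p) (𝓡 p) (transition p x₀ c) y (fderiv ℝ (transition p x₀ c) y) :=
    (hΦ.differentiableAt (by simp)).hasFDerivAt.hasMFDerivAt
  have e2 := ((h1.hasMFDerivAt.comp y h2).congr_of_eventuallyEq e1).mfderiv
  exact congrArg (fun A : EuclideanSpace ℝ (Fin p) →L[ℝ] EuclideanSpace ℝ (Fin p) => A v) e2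

/-- The transformation law of a covariant 2-tensor, from the chain rule for the inverse charts. -/
lemma gramMatrix_transition (g : ContMDiffRiemannianMetric (𝓡 p) ∞ (EuclideanSpace ℝ (Fin p))
      (fun x : F => TangentSpace (𝓡 p) x)) (x₀ c : F) {y : EuclideanSpace ℝ (Fin p)}
    (hy : y ∈ (extChartAt (𝓡 p) x₀).target)
    (hc : (extChartAt (𝓡 p) x₀).symm y ∈ (extChartAt (𝓡 p) c).source) :
    gramMatrix g x₀ y = (jacMatrix (transition p x₀ c) y).transpose *
      gramMatrix g c (transition p x₀ c y) * jacMatrix (transition p x₀ c) y := by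
  have hJ : ∀ l i, jacMatrix (transition p x₀ c) y l i =
      (fderiv ℝ (transition p x₀ c) y (EuclideanSpace.single i 1)) l := fun l i => by
    have h := (EuclideanSpace.proj l : EuclideanSpace ℝ (Fin p) →L[ℝ] ℝ).hasFDerivAt.comp y
      ((contDiffAt_transition x₀ c hy hc).differentiableAt (by simp)).hasFDerivAt
    change fderiv ℝ ((EuclideanSpace.proj l : EuclideanSpace ℝ (Fin p) →L[ℝ] ℝ) ∘
      transition p x₀ c) y _ = _
    rw [h.fderiv]
    rfl
  have hb : (extChartAt (𝓡 p) x₀).symm y = (extChartAt (𝓡 p) c).symm (transition p x₀ c y) :=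
    ((extChartAt (𝓡 p) c).left_inv hc).symm
  ext i j
  rw [gramMatrix_apply, chartSymmDeriv_transition x₀ c hy hc, chartSymmDeriv_transition x₀ c hy hc,
    hb, bilin_apply]
  simp only [Matrix.mul_apply, Matrix.transpose_apply, Finset.sum_mul, hJ, gramMatrix_apply]
  rw [Finset.sum_comm]
  exact Finset.sum_congr rfl fun l _ => Finset.sum_congr rfl fun m _ => by ring

/-- The coordinate field is the tangent map of the inverse chart applied to a constant section. -/
lemma contMDiffOn_coordVec (c : F) (i : Fin p) :
    ContMDiffOn (𝓡 p) ((𝓡 p).prod (𝓡 p)) ∞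
      (fun y => TotalSpace.mk' (EuclideanSpace ℝ (Fin p)) (E := fun x : F => TangentSpace (𝓡 p) x)
        ((extChartAt (𝓡 p) c).symm y) (coordVec c i y)) (extChartAt (𝓡 p) c).target := by
  have ho := isOpen_extChartAt_target (I := 𝓡 p) c
  have h1 := (contMDiffOn_extChartAt_symm (I := 𝓡 p) (n := ∞) c).contMDiffOn_tangentMapWithin
    (m := ∞) (by simp) ho.uniqueMDiffOn
  have h2 : ContMDiff (𝓡 p) (𝓡 p).tangent ∞ (fun y : EuclideanSpace ℝ (Fin p) =>
      (⟨y, EuclideanSpace.single i (1 : ℝ)⟩ : TangentBundle (𝓡 p) (EuclideanSpace ℝ (Fin p)))) :=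
    contMDiff_vectorSpace_iff_contDiff.2 contDiff_const
  have h3 := h1.comp h2.contMDiffOn (s := (extChartAt (𝓡 p) c).target) (fun y hy => hy)
  refine h3.congr fun y hy => ?_
  simp only [Function.comp, tangentMapWithin, coordVec]
  rw [mfderivWithin_of_isOpen ho hy]

lemma contDiffOn_gramMatrix {Q : Set (EuclideanSpace ℝ (Fin n))}
    {g : EuclideanSpace ℝ (Fin n) →
      ContMDiffRiemannianMetric (𝓡 p) ∞ (EuclideanSpace ℝ (Fin p))
        (fun x : F => TangentSpace (𝓡 p) x)}
    (hg : ContMDiffOn ((𝓡 p).prod (𝓡 n))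
      ((𝓡 p).prod
        𝓘(ℝ, EuclideanSpace ℝ (Fin p) →L[ℝ] EuclideanSpace ℝ (Fin p) →L[ℝ] ℝ)) ∞
      (fun z : F × EuclideanSpace ℝ (Fin n) =>
        TotalSpace.mk' (EuclideanSpace ℝ (Fin p) →L[ℝ] EuclideanSpace ℝ (Fin p) →L[ℝ] ℝ)
          (E := fun x : F => TangentSpace (𝓡 p) x →L[ℝ] TangentSpace (𝓡 p) x →L[ℝ] ℝ)
          z.1 ((g z.2).inner z.1))
      (univ ×ˢ Q)) (c : F) (i j : Fin p) :
    ContDiffOn ℝ ∞ (fun z : EuclideanSpace ℝ (Fin p) × EuclideanSpace ℝ (Fin n) =>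
      gramMatrix (g z.2) c z.1 i j) ((extChartAt (𝓡 p) c).target ×ˢ Q) := by
  rw [← contMDiffOn_iff_contDiffOn]
  have hfst : ContMDiffOn 𝓘(ℝ, EuclideanSpace ℝ (Fin p) × EuclideanSpace ℝ (Fin n)) (𝓡 p) ∞
      (fun z : EuclideanSpace ℝ (Fin p) × EuclideanSpace ℝ (Fin n) => z.1)
      ((extChartAt (𝓡 p) c).target ×ˢ Q) := contDiff_fst.contMDiff.contMDiffOn
  have hsnd : ContMDiffOn 𝓘(ℝ, EuclideanSpace ℝ (Fin p) × EuclideanSpace ℝ (Fin n)) (𝓡 n) ∞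
      (fun z : EuclideanSpace ℝ (Fin p) × EuclideanSpace ℝ (Fin n) => z.2)
      ((extChartAt (𝓡 p) c).target ×ˢ Q) := contDiff_snd.contMDiff.contMDiffOn
  have hsymm := (contMDiffOn_extChartAt_symm (I := 𝓡 p) (n := ∞) c).comp hfst fun z hz => hz.1
  have h1 := hg.comp (hsymm.prodMk hsnd) fun z hz => ⟨mem_univ _, hz.2⟩
  have hv := fun i => (contMDiffOn_coordVec (p := p) c i).comp hfst fun z hz => hz.1
  have h2 := ContMDiffOn.clm_bundle_apply₂ (F₁ := EuclideanSpace ℝ (Fin p))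
    (F₂ := EuclideanSpace ℝ (Fin p)) (F₃ := ℝ) (E₁ := fun x : F => TangentSpace (𝓡 p) x)
    (E₂ := fun x : F => TangentSpace (𝓡 p) x) (E₃ := fun _ : F => ℝ)
    (b := fun z : EuclideanSpace ℝ (Fin p) × EuclideanSpace ℝ (Fin n) =>
      (extChartAt (𝓡 p) c).symm z.1)
    (ψ := fun z => (g z.2).inner _) (v := fun z => coordVec c i z.1)
    (w := fun z => coordVec c j z.1) h1 (hv i) (hv j)
  exact fun z hz => ((Bundle.contMDiffWithinAt_totalSpace (F := ℝ) (E := Bundle.Trivial F ℝ)).1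
    (h2 z hz)).2

end Gram

/-! ### The Laplacians of a smooth family of metrics -/

section Laplacian

variable {p n : ℕ} {F : Type*} [TopologicalSpace F] [ChartedSpace (EuclideanSpace ℝ (Fin p)) F]
  [IsManifold (𝓡 p) ∞ F]

lemma partialDeriv_eq_iteratedFDeriv {w : EuclideanSpace ℝ (Fin p) → ℝ}
    (y : EuclideanSpace ℝ (Fin p)) (j : Fin p) : partialDeriv j w y =
      iteratedFDeriv ℝ 1 w y (fun _ => EuclideanSpace.single j 1) := by
  rw [iteratedFDeriv_one_apply, partialDeriv]

lemma partialDeriv_partialDeriv_eq_iteratedFDeriv {w : EuclideanSpace ℝ (Fin p) → ℝ}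
    {y : EuclideanSpace ℝ (Fin p)} (hw : ContDiffAt ℝ 2 w y) (i j : Fin p) :
    partialDeriv i (partialDeriv j w) y =
      iteratedFDeriv ℝ 2 w y ![EuclideanSpace.single i 1, EuclideanSpace.single j 1] := by
  have h1 : DifferentiableAt ℝ (fderiv ℝ w) y :=
    (hw.fderiv_right (m := 1) (by norm_num)).differentiableAt one_ne_zero
  have h2 := h1.hasFDerivAt.clm_apply (hasFDerivAt_const (EuclideanSpace.single j (1 : ℝ)) y)
  rw [iteratedFDeriv_two_apply, partialDeriv]
  change fderiv ℝ (fun z => fderiv ℝ w z (EuclideanSpace.single j 1)) y _ = _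
  rw [h2.fderiv]
  simp

lemma isBoundedOp_jet {α : Type*} [Finite α] (κ : α → ChartCompact p F) (a : F → α)
    (ha : ∀ x, x ∈ (κ (a x)).carrier) {k : ℕ} (hk : 1 ≤ k)
    {m : Fin k → EuclideanSpace ℝ (Fin p)} (hm : ∀ i, ‖m i‖ ≤ 1) :
    IsBoundedOp p (fun φ x => jet p k (κ (a x)).center φ x m) where
  add hφ hψ x := by
    rw [jet_add hφ hψ k _ ((κ (a x)).subset (ha x))]
    rfl
  smul c φ hφ x := by
    rw [jet_const_mul hφ c k _ ((κ (a x)).subset (ha x))]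
    rfl
  bound := by
    classical
    obtain ⟨_⟩ := nonempty_fintype α
    refine ⟨Finset.univ.image fun i : α => (κ i, k), fun s hs => ?_, fun T v C _ hb t ht x => ?_⟩
    · obtain ⟨i, -, rfl⟩ := Finset.mem_image.1 hs
      exact hk
    · have h1 := (hb (κ (a x), k) (Finset.mem_image_of_mem _ (Finset.mem_univ _))).2 t ht x (ha x)
      refine ((jet p k (κ (a x)).center (fun x => v x t) x).le_opNorm m).trans (le_trans ?_ h1)
      exact mul_le_of_le_one_right (norm_nonneg _)
        (Finset.prod_le_one (fun _ _ => norm_nonneg _) fun i _ => hm i)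

lemma contDiffAt_rep {φ : F → ℝ} (hφ : ContMDiff (𝓡 p) 𝓘(ℝ, ℝ) ∞ φ) (c : F)
    {y : EuclideanSpace ℝ (Fin p)} (hy : y ∈ (extChartAt (𝓡 p) c).target) :
    ContDiffAt ℝ 2 (rep p c φ) y :=
  ((contDiffOn_rep hφ c).contDiffAt ((isOpen_extChartAt_target c).mem_nhds hy)).of_le
    (by norm_cast)

variable {Q : Set (EuclideanSpace ℝ (Fin n))}
    {g : EuclideanSpace ℝ (Fin n) →
      ContMDiffRiemannianMetric (𝓡 p) ∞ (EuclideanSpace ℝ (Fin p))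
        (fun x : F => TangentSpace (𝓡 p) x)}

/-- A family of metrics that is smooth in the variables and the parameter. -/
def SmoothMetrics (Q : Set (EuclideanSpace ℝ (Fin n))) (g : EuclideanSpace ℝ (Fin n) →
      ContMDiffRiemannianMetric (𝓡 p) ∞ (EuclideanSpace ℝ (Fin p))
        (fun x : F => TangentSpace (𝓡 p) x)) : Prop :=
  ContMDiffOn ((𝓡 p).prod (𝓡 n))
      ((𝓡 p).prod
        𝓘(ℝ, EuclideanSpace ℝ (Fin p) →L[ℝ] EuclideanSpace ℝ (Fin p) →L[ℝ] ℝ)) ∞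
      (fun z : F × EuclideanSpace ℝ (Fin n) =>
        TotalSpace.mk' (EuclideanSpace ℝ (Fin p) →L[ℝ] EuclideanSpace ℝ (Fin p) →L[ℝ] ℝ)
          (E := fun x : F => TangentSpace (𝓡 p) x →L[ℝ] TangentSpace (𝓡 p) x →L[ℝ] ℝ)
          z.1 ((g z.2).inner z.1))
      (univ ×ˢ Q)

lemma SmoothMetrics.contDiffAt_gramMatrix (hg : SmoothMetrics Q g) (hQ : IsOpen Q)
    {q : EuclideanSpace ℝ (Fin n)} (hq : q ∈ Q) (c : F) {y : EuclideanSpace ℝ (Fin p)}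
    (hy : y ∈ (extChartAt (𝓡 p) c).target) (i j : Fin p) :
    ContDiffAt ℝ 1 (fun z => gramMatrix (g q) c z i j) y := by
  have h := ((contDiffOn_gramMatrix hg c i j).contDiffAt
    (((isOpen_extChartAt_target c).prod hQ).mem_nhds (mk_mem_prod hy hq))).comp y
      ((contDiff_id.prodMk contDiff_const).contDiffAt (x := y)
        (f := fun z : EuclideanSpace ℝ (Fin p) => (z, q)))
  exact h.of_le (by exact_mod_cast le_top)

/-- By definition `laplacian` uses the chart around x, which varies with x. Coordinate invariance
replaces it by a fixed chart, whose coefficients are smooth in (y, q). -/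
lemma SmoothMetrics.laplacian_eq_lapCoord (hg : SmoothMetrics Q g) (hQ : IsOpen Q)
    {q : EuclideanSpace ℝ (Fin n)} (hq : q ∈ Q) {φ : F → ℝ}
    (hφ : ContMDiff (𝓡 p) 𝓘(ℝ, ℝ) ∞ φ) (c : F) {x : F}
    (hx : x ∈ (extChartAt (𝓡 p) c).source) : laplacian (g q) φ x =
      lapCoord (gramMatrix (g q) c) (rep p c φ) (extChartAt (𝓡 p) c x) := by
  have hy : extChartAt (𝓡 p) x x ∈ (extChartAt (𝓡 p) x).target := mem_extChartAt_target x
  have hxx : (extChartAt (𝓡 p) x).symm (extChartAt (𝓡 p) x x) = x := extChartAt_to_inv x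
  have hc : (extChartAt (𝓡 p) x).symm (extChartAt (𝓡 p) x x) ∈ (extChartAt (𝓡 p) c).source := by
    rwa [hxx]
  have hΦ : transition p x c (extChartAt (𝓡 p) x x) = extChartAt (𝓡 p) c x := by
    rw [transition, hxx]
  have hmem := (extChartAt (𝓡 p) c).map_source hx
  rw [← hΦ] at hmem ⊢
  refine lapCoord_comp ((contDiffAt_transition x c hy hc).of_le (by norm_cast)) ?_ ?_
    (hg.contDiffAt_gramMatrix hQ hq c hmem) (gramMatrix_posDef (g q) c hmem).det_pos
    (contDiffAt_rep hφ c hmem) ?_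
  · have h1 := (gramMatrix_posDef (g q) x hy).det_pos
    rw [gramMatrix_transition (g q) x c hy hc, Matrix.det_mul] at h1
    exact right_ne_zero_of_mul h1.ne'
  · filter_upwards [eventually_mem_charts x c hy hc] with z hz
    exact gramMatrix_transition (g q) x c hz.1 hz.2
  · filter_upwards [eventually_mem_charts x c hy hc] with z hz
    simp only [rep, transition, (extChartAt (𝓡 p) c).left_inv hz.2]

lemma SmoothMetrics.laplacian_nonpos_of_max (hg : SmoothMetrics Q g) (hQ : IsOpen Q)
    {q : EuclideanSpace ℝ (Fin n)} (hq : q ∈ Q) {φ : F → ℝ}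
    (hφ : ContMDiff (𝓡 p) 𝓘(ℝ, ℝ) ∞ φ) {x : F} (hx : ∀ y, φ y ≤ φ x) :
    laplacian (g q) φ x ≤ 0 := by
  have hy : extChartAt (𝓡 p) x x ∈ (extChartAt (𝓡 p) x).target := mem_extChartAt_target x
  rw [hg.laplacian_eq_lapCoord hQ hq hφ x (mem_extChartAt_source x)]
  refine lapCoord_nonpos_of_isLocalMax (hg.contDiffAt_gramMatrix hQ hq x hy)
    (gramMatrix_posDef (g q) x hy) (contDiffAt_rep hφ x hy) (Eventually.of_forall fun z => ?_)
  rw [rep, rep, extChartAt_to_inv]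
  exact hx _

lemma SmoothMetrics.contDiffOn_inv (hg : SmoothMetrics Q g) (hQ : IsOpen Q) (c : F) (i j : Fin p) :
    ContDiffOn ℝ ∞ (fun z : EuclideanSpace ℝ (Fin p) × EuclideanSpace ℝ (Fin n) =>
      (gramMatrix (g z.2) c z.1)⁻¹ i j) ((extChartAt (𝓡 p) c).target ×ˢ Q) := fun z hz =>
  (contDiffAt_matrix_inv (fun a b => (contDiffOn_gramMatrix hg c a b).contDiffAt
    (((isOpen_extChartAt_target c).prod hQ).mem_nhds hz))
    (gramMatrix_posDef (g z.2) c hz.1).det_pos.ne' i j).contDiffWithinAt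

lemma SmoothMetrics.contDiffOn_sqrt_det (hg : SmoothMetrics Q g) (hQ : IsOpen Q) (c : F) :
    ContDiffOn ℝ ∞ (fun z : EuclideanSpace ℝ (Fin p) × EuclideanSpace ℝ (Fin n) =>
      Real.sqrt (gramMatrix (g z.2) c z.1).det) ((extChartAt (𝓡 p) c).target ×ˢ Q) := fun z hz =>
  (contDiffAt_sqrt_det (fun a b => (contDiffOn_gramMatrix hg c a b).contDiffAt
    (((isOpen_extChartAt_target c).prod hQ).mem_nhds hz))
    (gramMatrix_posDef (g z.2) c hz.1).det_pos).contDiffWithinAt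

lemma contDiffOn_partialDeriv_fst {U : Set (EuclideanSpace ℝ (Fin p))} (hU : IsOpen U)
    (hQ : IsOpen Q) {h : EuclideanSpace ℝ (Fin p) × EuclideanSpace ℝ (Fin n) → ℝ}
    (hh : ContDiffOn ℝ ∞ h (U ×ˢ Q)) (i : Fin p) :
    ContDiffOn ℝ ∞ (fun z : EuclideanSpace ℝ (Fin p) × EuclideanSpace ℝ (Fin n) =>
      partialDeriv i (fun y => h (y, z.2)) z.1) (U ×ˢ Q) := by
  have h1 := (hh.fderiv_of_isOpen (hU.prod hQ) (m := ∞) (by simp)).clm_apply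
    (contDiffOn_const (c := ((EuclideanSpace.single i (1 : ℝ), 0) :
      EuclideanSpace ℝ (Fin p) × EuclideanSpace ℝ (Fin n))))
  refine h1.congr fun z hz => ?_
  have h2 : HasFDerivAt (fun y : EuclideanSpace ℝ (Fin p) => (y, z.2))
      (ContinuousLinearMap.inl ℝ (EuclideanSpace ℝ (Fin p)) (EuclideanSpace ℝ (Fin n))) z.1 :=
    hasFDerivAt_prodMk_left _ _
  have h3 : DifferentiableAt ℝ h (z.1, z.2) :=
    (hh.contDiffAt ((hU.prod hQ).mem_nhds hz)).differentiableAt (by simp)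
  have h4 := h3.hasFDerivAt.comp z.1 h2
  change fderiv ℝ (h ∘ fun y => (y, z.2)) z.1 _ = _
  rw [h4.fderiv]
  rfl

lemma SmoothMetrics.contDiffOn_lapDrift (hg : SmoothMetrics Q g) (hQ : IsOpen Q) (c : F)
    (j : Fin p) :
    ContDiffOn ℝ ∞ (fun z : EuclideanSpace ℝ (Fin p) × EuclideanSpace ℝ (Fin n) =>
      lapDrift (gramMatrix (g z.2) c) j z.1) ((extChartAt (𝓡 p) c).target ×ˢ Q) := by
  refine ((hg.contDiffOn_sqrt_det hQ c).inv fun z hz =>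
    (Real.sqrt_pos.2 (gramMatrix_posDef (g z.2) c hz.1).det_pos).ne').mul ?_
  refine ContDiffOn.sum fun i _ => ?_
  exact contDiffOn_partialDeriv_fst (isOpen_extChartAt_target c) hQ
    ((hg.contDiffOn_sqrt_det hQ c).mul (hg.contDiffOn_inv hQ c i j)) i

/-- The Laplace-Beltrami operators of a smooth family of metrics form an elliptic family. -/
theorem SmoothMetrics.exists_ellipticFamily [CompactSpace F] (hg : SmoothMetrics Q g)
    (hQ : IsOpen Q) :
    ∃ (A : (Fin p × Fin p) ⊕ Fin p → EuclideanSpace ℝ (Fin n) → F → ℝ → ℝ)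
      (D : (Fin p × Fin p) ⊕ Fin p → (F → ℝ) → F → ℝ),
      EllipticFamily p Q (fun q => laplacian (g q)) A D := by
  obtain ⟨I, κ, a, ha⟩ := exists_finite_chartCover (p := p) (F := F)
  have hs := fun x => (κ (a x)).subset (ha x)
  -- The coefficients are g^ij and the first-order drift, and the operators are second and first
  -- partial derivatives, all read in the chart chosen for x by the finite cover. No regularity in x
  -- across charts is needed.
  refine ⟨Sum.elim
    (fun ij q x _ => (gramMatrix (g q) (κ (a x)).center
      (extChartAt (𝓡 p) (κ (a x)).center x))⁻¹ ij.1 ij.2)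
    (fun j q x _ => lapDrift (gramMatrix (g q) (κ (a x)).center) j
      (extChartAt (𝓡 p) (κ (a x)).center x)),
    Sum.elim
    (fun ij φ x => jet p 2 (κ (a x)).center φ x
      ![EuclideanSpace.single ij.1 1, EuclideanSpace.single ij.2 1])
    (fun j φ x => jet p 1 (κ (a x)).center φ x fun _ => EuclideanSpace.single j 1),
    ⟨?_, ?_, ?_, fun q hq φ hφ x hx => hg.laplacian_nonpos_of_max hQ hq hφ hx⟩⟩
  · rintro (⟨i, j⟩ | j)
    · refine isBoundedOp_jet (fun i : I => κ i) a ha one_le_two fun l => ?_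
      fin_cases l <;> simp
    · exact isBoundedOp_jet (fun i : I => κ i) a ha le_rfl fun l => by simp
  · intro q hq φ hφ x t
    have hy := (extChartAt (𝓡 p) (κ (a x)).center).map_source (hs x)
    have hw := contDiffAt_rep hφ _ hy
    change laplacian (g q) φ x = _
    rw [hg.laplacian_eq_lapCoord hQ hq hφ _ (hs x), lapCoord_eq
      (hg.contDiffAt_gramMatrix hQ hq _ hy) (gramMatrix_posDef (g q) _ hy).det_pos hw,
      Fintype.sum_sum_type, Fintype.sum_prod_type]
    simp only [Sum.elim_inl, Sum.elim_inr, jet, partialDeriv_partialDeriv_eq_iteratedFDeriv hw,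
      partialDeriv_eq_iteratedFDeriv]
  · intro T k
    have key : ∀ h : I → EuclideanSpace ℝ (Fin p) × EuclideanSpace ℝ (Fin n) → ℝ,
        (∀ i : I, ContDiffOn ℝ ∞ (h i) ((extChartAt (𝓡 p) (κ i).center).target ×ˢ Q)) →
        CkH (SupBd T) Q k (fun q x _ => h (a x) (extChartAt (𝓡 p) (κ (a x)).center x, q)) :=
      fun h hh => ckH_of_cover hQ a (fun x => extChartAt (𝓡 p) (κ (a x)).center x)
        (fun i : I => isOpen_extChartAt_target (κ i).center)
        (fun i : I => (κ i).isCompact.image_of_continuousOn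
          ((continuousOn_extChartAt (κ i).center).mono (κ i).subset))
        (fun i => (mapsTo_iff_image_subset).1 fun x hx =>
          (extChartAt (𝓡 p) (κ i).center).map_source ((κ i).subset hx))
        (fun x => mem_image_of_mem _ (ha x)) hh k
    rintro (⟨i, j⟩ | j)
    · exact key (fun l z => (gramMatrix (g z.2) (κ l).center z.1)⁻¹ i j)
        fun l => hg.contDiffOn_inv hQ _ i j
    · exact key (fun l z => lapDrift (gramMatrix (g z.2) (κ l).center) j z.1)
        fun l => hg.contDiffOn_lapDrift hQ _ j

end Laplacian

/-! ### The Cauchy problem -/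

section Cauchy

variable {p n : ℕ} {F : Type*} [TopologicalSpace F] [ChartedSpace (EuclideanSpace ℝ (Fin p)) F]
  [IsManifold (𝓡 p) ∞ F] [CompactSpace F] {Q : Set (EuclideanSpace ℝ (Fin n))} {J : Set ℝ}

lemma uniqueDiffOn_of_ordConnected (hJ : J.OrdConnected) (h : J.Nontrivial) :
    UniqueDiffOn ℝ J :=
  uniqueDiffOn_convex hJ.convex (hJ.convex.nontrivial_iff_nonempty_interior.1 h)

/-- The index is 1 because only derivatives of order at least one are controlled; f itself may be
unbounded on J. -/
lemma bddSmooth_nonlinearity (hQ : IsOpen Q) (hJQ : UniqueDiffOn ℝ (J ×ˢ Q))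
    {f : F → ℝ → EuclideanSpace ℝ (Fin n) → ℝ}
    (hf : ContMDiffOn ((𝓡 p).prod (𝓘(ℝ, ℝ).prod (𝓡 n))) 𝓘(ℝ, ℝ) ∞
      (fun z : F × ℝ × EuclideanSpace ℝ (Fin n) => f z.1 z.2.1 z.2.2) (univ ×ˢ J ×ˢ Q))
    (hf_bdd : BoundedDerivs (p := p) (J ×ˢ Q)
      (fun (x : F) (a : ℝ × EuclideanSpace ℝ (Fin n)) => f x a.1 a.2)) :
    BddSmooth J Q 1 (fun (x : F) (b : ℝ × EuclideanSpace ℝ (Fin n)) => f x b.1 b.2) := by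
  obtain ⟨I, κ, a, ha⟩ := exists_finite_chartCover (p := p) (F := F)
  have hs := fun x => (κ (a x)).subset (ha x)
  have hh : ∀ c : F, ContDiffOn ℝ ∞ (fun z : EuclideanSpace ℝ (Fin p) ×
      (ℝ × EuclideanSpace ℝ (Fin n)) => f ((extChartAt (𝓡 p) c).symm z.1) z.2.1 z.2.2)
      ((extChartAt (𝓡 p) c).target ×ˢ (J ×ˢ Q)) := fun c => by
    rw [← contMDiffOn_iff_contDiffOn]
    have h1 := (contMDiffOn_extChartAt_symm (I := 𝓡 p) (n := ∞) c).comp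
      (contDiff_fst.contMDiff.contMDiffOn (I := 𝓘(ℝ, EuclideanSpace ℝ (Fin p) ×
      (ℝ × EuclideanSpace ℝ (Fin n)))) (s := (extChartAt (𝓡 p) c).target ×ˢ (J ×ˢ Q)))
      fun z hz => hz.1
    have h2 : ContMDiffOn 𝓘(ℝ, EuclideanSpace ℝ (Fin p) × (ℝ × EuclideanSpace ℝ (Fin n)))
      𝓘(ℝ, ℝ) ∞ (fun z : EuclideanSpace ℝ (Fin p) × (ℝ × EuclideanSpace ℝ (Fin n)) => z.2.1)
      ((extChartAt (𝓡 p) c).target ×ˢ (J ×ˢ Q)) :=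
        (contDiff_fst.comp contDiff_snd).contMDiff.contMDiffOn
    have h3 : ContMDiffOn 𝓘(ℝ, EuclideanSpace ℝ (Fin p) × (ℝ × EuclideanSpace ℝ (Fin n)))
      (𝓡 n) ∞ (fun z : EuclideanSpace ℝ (Fin p) × (ℝ × EuclideanSpace ℝ (Fin n)) => z.2.2)
      ((extChartAt (𝓡 p) c).target ×ˢ (J ×ˢ Q)) :=
        (contDiff_snd.comp contDiff_snd).contMDiff.contMDiffOn
    exact hf.comp (h1.prodMk (h2.prodMk h3)) fun z hz => ⟨mem_univ _, hz.2⟩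
  have h := bddSmooth_of_cover hQ hJQ a (fun x => extChartAt (𝓡 p) (κ (a x)).center x)
    (U := fun i : I => (extChartAt (𝓡 p) (κ i).center).target)
    (fun i => isOpen_extChartAt_target (κ i).center)
    (fun x => (extChartAt (𝓡 p) (κ (a x)).center).map_source (hs x))
    (h := fun i z => f ((extChartAt (𝓡 p) (κ i).center).symm z.1) z.2.1 z.2.2)
    (fun i => hh _) (m := 1) fun k hk i q₀ hq₀ => by
      obtain ⟨C, hC⟩ := hf_bdd k hk (κ i).center (κ i).carrier (κ i).isCompact (κ i).subset
      refine ⟨C, ?_⟩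
      filter_upwards [hQ.mem_nhds hq₀] with q hq x hx s hsJ
      have hxi : x ∈ (κ i).carrier := hx ▸ ha x
      rw [hx]
      exact hC x hxi (s, q) ⟨hsJ, hq⟩
  convert h using 3 with x b
  exact congrArg (fun y => f y b.1 b.2)
    ((extChartAt (𝓡 p) (κ (a x)).center).left_inv (hs x)).symm

lemma ckH_of_contMDiffOn (hQ : IsOpen Q) {u₀ : F → EuclideanSpace ℝ (Fin n) → ℝ}
    (hu₀ : ContMDiffOn ((𝓡 p).prod (𝓡 n)) 𝓘(ℝ, ℝ) ∞
      (fun z : F × EuclideanSpace ℝ (Fin n) => u₀ z.1 z.2) (univ ×ˢ Q)) (T : ℝ) (k : ℕ) :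
    CkH (SupBd T) Q k (fun q x _ => u₀ x q) := by
  obtain ⟨I, κ, a, ha⟩ := exists_finite_chartCover (p := p) (F := F)
  have hs := fun x => (κ (a x)).subset (ha x)
  have hh : ∀ c : F, ContDiffOn ℝ ∞ (fun z : EuclideanSpace ℝ (Fin p) ×
      EuclideanSpace ℝ (Fin n) => u₀ ((extChartAt (𝓡 p) c).symm z.1) z.2)
      ((extChartAt (𝓡 p) c).target ×ˢ Q) := fun c => by
    rw [← contMDiffOn_iff_contDiffOn]
    have h1 := (contMDiffOn_extChartAt_symm (I := 𝓡 p) (n := ∞) c).comp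
      (contDiff_fst.contMDiff.contMDiffOn (I := 𝓘(ℝ, EuclideanSpace ℝ (Fin p) ×
      EuclideanSpace ℝ (Fin n))) (s := (extChartAt (𝓡 p) c).target ×ˢ Q)) fun z hz => hz.1
    have h2 : ContMDiffOn 𝓘(ℝ, EuclideanSpace ℝ (Fin p) × EuclideanSpace ℝ (Fin n))
      (𝓡 n) ∞ (fun z : EuclideanSpace ℝ (Fin p) × EuclideanSpace ℝ (Fin n) => z.2)
      ((extChartAt (𝓡 p) c).target ×ˢ Q) := contDiff_snd.contMDiff.contMDiffOn
    exact hu₀.comp (h1.prodMk h2) fun z hz => ⟨mem_univ _, hz.2⟩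
  have h := ckH_of_cover (T := T) hQ a (fun x => extChartAt (𝓡 p) (κ (a x)).center x)
    (fun i : I => isOpen_extChartAt_target (κ i).center)
    (fun i : I => (κ i).isCompact.image_of_continuousOn
      ((continuousOn_extChartAt (κ i).center).mono (κ i).subset))
    (fun i => (mapsTo_iff_image_subset).1 fun x hx =>
      (extChartAt (𝓡 p) (κ i).center).map_source ((κ i).subset hx))
    (fun x => mem_image_of_mem _ (ha x))
    (h := fun i z => u₀ ((extChartAt (𝓡 p) (κ i).center).symm z.1) z.2) (fun i => hh _) k
  convert h using 5 with q x t
  exact ((extChartAt (𝓡 p) (κ (a x)).center).left_inv (hs x)).symm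

/-- Solutions of the Cauchy problem with bounded spatial derivatives depend smoothly on the
parameter. -/
theorem contMDiffOn_of_isSolution (hQ : IsOpen Q)
    {g : EuclideanSpace ℝ (Fin n) →
      ContMDiffRiemannianMetric (𝓡 p) ∞ (EuclideanSpace ℝ (Fin p))
        (fun x : F => TangentSpace (𝓡 p) x)} (hg : SmoothMetrics Q g)
    (hJ : J.OrdConnected) {f : F → ℝ → EuclideanSpace ℝ (Fin n) → ℝ}
    (hf : ContMDiffOn ((𝓡 p).prod (𝓘(ℝ, ℝ).prod (𝓡 n))) 𝓘(ℝ, ℝ) ∞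
      (fun z : F × ℝ × EuclideanSpace ℝ (Fin n) => f z.1 z.2.1 z.2.2) (univ ×ˢ J ×ˢ Q))
    (hf_bdd : BoundedDerivs (p := p) (J ×ˢ Q)
      (fun (x : F) (a : ℝ × EuclideanSpace ℝ (Fin n)) => f x a.1 a.2))
    {u₀ : F → EuclideanSpace ℝ (Fin n) → ℝ}
    (hu₀ : ContMDiffOn ((𝓡 p).prod (𝓡 n)) 𝓘(ℝ, ℝ) ∞
      (fun z : F × EuclideanSpace ℝ (Fin n) => u₀ z.1 z.2) (univ ×ˢ Q))
    {T : ℝ} (hT : 0 ≤ T) {u : F → ℝ → EuclideanSpace ℝ (Fin n) → ℝ}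
    (hu : ∀ q ∈ Q, IsSolution (g q) J T (fun x s => f x s q) (fun x => u₀ x q)
      (fun x t => u x t q))
    (hu_smooth : ∀ q ∈ Q, ∀ t ∈ Icc 0 T, ContMDiff (𝓡 p) 𝓘(ℝ, ℝ) ∞ (fun x => u x t q))
    (hu_bdd : BoundedSpaceDerivs (p := p) (Icc 0 T ×ˢ Q)
      (fun (a : ℝ × EuclideanSpace ℝ (Fin n)) (x : F) => u x a.1 a.2)) :
    ∀ t ∈ Icc 0 T, ContMDiffOn ((𝓡 p).prod (𝓡 n)) 𝓘(ℝ, ℝ) ∞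
      (fun z : F × EuclideanSpace ℝ (Fin n) => u z.1 t z.2) (univ ×ˢ Q) := by
  intro t ht
  -- If J has at most one point, derivatives within J × Q are not unique, but then u is constant on
  -- F × [0, T] × Q and the claim is trivial.
  rcases J.subsingleton_or_nontrivial with hJs | hJn
  · intro z hz
    have h1 : ContMDiffOn ((𝓡 p).prod (𝓡 n)) 𝓘(ℝ, ℝ) ∞
        (fun _ : F × EuclideanSpace ℝ (Fin n) => u z.1 t z.2) (univ ×ˢ Q) := contMDiffOn_const
    exact h1.congr (fun z' hz' => hJs ((hu _ hz'.2).mem _ t ht) ((hu _ hz.2).mem _ t ht)) z hz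
  · have hJQ := (uniqueDiffOn_of_ordConnected hJ hJn).prod hQ.uniqueDiffOn
    obtain ⟨A, D, hE⟩ := hg.exists_ellipticFamily hQ
    set v : EuclideanSpace ℝ (Fin n) → F → ℝ → ℝ := fun q x t => u x t q with hv
    have hs : Sol p Q T (fun q => laplacian (g q)) v
        (subst (fun (x : F) (b : ℝ × EuclideanSpace ℝ (Fin n)) => f x b.1 b.2) v) := by
      refine ⟨fun q hq => (hu q hq).continuousOn, hu_smooth,
        fun q hq x t ht => (hu q hq).equation x t ht, fun κ j hj q₀ hq₀ => ?_⟩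
      obtain ⟨C, hC⟩ := hu_bdd j hj κ.center κ.carrier κ.isCompact κ.subset
      refine ⟨C, ?_⟩
      filter_upwards [hQ.mem_nhds hq₀] with q hq
      exact ⟨hu_smooth q hq, fun t ht x hx => hC x hx (t, q) ⟨ht, hq⟩⟩
    exact contMDiffOn_of_ckH hQ (v := v) (fun k => hs.ckH_of_semilinear hE hQ hT hJ.convex hJQ
      (bddSmooth_nonlinearity hQ hJQ hf hf_bdd) (fun q hq x t ht => (hu q hq).mem x t ht)
      (fun k => ckH_of_contMDiffOn hQ hu₀ T k) (fun q hq x => (hu q hq).initial x) k) ht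

end Cauchy

end ParamHeat

end

theorem mainTheorem12 {p n : ℕ}
    -- a closed manifold `F` of dimension `p`
    {F : Type*} [TopologicalSpace F] [ChartedSpace (EuclideanSpace ℝ (Fin p)) F]
    [IsManifold (𝓡 p) ∞ F] [CompactSpace F] [T2Space F]
    -- the parameter domain, and a metric on `F` depending smoothly on the parameter
    (Q : Set (EuclideanSpace ℝ (Fin n))) (hQ : IsOpen Q)
    (g : EuclideanSpace ℝ (Fin n) →
      ContMDiffRiemannianMetric (𝓡 p) ∞ (EuclideanSpace ℝ (Fin p))
        (fun x : F => TangentSpace (𝓡 p) x))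
    (hg : ContMDiffOn ((𝓡 p).prod (𝓡 n))
      ((𝓡 p).prod
        𝓘(ℝ, EuclideanSpace ℝ (Fin p) →L[ℝ] EuclideanSpace ℝ (Fin p) →L[ℝ] ℝ)) ∞
      (fun z : F × EuclideanSpace ℝ (Fin n) =>
        TotalSpace.mk' (EuclideanSpace ℝ (Fin p) →L[ℝ] EuclideanSpace ℝ (Fin p) →L[ℝ] ℝ)
          (E := fun x : F => TangentSpace (𝓡 p) x →L[ℝ] TangentSpace (𝓡 p) x →L[ℝ] ℝ)
          z.1 ((g z.2).inner z.1))
      (univ ×ˢ Q))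
    -- the nonlinearity `f : F × J × Q → ℝ`
    (J : Set ℝ) (hJ : J.OrdConnected)
    (f : F → ℝ → EuclideanSpace ℝ (Fin n) → ℝ)
    (hf : ContMDiffOn ((𝓡 p).prod (𝓘(ℝ, ℝ).prod (𝓡 n))) 𝓘(ℝ, ℝ) ∞
      (fun z : F × ℝ × EuclideanSpace ℝ (Fin n) => f z.1 z.2.1 z.2.2) (univ ×ˢ J ×ˢ Q))
    (hf_bdd : ParamHeat.BoundedDerivs (p := p) (J ×ˢ Q)
      (fun (x : F) (a : ℝ × EuclideanSpace ℝ (Fin n)) => f x a.1 a.2))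
    -- the initial value `u₀ : F × Q → J`
    (u₀ : F → EuclideanSpace ℝ (Fin n) → ℝ)
    (hu₀_mem : ∀ x, ∀ q ∈ Q, u₀ x q ∈ J)
    (hu₀ : ContMDiffOn ((𝓡 p).prod (𝓡 n)) 𝓘(ℝ, ℝ) ∞
      (fun z : F × EuclideanSpace ℝ (Fin n) => u₀ z.1 z.2) (univ ×ˢ Q))
    (hu₀_bdd : ParamHeat.BoundedDerivs (p := p) Q u₀)
    -- the solution `u : F × [0,T] × Q → ℝ`, unique for every `q`, with bounded `x`-derivatives
    (T : ℝ) (hT : 0 < T)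
    (u : F → ℝ → EuclideanSpace ℝ (Fin n) → ℝ)
    (hu : ∀ q ∈ Q, ParamHeat.IsSolution (g q) J T (fun x s => f x s q) (fun x => u₀ x q)
      (fun x t => u x t q))
    (hu_unique : ∀ q ∈ Q, ∀ v : F → ℝ → ℝ,
      ParamHeat.IsSolution (g q) J T (fun x s => f x s q) (fun x => u₀ x q) v →
        ∀ x, ∀ t ∈ Icc 0 T, v x t = u x t q)
    (hu_smooth : ∀ q ∈ Q, ∀ t ∈ Icc 0 T, ContMDiff (𝓡 p) 𝓘(ℝ, ℝ) ∞ (fun x => u x t q))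
    (hu_bdd : ParamHeat.BoundedSpaceDerivs (p := p) (Icc 0 T ×ˢ Q)
      (fun (a : ℝ × EuclideanSpace ℝ (Fin n)) (x : F) => u x a.1 a.2)) :
    ∀ t ∈ Icc 0 T, ContMDiffOn ((𝓡 p).prod (𝓡 n)) 𝓘(ℝ, ℝ) ∞
      (fun z : F × EuclideanSpace ℝ (Fin n) => u z.1 t z.2) (univ ×ˢ Q) := by
  exact ParamHeat.contMDiffOn_of_isSolution hQ hg hJ hf hf_bdd hu₀ hT.le hu hu_smooth hu_bdd
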